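/- Let $\mathbb{k}$ be an algebraically closed field of characteristic zero (for example $\mathbb{C}$). Work in propositional intuitionistic linear logic with connectives $\otimes,\&,\multimap,!$, with its Sweedler semantics $\llbracket-\rrbracket$ in $\mathbb{k}$-vector spaces for an arbitrary choice of vector spaces for the atoms: $\llbracket A\otimes B\rrbracket=\llbracket A\rrbracket\otimes\llbracket B\rrbracket$, $\llbracket A\,\&\,B\rrbracket=\llbracket A\rrbracket\oplus\llbracket B\rrbracket$, $\llbracket A\multimap B\rrbracket=\operatorname{Hom}_{\mathbb{k}}(\llbracket A\rrbracket,\llbracket B\rrbracket)$, and $\llbracket !A\rrbracket={!}\llbracket A\rrbracket$, where ${!}V=\bigoplus_{P\in V}\operatorname{Sym}_P(V)$ is the cofree cocommutative coalgebra on $V$; promotion is interpreted by the universal lifting to a morphism of coalgebras, dereliction by the universal map $d:{!}V\to V$, contraction by the comultiplication and weakening by the counit. For $v_1,\dots,v_s\in V$ write $|v_1,\dots,v_s\rangle_P$ for the product $v_1\cdots v_s$ in the summand $\operatorname{Sym}_P(V)=\operatorname{Sym}(V)$ of ${!}V$. Proofs are considered equal if they are equivalent under cut-elimination. Let $\psi$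 be a plain proof of ${!}A_1,\dots,{!}A_r\vdash B$ with linear part $\pi:n_1A_1,\dots,n_rA_r\vdash B$, where $n_i\ge 0$. That is, $\pi$ is a proof which uses no promotion, dereliction, contraction or weakening, and $\psi$ is equivalent under cut-elimination to the proof obtained from $\pi$ by dereliction of all its hypotheses, followed by the contraction of the $n_i$ copies of ${!}A_i$ to a single ${!}A_i$ (a weakening if $n_i=0$) for each $i$. For each $i$ let a finite enumerated set of proofs of $\vdash A_i$, with members denoted $0,1,\dots,p_i$, be given, and let $\mathcal{Q}$ be a finite set of proofs of $\vdash B$ such that $(\llbracket\tau\rrbracket)_{\tau\in\mathcal{Q}}$ is linearly independent in $\llbracket B\rrbracket$. An error syndrome $\gamma$ is a sequence of functions $\gamma_i:\{1,\dots,n_i\}\to\{0,\dots,p_i\}$, $1\le i\le r$. Its weight is $\operatorname{wt}(\gamma)=(\mathbf{s}^1,\dots,\mathbf{s}^r)\in\prod_i\mathbb{N}^{p_i}$ with $s^i_j=|\gamma_i^{-1}(j)|$ for $1\le j\le p_i$, and $\operatorname{eval}(\pi,\gamma)=\pi(\gamma_1(1),\dots,\gamma_1(n_1),\dots,\gamma_r(1),\dots,\gamma_r(n_r))$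 is the proof of $\vdash B$ obtained by cutting the hypotheses of $\pi$ against the proofs selected by $\gamma$. Assume that $\operatorname{eval}(\pi,\gamma)\in\mathcal{Q}$ for every error syndrome $\gamma$. Then for every $\mathbf{k}=(\mathbf{k}^1,\dots,\mathbf{k}^r)$ with $\mathbf{k}^i\in\mathbb{N}^{p_i}$, $$\llbracket\psi\rrbracket\Big(\bigotimes_{i=1}^r\Big|(\llbracket1\rrbracket-\llbracket0\rrbracket)^{\otimes k^i_1},\dots,(\llbracket p_i\rrbracket-\llbracket0\rrbracket)^{\otimes k^i_{p_i}}\Big\rangle_{\llbracket0\rrbracket}\Big)=\sum_{\tau\in\mathcal{Q}}\ \sum_{\mathbf{0}\le\mathbf{s}\le\mathbf{k}}S^{\mathbf{k}}_{\mathbf{s}}A^{\mathbf{s}}_\tau\,\llbracket\tau\rrbracket ,$$ where $v^{\otimes k}$ inside a ket means that $v$ is repeated $k$ times, $\mathbf{s}\le\mathbf{k}$ means $s^i_j\le k^i_j$ for all $i,j$, $$A^{\mathbf{s}}_\tau=\big|\{\gamma\mid\operatorname{wt}(\gamma)=\mathbf{s}\text{ and }\operatorname{eval}(\pi,\gamma)=\tau\}\big|,$$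 and, with $|\mathbf{s}^i|=\sum_js^i_j$ and $|\mathbf{k}^i|=\sum_jk^i_j$, $$S^{\mathbf{k}}_{\mathbf{s}}=\prod_{i=1}^r\Big\{\delta_{n_i\ge|\mathbf{k}^i|}\,(-1)^{|\mathbf{k}^i|-|\mathbf{s}^i|}\,\frac{(n_i-|\mathbf{s}^i|)!}{(n_i-|\mathbf{k}^i|)!}\prod_{j=1}^{p_i}\frac{k^i_j!}{(k^i_j-s^i_j)!}\Big\}$$ (a factor with $n_i<|\mathbf{k}^i|$ being $0$). -/

import Mathlib

open scoped TensorProduct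

namespace ILL

universe u w

/-! ## Formulas, sequents and proofs of intuitionistic linear logic -/

/-- Formulas of propositional intuitionistic linear logic over a type `α` of atoms, with the
connectives `⊗`, `&`, `⊸` and `!`. -/
inductive Formula (α : Type w) : Type w
  | atom (a : α)
  | tensor (A B : Formula α)
  | amp (A B : Formula α)
  | lolli (A B : Formula α)
  | bang (A : Formula α)

/-- The left-hand sides of sequents: finite sequences of formulas. The comma is kept as a formal
binary operation with an empty context; reassociation, deletion of empty contexts and permutation
are all performed by the exchange rule. -/
inductive Ctx (α : Type w) : Type w
  | nil
  | single (A : Formula α)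
  | comma (Γ Δ : Ctx α)

infixr:67 " ,, " => Ctx.comma

variable {α : Type w}

instance : Coe (Formula α) (Ctx α) := ⟨Ctx.single⟩

namespace Ctx

/-- `!Γ`: put `!` in front of every formula of a context. -/
def bang : Ctx α → Ctx α
  | nil => nil
  | single A => single (Formula.bang A)
  | comma Γ Δ => comma (bang Γ) (bang Δ)

/-- The concatenation `Γ₁, …, Γᵣ` of a finite family of contexts. -/
def join : {r : ℕ} → (Fin r → Ctx α) → Ctx α
  | 0, _ => nil
  | _ + 1, Γ => comma (Γ 0) (join fun i => Γ i.succ)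

/-- The context consisting of `m` copies of `A`. -/
def copies (m : ℕ) (A : Formula α) : Ctx α := join fun _ : Fin m => single A

/-- The positions of a context, i.e. the occurrences of formulas in it. -/
def Pos : Ctx α → Type
  | nil => Empty
  | single _ => Unit
  | comma Γ Δ => Pos Γ ⊕ Pos Δ

end Ctx

open Ctx

/-- Instances of the exchange rule: the rearrangements of the formulas of `Γ` into `Δ`. -/
inductive Exch : Ctx α → Ctx α → Type w
  | refl (Γ : Ctx α) : Exch Γ Γ
  | symm {Γ Δ : Ctx α} (e : Exch Γ Δ) : Exch Δ Γ
  | trans {Γ Δ Θ : Ctx α} (e : Exch Γ Δ) (f : Exch Δ Θ) : Exch Γ Θ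
  | congr {Γ Γ' Δ Δ' : Ctx α} (e : Exch Γ Γ') (f : Exch Δ Δ') : Exch (Γ ,, Δ) (Γ' ,, Δ')
  | comm (Γ Δ : Ctx α) : Exch (Γ ,, Δ) (Δ ,, Γ)
  | assoc (Γ Δ Θ : Ctx α) : Exch ((Γ ,, Δ) ,, Θ) (Γ ,, Δ ,, Θ)
  | lunit (Γ : Ctx α) : Exch (nil ,, Γ) Γ

namespace Exch

/-- The permutation of positions carried out by an exchange. -/
def perm : {Γ Δ : Ctx α} → Exch Γ Δ → (Γ.Pos ≃ Δ.Pos)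
  | _, _, refl Γ => Equiv.refl Γ.Pos
  | _, _, symm e => e.perm.symm
  | _, _, trans e f => e.perm.trans f.perm
  | _, _, congr e f => Equiv.sumCongr e.perm f.perm
  | _, _, comm Γ Δ => Equiv.sumComm Γ.Pos Δ.Pos
  | _, _, assoc Γ Δ Θ => Equiv.sumAssoc Γ.Pos Δ.Pos Θ.Pos
  | _, _, lunit Γ => Equiv.emptySum Empty Γ.Pos

/-- `Γ, ∅ ≅ Γ`. -/
def runit (Γ : Ctx α) : Exch (Γ ,, nil) Γ := (comm Γ nil).trans (lunit Γ)

/-- `Γ ≅ Γ, ∅`. -/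
def runitInv (Γ : Ctx α) : Exch Γ (Γ ,, nil) := (runit Γ).symm

/-- `Γ, (Δ, Θ) ≅ (Γ, Δ), Θ`. -/
def unassoc (Γ Δ Θ : Ctx α) : Exch (Γ ,, Δ ,, Θ) ((Γ ,, Δ) ,, Θ) := (assoc Γ Δ Θ).symm

/-- `Γ, Δ, Θ ≅ Δ, Γ, Θ`. -/
def lcomm (Γ Δ Θ : Ctx α) : Exch (Γ ,, Δ ,, Θ) (Δ ,, Γ ,, Θ) :=
  ((unassoc Γ Δ Θ).trans (congr (comm Γ Δ) (refl Θ))).trans (assoc Δ Γ Θ)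

/-- An exchange in `Γ` applied to `Γ, Θ`. -/
def left {Γ Δ : Ctx α} (e : Exch Γ Δ) (Θ : Ctx α) : Exch (Γ ,, Θ) (Δ ,, Θ) := congr e (refl Θ)

/-- An exchange in `Γ` applied to `Θ, Γ`. -/
def right (Θ : Ctx α) {Γ Δ : Ctx α} (e : Exch Γ Δ) : Exch (Θ ,, Γ) (Θ ,, Δ) := congr (refl Θ) e

/-- `(Γ₁, Γ₂), (Δ₁, Δ₂) ≅ (Γ₁, Δ₁), (Γ₂, Δ₂)`. -/
def interchange (Γ₁ Γ₂ Δ₁ Δ₂ : Ctx α) :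
    Exch ((Γ₁ ,, Γ₂) ,, Δ₁ ,, Δ₂) ((Γ₁ ,, Δ₁) ,, Γ₂ ,, Δ₂) :=
  ((assoc Γ₁ Γ₂ (Δ₁ ,, Δ₂)).trans (right Γ₁ (lcomm Γ₂ Δ₁ Δ₂))).trans (unassoc Γ₁ Δ₁ (Γ₂ ,, Δ₂))

/-- The same exchange after putting `!` in front of every formula. -/
def bang : {Γ Δ : Ctx α} → Exch Γ Δ → Exch Γ.bang Δ.bang
  | _, _, refl Γ => refl Γ.bang
  | _, _, symm e => symm e.bang
  | _, _, trans e f => trans e.bang f.bang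
  | _, _, congr e f => congr e.bang f.bang
  | _, _, comm Γ Δ => comm Γ.bang Δ.bang
  | _, _, assoc Γ Δ Θ => assoc Γ.bang Δ.bang Θ.bang
  | _, _, lunit Γ => lunit Γ.bang

end Exch

/-- Sequent calculus proofs: `Proof Γ A` is the type of proofs of `Γ ⊢ A`. -/
inductive Proof : Ctx α → Formula α → Type w
  /-- axiom -/
  | ax (A : Formula α) : Proof (single A) A
  /-- exchange -/
  | exch {Γ Δ : Ctx α} {A : Formula α} (e : Exch Γ Δ) (π : Proof Γ A) : Proof Δ A
  /-- cut -/
  | cut {Γ Δ : Ctx α} {A B : Formula α} (π : Proof Γ A) (θ : Proof (A ,, Δ) B) : Proof (Γ ,, Δ) B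
  /-- right introduction of `⊗` -/
  | tensorR {Γ Δ : Ctx α} {A B : Formula α} (π : Proof Γ A) (θ : Proof Δ B) :
      Proof (Γ ,, Δ) (A.tensor B)
  /-- left introduction of `⊗` -/
  | tensorL {Γ : Ctx α} {A B C : Formula α} (θ : Proof ((single A ,, single B) ,, Γ) C) :
      Proof (A.tensor B ,, Γ) C
  /-- right introduction of `&` -/
  | withR {Γ : Ctx α} {A B : Formula α} (π : Proof Γ A) (θ : Proof Γ B) : Proof Γ (A.amp B)
  /-- first left introduction of `&` -/
  | withL₁ {Γ : Ctx α} {A : Formula α} (B : Formula α) {C : Formula α} (θ : Proof (A ,, Γ) C) :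
      Proof (A.amp B ,, Γ) C
  /-- second left introduction of `&` -/
  | withL₂ {Γ : Ctx α} (A : Formula α) {B C : Formula α} (θ : Proof (B ,, Γ) C) :
      Proof (A.amp B ,, Γ) C
  /-- right introduction of `⊸` -/
  | lolliR {Γ : Ctx α} {A B : Formula α} (π : Proof (A ,, Γ) B) : Proof Γ (A.lolli B)
  /-- left introduction of `⊸` -/
  | lolliL {Γ Δ : Ctx α} {A B C : Formula α} (π : Proof Γ A) (θ : Proof (B ,, Δ) C) :
      Proof (A.lolli B ,, Γ ,, Δ) C
  /-- promotion -/
  | prom (Γ : Ctx α) {A : Formula α} (π : Proof Γ.bang A) : Proof Γ.bang A.bang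
  /-- dereliction -/
  | der {Γ : Ctx α} {A B : Formula α} (θ : Proof (A ,, Γ) B) : Proof (A.bang ,, Γ) B
  /-- weakening -/
  | wk {Γ : Ctx α} (A : Formula α) {B : Formula α} (θ : Proof Γ B) : Proof (A.bang ,, Γ) B
  /-- contraction -/
  | ctr {Γ : Ctx α} {A B : Formula α} (θ : Proof ((single A.bang ,, single A.bang) ,, Γ) B) :
      Proof (A.bang ,, Γ) B

namespace Proof

/-- A proof is linear if it uses no logical rules but the introduction rules of `⊗`, `&`, `⊸`
(that is, none of promotion, dereliction, weakening and contraction). -/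
def IsLinear : {Γ : Ctx α} → {A : Formula α} → Proof Γ A → Prop
  | _, _, ax _ => True
  | _, _, exch _ π => π.IsLinear
  | _, _, cut π θ => π.IsLinear ∧ θ.IsLinear
  | _, _, tensorR π θ => π.IsLinear ∧ θ.IsLinear
  | _, _, tensorL θ => θ.IsLinear
  | _, _, withR π θ => π.IsLinear ∧ θ.IsLinear
  | _, _, withL₁ _ θ => θ.IsLinear
  | _, _, withL₂ _ θ => θ.IsLinear
  | _, _, lolliR π => π.IsLinear
  | _, _, lolliL π θ => π.IsLinear ∧ θ.IsLinear
  | _, _, prom _ _ => False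
  | _, _, der _ => False
  | _, _, wk _ _ => False
  | _, _, ctr _ => False

/-- Weakening by all the formulas of `!Γ`. -/
def wks : (Γ : Ctx α) → {Δ : Ctx α} → {B : Formula α} → Proof Δ B → Proof (Γ.bang ,, Δ) B
  | nil, _, _, θ => exch (Exch.lunit _).symm θ
  | single A, _, _, θ => wk A θ
  | comma Γ₁ Γ₂, _, _, θ => exch (Exch.unassoc _ _ _) (wks Γ₁ (wks Γ₂ θ))

/-- Contraction of two copies of `!Γ`, formula by formula. -/
def ctrs : (Γ : Ctx α) → {Δ : Ctx α} → {B : Formula α} →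
    Proof ((Γ.bang ,, Γ.bang) ,, Δ) B → Proof (Γ.bang ,, Δ) B
  | nil, _, _, θ => exch (Exch.left (Exch.lunit _) _) θ
  | single _, _, _, θ => ctr θ
  | comma Γ₁ Γ₂, Δ, _, θ =>
      exch ((Exch.lcomm Γ₂.bang Γ₁.bang Δ).trans (Exch.unassoc Γ₁.bang Γ₂.bang Δ))
        (ctrs Γ₂ (exch (Exch.lcomm Γ₁.bang (Γ₂.bang ,, Γ₂.bang) Δ)
          (ctrs Γ₁ (exch
            ((Exch.left (Exch.interchange Γ₁.bang Γ₂.bang Γ₁.bang Γ₂.bang) Δ).trans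
              (Exch.assoc (Γ₁.bang ,, Γ₁.bang) (Γ₂.bang ,, Γ₂.bang) Δ)) θ))))

end Proof

open Proof

/-! ## Equivalence of proofs under cut-elimination -/

/-- Equivalence under cut-elimination: the congruence generated by the cut-elimination
transformations, proofs being considered up to the placement of exchanges. -/
inductive CutEquiv : {Γ : Ctx α} → {A : Formula α} → Proof Γ A → Proof Γ A → Prop
  -- equivalence relation
  | refl {Γ : Ctx α} {A : Formula α} (π : Proof Γ A) : CutEquiv π π
  | symm {Γ : Ctx α} {A : Formula α} {π π' : Proof Γ A} : CutEquiv π π' → CutEquiv π' π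
  | trans {Γ : Ctx α} {A : Formula α} {π π' π'' : Proof Γ A} :
      CutEquiv π π' → CutEquiv π' π'' → CutEquiv π π''
  -- compatibility with all rules
  | exch_congr {Γ Δ : Ctx α} {A : Formula α} (e : Exch Γ Δ) {π π' : Proof Γ A} :
      CutEquiv π π' → CutEquiv (exch e π) (exch e π')
  | cut_congr {Γ Δ : Ctx α} {A B : Formula α} {π π' : Proof Γ A} {θ θ' : Proof (A ,, Δ) B} :
      CutEquiv π π' → CutEquiv θ θ' → CutEquiv (cut π θ) (cut π' θ')
  | tensorR_congr {Γ Δ : Ctx α} {A B : Formula α} {π π' : Proof Γ A} {θ θ' : Proof Δ B} :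
      CutEquiv π π' → CutEquiv θ θ' → CutEquiv (tensorR π θ) (tensorR π' θ')
  | tensorL_congr {Γ : Ctx α} {A B C : Formula α}
      {θ θ' : Proof ((single A ,, single B) ,, Γ) C} :
      CutEquiv θ θ' → CutEquiv (tensorL θ) (tensorL θ')
  | withR_congr {Γ : Ctx α} {A B : Formula α} {π π' : Proof Γ A} {θ θ' : Proof Γ B} :
      CutEquiv π π' → CutEquiv θ θ' → CutEquiv (withR π θ) (withR π' θ')
  | withL₁_congr {Γ : Ctx α} {A B C : Formula α} {θ θ' : Proof (A ,, Γ) C} :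
      CutEquiv θ θ' → CutEquiv (withL₁ B θ) (withL₁ B θ')
  | withL₂_congr {Γ : Ctx α} {A B C : Formula α} {θ θ' : Proof (B ,, Γ) C} :
      CutEquiv θ θ' → CutEquiv (withL₂ A θ) (withL₂ A θ')
  | lolliR_congr {Γ : Ctx α} {A B : Formula α} {π π' : Proof (A ,, Γ) B} :
      CutEquiv π π' → CutEquiv (lolliR π) (lolliR π')
  | lolliL_congr {Γ Δ : Ctx α} {A B C : Formula α} {π π' : Proof Γ A} {θ θ' : Proof (B ,, Δ) C} :
      CutEquiv π π' → CutEquiv θ θ' → CutEquiv (lolliL π θ) (lolliL π' θ')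
  | prom_congr {Γ : Ctx α} {A : Formula α} {π π' : Proof Γ.bang A} :
      CutEquiv π π' → CutEquiv (prom Γ π) (prom Γ π')
  | der_congr {Γ : Ctx α} {A B : Formula α} {θ θ' : Proof (A ,, Γ) B} :
      CutEquiv θ θ' → CutEquiv (der θ) (der θ')
  | wk_congr {Γ : Ctx α} {A B : Formula α} {θ θ' : Proof Γ B} :
      CutEquiv θ θ' → CutEquiv (wk A θ) (wk A θ')
  | ctr_congr {Γ : Ctx α} {A B : Formula α}
      {θ θ' : Proof ((single A.bang ,, single A.bang) ,, Γ) B} :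
      CutEquiv θ θ' → CutEquiv (ctr θ) (ctr θ')
  -- an exchange matters only through its permutation of the hypotheses
  | exch_perm {Γ Δ : Ctx α} {A : Formula α} (e f : Exch Γ Δ) (h : e.perm = f.perm)
      (π : Proof Γ A) : CutEquiv (exch e π) (exch f π)
  | exch_refl {Γ : Ctx α} {A : Formula α} (π : Proof Γ A) : CutEquiv (exch (Exch.refl Γ) π) π
  | exch_trans {Γ Δ Θ : Ctx α} {A : Formula α} (e : Exch Γ Δ) (f : Exch Δ Θ) (π : Proof Γ A) :
      CutEquiv (exch f (exch e π)) (exch (e.trans f) π)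
  -- exchanges of side formulas pass through all rules
  | cut_exch_left {Γ Γ' Δ : Ctx α} {A B : Formula α} (e : Exch Γ Γ') (π : Proof Γ A)
      (θ : Proof (A ,, Δ) B) :
      CutEquiv (cut (exch e π) θ) (exch (e.left Δ) (cut π θ))
  | cut_exch_right {Γ Δ Δ' : Ctx α} {A B : Formula α} (e : Exch Δ Δ') (π : Proof Γ A)
      (θ : Proof (A ,, Δ) B) :
      CutEquiv (cut π (exch (Exch.right A e) θ)) (exch (Exch.right Γ e) (cut π θ))
  | tensorR_exch_left {Γ Γ' Δ : Ctx α} {A B : Formula α} (e : Exch Γ Γ') (π : Proof Γ A)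
      (θ : Proof Δ B) :
      CutEquiv (tensorR (exch e π) θ) (exch (e.left Δ) (tensorR π θ))
  | tensorR_exch_right {Γ Δ Δ' : Ctx α} {A B : Formula α} (e : Exch Δ Δ') (π : Proof Γ A)
      (θ : Proof Δ B) :
      CutEquiv (tensorR π (exch e θ)) (exch (Exch.right Γ e) (tensorR π θ))
  | tensorL_exch {Γ Γ' : Ctx α} {A B C : Formula α} (e : Exch Γ Γ')
      (θ : Proof ((single A ,, single B) ,, Γ) C) :
      CutEquiv (tensorL (exch (Exch.right (single A ,, single B) e) θ))
        (exch (Exch.right (A.tensor B) e) (tensorL θ))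
  | withR_exch {Γ Γ' : Ctx α} {A B : Formula α} (e : Exch Γ Γ') (π : Proof Γ A) (θ : Proof Γ B) :
      CutEquiv (withR (exch e π) (exch e θ)) (exch e (withR π θ))
  | withL₁_exch {Γ Γ' : Ctx α} {A B C : Formula α} (e : Exch Γ Γ') (θ : Proof (A ,, Γ) C) :
      CutEquiv (withL₁ B (exch (Exch.right A e) θ)) (exch (Exch.right (A.amp B) e) (withL₁ B θ))
  | withL₂_exch {Γ Γ' : Ctx α} {A B C : Formula α} (e : Exch Γ Γ') (θ : Proof (B ,, Γ) C) :
      CutEquiv (withL₂ A (exch (Exch.right B e) θ)) (exch (Exch.right (A.amp B) e) (withL₂ A θ))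
  | lolliR_exch {Γ Γ' : Ctx α} {A B : Formula α} (e : Exch Γ Γ') (π : Proof (A ,, Γ) B) :
      CutEquiv (lolliR (exch (Exch.right A e) π)) (exch e (lolliR π))
  | lolliL_exch_left {Γ Γ' Δ : Ctx α} {A B C : Formula α} (e : Exch Γ Γ') (π : Proof Γ A)
      (θ : Proof (B ,, Δ) C) :
      CutEquiv (lolliL (exch e π) θ) (exch (Exch.right (A.lolli B) (e.left Δ)) (lolliL π θ))
  | lolliL_exch_right {Γ Δ Δ' : Ctx α} {A B C : Formula α} (e : Exch Δ Δ') (π : Proof Γ A)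
      (θ : Proof (B ,, Δ) C) :
      CutEquiv (lolliL π (exch (Exch.right B e) θ))
        (exch (Exch.right (A.lolli B) (Exch.right Γ e)) (lolliL π θ))
  | prom_exch {Γ Γ' : Ctx α} {A : Formula α} (e : Exch Γ Γ') (π : Proof Γ.bang A) :
      CutEquiv (prom Γ' (exch e.bang π)) (exch e.bang (prom Γ π))
  | der_exch {Γ Γ' : Ctx α} {A B : Formula α} (e : Exch Γ Γ') (θ : Proof (A ,, Γ) B) :
      CutEquiv (der (exch (Exch.right A e) θ)) (exch (Exch.right A.bang e) (der θ))
  | wk_exch {Γ Γ' : Ctx α} {A B : Formula α} (e : Exch Γ Γ') (θ : Proof Γ B) :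
      CutEquiv (wk A (exch e θ)) (exch (Exch.right A.bang e) (wk A θ))
  | ctr_exch {Γ Γ' : Ctx α} {A B : Formula α} (e : Exch Γ Γ')
      (θ : Proof ((single A.bang ,, single A.bang) ,, Γ) B) :
      CutEquiv (ctr (exch (Exch.right (single A.bang ,, single A.bang) e) θ))
        (exch (Exch.right A.bang e) (ctr θ))
  -- cut against an axiom
  | ax_cut {Δ : Ctx α} {A B : Formula α} (θ : Proof (A ,, Δ) B) : CutEquiv (cut (ax A) θ) θ
  | cut_ax {Γ : Ctx α} {A : Formula α} (π : Proof Γ A) :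
      CutEquiv (cut π (exch (Exch.runitInv (single A)) (ax A))) (exch (Exch.runitInv Γ) π)
  -- cut against cut
  | cut_assoc {Γ Δ Θ : Ctx α} {A B C : Formula α} (π : Proof Γ A) (θ : Proof (A ,, Δ) B)
      (ρ : Proof (B ,, Θ) C) :
      CutEquiv (cut (cut π θ) ρ)
        (exch (Exch.unassoc Γ Δ Θ) (cut π (exch (Exch.assoc A Δ Θ) (cut θ ρ))))
  | cut_comm {Γ Δ Θ : Ctx α} {A B C : Formula α} (π : Proof Γ A) (θ : Proof Δ B)
      (ρ : Proof (single A ,, single B ,, Θ) C) :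
      CutEquiv (cut θ (exch (Exch.lcomm Γ B Θ) (cut π ρ)))
        (exch (Exch.lcomm Γ Δ Θ)
          (cut π (exch (Exch.lcomm Δ A Θ) (cut θ (exch (Exch.lcomm A B Θ) ρ)))))
  -- expansion of axioms
  | eta_tensor (A B : Formula α) :
      CutEquiv (ax (A.tensor B))
        (exch (Exch.runit _) (tensorL (exch (Exch.runitInv _) (tensorR (ax A) (ax B)))))
  | eta_amp (A B : Formula α) :
      CutEquiv (ax (A.amp B))
        (withR (exch (Exch.runit _) (withL₁ B (exch (Exch.runitInv _) (ax A))))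
          (exch (Exch.runit _) (withL₂ A (exch (Exch.runitInv _) (ax B)))))
  | eta_lolli (A B : Formula α) :
      CutEquiv (ax (A.lolli B))
        (lolliR (exch ((Exch.right _ (Exch.runit _)).trans (Exch.comm _ _))
          (lolliL (ax A) (exch (Exch.runitInv _) (ax B)))))
  | eta_bang (A : Formula α) :
      CutEquiv (ax A.bang)
        (prom (single A) (exch (Exch.runit _) (der (exch (Exch.runitInv _) (ax A)))))
  -- principal cuts
  | cut_tensor {Γ Δ Θ : Ctx α} {A B C : Formula α} (π : Proof Γ A) (θ : Proof Δ B)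
      (ρ : Proof ((single A ,, single B) ,, Θ) C) :
      CutEquiv (cut (tensorR π θ) (tensorL ρ))
        (exch (Exch.unassoc Γ Δ Θ) (cut π (exch (Exch.lcomm Δ A Θ)
          (cut θ (exch ((Exch.assoc A B Θ).trans (Exch.lcomm A B Θ)) ρ)))))
  | cut_amp₁ {Γ Δ : Ctx α} {A B C : Formula α} (π : Proof Γ A) (θ : Proof Γ B)
      (ρ : Proof (A ,, Δ) C) :
      CutEquiv (cut (withR π θ) (withL₁ B ρ)) (cut π ρ)
  | cut_amp₂ {Γ Δ : Ctx α} {A B C : Formula α} (π : Proof Γ A) (θ : Proof Γ B)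
      (ρ : Proof (B ,, Δ) C) :
      CutEquiv (cut (withR π θ) (withL₂ A ρ)) (cut θ ρ)
  | cut_lolli {Γ Δ Θ : Ctx α} {A B C : Formula α} (π : Proof (A ,, Γ) B) (θ : Proof Δ A)
      (ρ : Proof (B ,, Θ) C) :
      CutEquiv (cut (lolliR π) (lolliL θ ρ))
        (exch ((Exch.left (Exch.comm Δ Γ) Θ).trans (Exch.assoc Γ Δ Θ)) (cut (cut θ π) ρ))
  | cut_prom_der {Γ Δ : Ctx α} {A B : Formula α} (π : Proof Γ.bang A) (θ : Proof (A ,, Δ) B) :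
      CutEquiv (cut (prom Γ π) (der θ)) (cut π θ)
  | cut_prom_wk {Γ Δ : Ctx α} {A B : Formula α} (π : Proof Γ.bang A) (θ : Proof Δ B) :
      CutEquiv (cut (prom Γ π) (wk A θ)) (wks Γ θ)
  | cut_prom_ctr {Γ Δ : Ctx α} {A B : Formula α} (π : Proof Γ.bang A)
      (θ : Proof ((single A.bang ,, single A.bang) ,, Δ) B) :
      CutEquiv (cut (prom Γ π) (ctr θ))
        (ctrs Γ (exch (Exch.unassoc Γ.bang Γ.bang Δ)
          (cut (prom Γ π) (exch (Exch.lcomm Γ.bang A.bang Δ)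
            (cut (prom Γ π)
              (exch ((Exch.assoc A.bang A.bang Δ).trans (Exch.lcomm A.bang A.bang Δ)) θ))))))
  | cut_prom_prom {Γ Δ : Ctx α} {A B : Formula α} (π : Proof Γ.bang A)
      (θ : Proof (single A.bang ,, Δ.bang) B) :
      CutEquiv (Γ := Γ.bang ,, Δ.bang) (cut (prom Γ π) (prom (single A ,, Δ) θ))
        (prom (Γ ,, Δ) (cut (prom Γ π) θ))
  -- cut against a left rule in its left premise
  | tensorL_cut {Γ Θ : Ctx α} {A B C D : Formula α} (θ : Proof ((single A ,, single B) ,, Γ) C)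
      (ρ : Proof (C ,, Θ) D) :
      CutEquiv (cut (tensorL θ) ρ)
        (exch (Exch.unassoc _ _ _) (tensorL (exch (Exch.assoc _ _ _) (cut θ ρ))))
  | withL₁_cut {Γ Θ : Ctx α} {A B C D : Formula α} (θ : Proof (A ,, Γ) C) (ρ : Proof (C ,, Θ) D) :
      CutEquiv (cut (withL₁ B θ) ρ)
        (exch (Exch.unassoc _ _ _) (withL₁ B (exch (Exch.assoc _ _ _) (cut θ ρ))))
  | withL₂_cut {Γ Θ : Ctx α} {A B C D : Formula α} (θ : Proof (B ,, Γ) C) (ρ : Proof (C ,, Θ) D) :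
      CutEquiv (cut (withL₂ A θ) ρ)
        (exch (Exch.unassoc _ _ _) (withL₂ A (exch (Exch.assoc _ _ _) (cut θ ρ))))
  | lolliL_cut {Γ Δ Θ : Ctx α} {A B C D : Formula α} (π : Proof Γ A) (θ : Proof (B ,, Δ) C)
      (ρ : Proof (C ,, Θ) D) :
      CutEquiv (cut (lolliL π θ) ρ)
        (exch ((Exch.right _ (Exch.unassoc _ _ _)).trans (Exch.unassoc _ _ _))
          (lolliL π (exch (Exch.assoc _ _ _) (cut θ ρ))))
  | der_cut {Γ Θ : Ctx α} {A B C : Formula α} (θ : Proof (A ,, Γ) B) (ρ : Proof (B ,, Θ) C) :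
      CutEquiv (cut (der θ) ρ)
        (exch (Exch.unassoc _ _ _) (der (exch (Exch.assoc _ _ _) (cut θ ρ))))
  | wk_cut {Γ Θ : Ctx α} {A B C : Formula α} (θ : Proof Γ B) (ρ : Proof (B ,, Θ) C) :
      CutEquiv (cut (wk A θ) ρ) (exch (Exch.unassoc _ _ _) (wk A (cut θ ρ)))
  | ctr_cut {Γ Θ : Ctx α} {A B C : Formula α}
      (θ : Proof ((single A.bang ,, single A.bang) ,, Γ) B) (ρ : Proof (B ,, Θ) C) :
      CutEquiv (cut (ctr θ) ρ)
        (exch (Exch.unassoc _ _ _) (ctr (exch (Exch.assoc _ _ _) (cut θ ρ))))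
  -- cut against a rule in its right premise for which the cut formula is a side formula
  | cut_tensorR_left {Γ Δ Θ : Ctx α} {A B C : Formula α} (π : Proof Γ A) (θ : Proof (A ,, Δ) B)
      (ρ : Proof Θ C) :
      CutEquiv (cut π (exch (Exch.assoc _ _ _) (tensorR θ ρ)))
        (exch (Exch.assoc _ _ _) (tensorR (cut π θ) ρ))
  | cut_tensorR_right {Γ Δ Θ : Ctx α} {A B C : Formula α} (π : Proof Γ A) (θ : Proof Δ B)
      (ρ : Proof (A ,, Θ) C) :
      CutEquiv (cut π (exch (Exch.lcomm _ _ _) (tensorR θ ρ)))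
        (exch (Exch.lcomm _ _ _) (tensorR θ (cut π ρ)))
  | cut_tensorL {Γ Δ : Ctx α} {A B C D : Formula α} (π : Proof Γ A)
      (θ : Proof ((single B ,, single C) ,, single A ,, Δ) D) :
      CutEquiv (cut π (exch (Exch.lcomm _ _ _) (tensorL θ)))
        (exch (Exch.lcomm _ _ _) (tensorL (exch (Exch.lcomm _ _ _)
          (cut π (exch (Exch.lcomm _ _ _) θ)))))
  | cut_withR {Γ Δ : Ctx α} {A B C : Formula α} (π : Proof Γ A) (θ : Proof (A ,, Δ) B)
      (ρ : Proof (A ,, Δ) C) :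
      CutEquiv (cut π (withR θ ρ)) (withR (cut π θ) (cut π ρ))
  | cut_withL₁ {Γ Δ : Ctx α} {A B C D : Formula α} (π : Proof Γ A)
      (θ : Proof (single B ,, single A ,, Δ) D) :
      CutEquiv (cut π (exch (Exch.lcomm _ _ _) (withL₁ C θ)))
        (exch (Exch.lcomm _ _ _) (withL₁ C (exch (Exch.lcomm _ _ _)
          (cut π (exch (Exch.lcomm _ _ _) θ)))))
  | cut_withL₂ {Γ Δ : Ctx α} {A B C D : Formula α} (π : Proof Γ A)
      (θ : Proof (single C ,, single A ,, Δ) D) :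
      CutEquiv (cut π (exch (Exch.lcomm _ _ _) (withL₂ B θ)))
        (exch (Exch.lcomm _ _ _) (withL₂ B (exch (Exch.lcomm _ _ _)
          (cut π (exch (Exch.lcomm _ _ _) θ)))))
  | cut_lolliR {Γ Δ : Ctx α} {A B C : Formula α} (π : Proof Γ A)
      (θ : Proof (single B ,, single A ,, Δ) C) :
      CutEquiv (cut π (lolliR θ))
        (lolliR (exch (Exch.lcomm _ _ _) (cut π (exch (Exch.lcomm _ _ _) θ))))
  | cut_lolliL_left {Γ Δ Θ : Ctx α} {A B C D : Formula α} (π : Proof Γ A)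
      (θ : Proof (A ,, Δ) B) (ρ : Proof (C ,, Θ) D) :
      CutEquiv
        (cut π (exch ((Exch.right _ (Exch.assoc _ _ _)).trans (Exch.lcomm _ _ _)) (lolliL θ ρ)))
        (exch ((Exch.right _ (Exch.assoc _ _ _)).trans (Exch.lcomm _ _ _)) (lolliL (cut π θ) ρ))
  | cut_lolliL_right {Γ Δ Θ : Ctx α} {A B C D : Formula α} (π : Proof Γ A) (θ : Proof Δ B)
      (ρ : Proof (single C ,, single A ,, Θ) D) :
      CutEquiv
        (cut π (exch ((Exch.right _ (Exch.lcomm _ _ _)).trans (Exch.lcomm _ _ _)) (lolliL θ ρ)))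
        (exch ((Exch.right _ (Exch.lcomm _ _ _)).trans (Exch.lcomm _ _ _))
          (lolliL θ (exch (Exch.lcomm _ _ _) (cut π (exch (Exch.lcomm _ _ _) ρ)))))
  | cut_der {Γ Δ : Ctx α} {A B C : Formula α} (π : Proof Γ A)
      (θ : Proof (single B ,, single A ,, Δ) C) :
      CutEquiv (cut π (exch (Exch.lcomm _ _ _) (der θ)))
        (exch (Exch.lcomm _ _ _) (der (exch (Exch.lcomm _ _ _)
          (cut π (exch (Exch.lcomm _ _ _) θ)))))
  | cut_wk {Γ Δ : Ctx α} {A B C : Formula α} (π : Proof Γ A) (θ : Proof (A ,, Δ) C) :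
      CutEquiv (cut π (exch (Exch.lcomm _ _ _) (wk B θ)))
        (exch (Exch.lcomm _ _ _) (wk B (cut π θ)))
  | cut_ctr {Γ Δ : Ctx α} {A B C : Formula α} (π : Proof Γ A)
      (θ : Proof ((single B.bang ,, single B.bang) ,, single A ,, Δ) C) :
      CutEquiv (cut π (exch (Exch.lcomm _ _ _) (ctr θ)))
        (exch (Exch.lcomm _ _ _) (ctr (exch (Exch.lcomm _ _ _)
          (cut π (exch (Exch.lcomm _ _ _) θ)))))

/-! ## Plain proofs -/

/-- A derived rule that replaces `Γ` by `Γ'` next to an arbitrary context `Δ`. -/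
abbrev Rule (Γ Γ' : Ctx α) : Type w :=
  ∀ (Δ : Ctx α) (B : Formula α), Proof (Γ ,, Δ) B → Proof (Γ' ,, Δ) B

/-- Apply a derived rule to each member of a family of contexts. -/
def Rule.join : {r : ℕ} → {Γ Γ' : Fin r → Ctx α} → (∀ i, Rule (Γ i) (Γ' i)) →
    Rule (Ctx.join Γ) (Ctx.join Γ')
  | 0, _, _, _ => fun _ _ π => π
  | _ + 1, Γ, Γ', f => fun Δ B π =>
      exch ((Exch.lcomm _ _ _).trans (Exch.unassoc _ _ _))
        (Rule.join (Γ := fun i => Γ i.succ) (Γ' := fun i => Γ' i.succ) (fun i => f i.succ)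
          (Γ' 0 ,, Δ) B
          (exch (Exch.lcomm _ _ _) (f 0 _ B (exch (Exch.assoc _ _ _) π))))

/-- Contract `m` copies of `!A` to one copy, by `m - 1` contractions if `m > 0` and by a weakening
if `m = 0`. -/
def Rule.ctrWk (A : Formula α) : (m : ℕ) → Rule (Ctx.copies m A.bang) (single A.bang)
  | 0 => fun _ _ π => wk A (exch (Exch.lunit _) π)
  | 1 => fun Δ _ π => exch (Exch.left (Exch.runit _) Δ) π
  | m + 2 => fun Δ B π =>
      ctr (exch ((Exch.lcomm _ _ _).trans (Exch.unassoc _ _ _))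
        (Rule.ctrWk A (m + 1) (single A.bang ,, Δ) B
          (exch ((Exch.assoc (single A.bang) (Ctx.copies (m + 1) A.bang) Δ).trans
            (Exch.lcomm _ _ _)) π)))

/-- Cut a hypothesis `A` against a proof of `⊢ A`. -/
def Rule.cutClosed {A : Formula α} (ρ : Proof nil A) : Rule (single A) nil :=
  fun _ _ π => cut ρ π

variable {r : ℕ}

/-- From `π : n₁ A₁, …, nᵣ Aᵣ ⊢ B` form the proof of `!A₁, …, !Aᵣ ⊢ B` that ends with derelictions
of all the hypotheses followed by contractions and weakenings. -/
def plainForm {A : Fin r → Formula α} {B : Formula α} (n : Fin r → ℕ)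
    (π : Proof (Ctx.join fun i => Ctx.copies (n i) (A i)) B) :
    Proof (Ctx.join fun i => single (A i).bang) B :=
  exch (Exch.runit _)
    (Rule.join (fun i => Rule.ctrWk (A i) (n i)) nil B
      (Rule.join (fun _ => Rule.join fun _ => fun _ _ θ => der θ) nil B
        (exch (Exch.runitInv _) π)))

/-- `ψ : !A₁, …, !Aᵣ ⊢ B` is a plain proof with linear part `π : n₁ A₁, …, nᵣ Aᵣ ⊢ B`. -/
def IsPlainWith {A : Fin r → Formula α} {B : Formula α} (n : Fin r → ℕ)
    (ψ : Proof (Ctx.join fun i => single (A i).bang) B)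
    (π : Proof (Ctx.join fun i => Ctx.copies (n i) (A i)) B) : Prop :=
  π.IsLinear ∧ CutEquiv ψ (plainForm n π)

/-- Deletion of a concatenation of empty contexts. -/
def Exch.joinNil : (m : ℕ) → {Γ : Fin m → Ctx α} → (∀ i, Exch (Γ i) nil) → Exch (Ctx.join Γ) nil
  | 0, _, _ => Exch.refl nil
  | m + 1, _, e => (Exch.congr (e 0) (joinNil m fun i => e i.succ)).trans (Exch.lunit nil)

/-- `π(ρ₁₁, …, ρ₁ₙ₁, …, ρᵣ₁, …, ρᵣₙᵣ)`: the proof of `⊢ B` obtained by cutting every hypothesis of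
`π : n₁ A₁, …, nᵣ Aᵣ ⊢ B` against a proof of `⊢ Aᵢ`. -/
def plug {A : Fin r → Formula α} {B : Formula α} {n : Fin r → ℕ}
    (π : Proof (Ctx.join fun i => Ctx.copies (n i) (A i)) B)
    (ρ : ∀ i, Fin (n i) → Proof nil (A i)) : Proof nil B :=
  exch ((Exch.runit _).trans (Exch.joinNil r fun i => Exch.joinNil (n i) fun _ => Exch.refl nil))
    (Rule.join (fun i => Rule.join fun j => Rule.cutClosed (ρ i j)) nil B
      (exch (Exch.runitInv _) π))

/-! ## Error syndromes -/

/-- Error syndromes: an error type `γᵢ(c) ∈ {0, …, pᵢ}` for each of the `nᵢ` copies of the `i`-th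
input, `0` meaning no error. -/
abbrev Syndrome (n p : Fin r → ℕ) : Type := ∀ i, Fin (n i) → Fin (p i + 1)

/-- The weight of an error syndrome: `sⁱⱼ` is the number of errors of type `j` in the `i`-th input.
Here `j : Fin (p i)` stands for the error type `j + 1 ∈ {1, …, pᵢ}`. -/
def Syndrome.wt {n p : Fin r → ℕ} (γ : Syndrome n p) : ∀ i, Fin (p i) → ℕ :=
  fun i j => (Finset.univ.filter fun c => γ i c = j.succ).card

/-- `eval(π, γ)`, where `P i j` is the `j`-th of the chosen proofs of `Aᵢ`. -/
def eval {A : Fin r → Formula α} {B : Formula α} {n p : Fin r → ℕ}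
    (π : Proof (Ctx.join fun i => Ctx.copies (n i) (A i)) B)
    (P : ∀ i, Fin (p i + 1) → Proof nil (A i)) (γ : Syndrome n p) : Proof nil B :=
  plug π fun i c => P i (γ i c)

/-- `A^s_τ`: the number of error syndromes of weight `s` that produce `τ`. -/
noncomputable def syndromeCount {A : Fin r → Formula α} {B : Formula α} {n p : Fin r → ℕ}
    (π : Proof (Ctx.join fun i => Ctx.copies (n i) (A i)) B)
    (P : ∀ i, Fin (p i + 1) → Proof nil (A i)) (s : ∀ i, Fin (p i) → ℕ) (τ : Proof nil B) : ℕ :=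
  Nat.card {γ : Syndrome n p // γ.wt = s ∧ CutEquiv (eval π P γ) τ}

/-- The coefficient `S^k_s` (used for `s ≤ k`). -/
def syndromeCoeff (𝕜 : Type u) [Field 𝕜] (n : Fin r → ℕ) {p : Fin r → ℕ}
    (k s : ∀ i, Fin (p i) → ℕ) : 𝕜 :=
  ∏ i, if ∑ j, k i j ≤ n i then
    (-1) ^ (∑ j, k i j - ∑ j, s i j) *
      (((n i - ∑ j, s i j).factorial : 𝕜) / ((n i - ∑ j, k i j).factorial : 𝕜)) *
      ∏ j, ((k i j).factorial : 𝕜) / ((k i j - s i j).factorial : 𝕜)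
  else 0

/-! ## The cofree coalgebra -/

section Coalgebra

variable (𝕜 : Type u) [Field 𝕜] (V : Type u) [AddCommGroup V] [Module 𝕜 V]

/-- `!V = ⨁_{P ∈ V} Sym_P(V)`, with its coalgebra structure as a direct sum of the coalgebras
`Sym(V)`, in which the elements of `V` are primitive. -/
abbrev Bang : Type u := V →₀ SymmetricAlgebra 𝕜 V

variable {V}

/-- The ket `|v₁, …, vₛ⟩_P ∈ Sym_P(V) ⊆ !V`. -/
noncomputable def ket (P : V) (l : List V) : Bang 𝕜 V :=
  Finsupp.single P (l.map (SymmetricAlgebra.ι 𝕜 V)).prod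

variable (V)

/-- The projection `Sym(V) → V` to the part of degree one. -/
noncomputable def symDegOne : SymmetricAlgebra 𝕜 V →ₗ[𝕜] V := by
  letI : Module 𝕜ᵐᵒᵖ V := Module.compHom _ ((RingHom.id 𝕜).fromOpposite mul_comm)
  haveI : IsCentralScalar 𝕜 V := ⟨fun _ _ => rfl⟩
  exact TrivSqZeroExt.sndHom 𝕜 V ∘ₗ
    (SymmetricAlgebra.lift (TrivSqZeroExt.inrHom 𝕜 V)).toLinearMap

/-- The universal map `d : !V → V`, with `d|∅⟩_P = P`, `d|v⟩_P = v` and `d|v₁, …, vₛ⟩_P = 0` for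
`s > 1`. -/
noncomputable def bangD : Bang 𝕜 V →ₗ[𝕜] V :=
  Finsupp.lsum 𝕜 fun P =>
    (SymmetricAlgebra.algebraMapInv (R := 𝕜) (M := V)).toLinearMap.smulRight P + symDegOne 𝕜 V

variable {V}

open scoped Classical in
/-- The morphism of coalgebras `C → !V` which lifts a linear map `φ : C → V` through `d`. It exists
uniquely, by the universal property of `!V`, for a cocommutative coalgebra `C` over an algebraically
closed field of characteristic zero. -/
noncomputable def cofreeLift {C : Type u} [AddCommGroup C] [Module 𝕜 C] [Coalgebra 𝕜 C]
    (φ : C →ₗ[𝕜] V) : C →ₗ[𝕜] Bang 𝕜 V :=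
  if h : ∃ Φ : C →ₗc[𝕜] Bang 𝕜 V, bangD 𝕜 V ∘ₗ Φ.toLinearMap = φ then h.choose.toLinearMap else 0

end Coalgebra

/-! ## The Sweedler semantics -/

section Semantics

variable {𝕜 : Type u} [Field 𝕜] (v : α → ModuleCat.{u} 𝕜)

/-- The denotation `⟦A⟧` of a formula, given vector spaces `v a` for the atoms. -/
noncomputable def Formula.den : Formula α → ModuleCat.{u} 𝕜
  | atom a => v a
  | tensor A B => ModuleCat.of 𝕜 (A.den ⊗[𝕜] B.den)
  | amp A B => ModuleCat.of 𝕜 (A.den × B.den)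
  | lolli A B => ModuleCat.of 𝕜 (A.den →ₗ[𝕜] B.den)
  | bang A => ModuleCat.of 𝕜 (Bang 𝕜 A.den)

/-- The denotation of a context: the tensor product of the denotations of its formulas. -/
noncomputable def Ctx.den : Ctx α → ModuleCat.{u} 𝕜
  | nil => ModuleCat.of 𝕜 𝕜
  | single A => A.den v
  | comma Γ Δ => ModuleCat.of 𝕜 (Γ.den ⊗[𝕜] Δ.den)

/-- The coalgebra `!⟦A₁⟧ ⊗ ⋯ ⊗ !⟦Aₘ⟧`. -/
noncomputable instance Ctx.denCoalgebra : (Γ : Ctx α) → Coalgebra 𝕜 (Γ.bang.den v)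
  | nil => inferInstanceAs (Coalgebra 𝕜 𝕜)
  | single A => inferInstanceAs (Coalgebra 𝕜 (Bang 𝕜 (A.den v)))
  | comma Γ Δ =>
      letI := Ctx.denCoalgebra Γ
      letI := Ctx.denCoalgebra Δ
      inferInstanceAs (Coalgebra 𝕜 (Γ.bang.den v ⊗[𝕜] Δ.bang.den v))

/-- The denotation of an exchange. -/
noncomputable def Exch.den : {Γ Δ : Ctx α} → Exch Γ Δ → (Γ.den v ≃ₗ[𝕜] Δ.den v)
  | _, _, refl Γ => LinearEquiv.refl 𝕜 (Γ.den v)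
  | _, _, symm e => e.den.symm
  | _, _, trans e f => e.den.trans f.den
  | _, _, congr e f => TensorProduct.congr e.den f.den
  | _, _, comm Γ Δ => TensorProduct.comm 𝕜 (Γ.den v) (Δ.den v)
  | _, _, assoc Γ Δ Θ => TensorProduct.assoc 𝕜 (Γ.den v) (Δ.den v) (Θ.den v)
  | _, _, lunit Γ => TensorProduct.lid 𝕜 (Γ.den v)

/-- The denotation `⟦π⟧ : ⟦Γ⟧ → ⟦A⟧` of a proof of `Γ ⊢ A`. -/
noncomputable def Proof.den : {Γ : Ctx α} → {A : Formula α} → Proof Γ A →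
    (Γ.den v →ₗ[𝕜] A.den v)
  | _, _, ax A => (LinearMap.id : A.den v →ₗ[𝕜] A.den v)
  | _, _, exch e π => π.den ∘ₗ (e.den v).symm.toLinearMap
  | _, _, cut (Δ := Δ) π θ => θ.den ∘ₗ TensorProduct.map π.den (LinearMap.id : Δ.den v →ₗ[𝕜] _)
  | _, _, tensorR π θ => TensorProduct.map π.den θ.den
  | _, _, tensorL θ => θ.den
  | _, _, withR π θ => LinearMap.prod π.den θ.den
  | _, _, withL₁ (Γ := Γ) (A := A) B θ =>
      θ.den ∘ₗ TensorProduct.map (LinearMap.fst 𝕜 (A.den v) (B.den v))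
        (LinearMap.id : Γ.den v →ₗ[𝕜] _)
  | _, _, withL₂ (Γ := Γ) A (B := B) θ =>
      θ.den ∘ₗ TensorProduct.map (LinearMap.snd 𝕜 (A.den v) (B.den v))
        (LinearMap.id : Γ.den v →ₗ[𝕜] _)
  | _, _, lolliR (Γ := Γ) (A := A) (B := B) π =>
      (TensorProduct.curry (show A.den v ⊗[𝕜] Γ.den v →ₗ[𝕜] B.den v from π.den)).flip
  | _, _, lolliL (Γ := Γ) (Δ := Δ) (A := A) (B := B) π θ =>
      θ.den ∘ₗ TensorProduct.map
          (TensorProduct.lift (LinearMap.id : (A.den v →ₗ[𝕜] B.den v) →ₗ[𝕜] _))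
          (LinearMap.id : Δ.den v →ₗ[𝕜] _) ∘ₗ
        (TensorProduct.assoc 𝕜 (A.den v →ₗ[𝕜] B.den v) (A.den v) (Δ.den v)).symm.toLinearMap ∘ₗ
        TensorProduct.map (LinearMap.id : (A.den v →ₗ[𝕜] B.den v) →ₗ[𝕜] _)
          (TensorProduct.map π.den (LinearMap.id : Δ.den v →ₗ[𝕜] _))
  | _, _, prom Γ (A := A) π => cofreeLift 𝕜 (V := A.den v) (C := Γ.bang.den v) π.den
  | _, _, der (Γ := Γ) (A := A) θ =>
      θ.den ∘ₗ TensorProduct.map (bangD 𝕜 (A.den v)) (LinearMap.id : Γ.den v →ₗ[𝕜] _)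
  | _, _, wk (Γ := Γ) A θ =>
      θ.den ∘ₗ (TensorProduct.lid 𝕜 (Γ.den v)).toLinearMap ∘ₗ
        TensorProduct.map (Coalgebra.counit : Bang 𝕜 (A.den v) →ₗ[𝕜] 𝕜)
          (LinearMap.id : Γ.den v →ₗ[𝕜] _)
  | _, _, ctr (Γ := Γ) (A := A) θ =>
      θ.den ∘ₗ TensorProduct.map
        (Coalgebra.comul : Bang 𝕜 (A.den v) →ₗ[𝕜] Bang 𝕜 (A.den v) ⊗[𝕜] Bang 𝕜 (A.den v))
        (LinearMap.id : Γ.den v →ₗ[𝕜] _)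

/-- The denotation `⟦ρ⟧ ∈ ⟦A⟧` of a proof of `⊢ A`. -/
noncomputable def Proof.vec {A : Formula α} (ρ : Proof nil A) : A.den v :=
  ρ.den v (1 : 𝕜)

/-- The pure tensor `x₁ ⊗ ⋯ ⊗ xᵣ` in the denotation of `Γ₁, …, Γᵣ`. -/
noncomputable def Ctx.tprod : {r : ℕ} → {Γ : Fin r → Ctx α} → (∀ i, (Γ i).den v) →
    (Ctx.join Γ).den v
  | 0, _, _ => (1 : 𝕜)
  | _ + 1, Γ, x => (x 0) ⊗ₜ[𝕜] (Ctx.tprod (Γ := fun i => Γ i.succ) fun i => x i.succ)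

end Semantics

end ILL

/-!
The proof has three parts: the semantics is sound for equivalence under cut-elimination, so `ψ` may
be replaced by the proof that ends with derelictions and contractions; this proof is evaluated on a
tensor product of kets by means of the coalgebra structure; and the resulting coefficients of the
values of `π` are identified by a recurrence.

*Soundness* (`CutEquiv.ev_eq`). Apart from promotion, every transformation is an identity of linear
maps that can be checked on pure tensors; that an exchange matters only through its permutation is
coherence for symmetric monoidal categories (`Exch.den_eq_of_perm_eq`). The transformations that
involve promotion, and the η-rule for `!`, are instances of the universal property of `!V`: a linear
map `φ : C → V` has exactly one lift through `d` to a morphism of coalgebras `C → !V`. Only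
`C = !⟦A₁⟧ ⊗ ⋯ ⊗ !⟦Aₘ⟧` occurs, so the structure theory of cocommutative coalgebras is not needed.

* Uniqueness (`coalgHom_bang_ext`). The difference of two lifts of `φ` has as its range a subspace
  of `!V` on which the counit vanishes and which is stable under the contractions
  `x ↦ x₁ · f(d x₂)`, `f` a linear form on `V`. On the summand at `P` such a contraction is
  `f(P) + ∂_f`, with `∂_f` locally nilpotent. Hence the subspace would contain a nonzero element
  supported at a single point if it were not zero, and Taylor's formula in `Sym(V)` excludes this.
* Existence (`Ctx.cofreeLift_spec`). The isomorphism `!V ⊗ !W ≅ !(V × W)` of coalgebras reduces to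
  `C = !W`. On the summand at `P` the lift goes to the summand at `φ(1_P)`, and is the exponential,
  in the convolution algebra of linear maps `Sym(W) → Sym(V)`, of the part of `φ` that vanishes
  at `1`.

*Evaluation* (`ev_plainForm`, `Formula.copyD_errKet`). Contraction followed by dereliction of `n`
copies is the map `T_n = d^{⊗ n} ∘ Δ^{(n)}`, so that `T_{n + 1} = (d ⊗ T_n) ∘ Δ`. Write `u_j` for
`⟦j⟧` and `|k⟩` for the ket at `u₀` in which `u_j - u₀` is repeated `k_j` times. Since `d` kills the
products of more than one factor,
`T_{n + 1} |k⟩ = u₀ ⊗ T_n |k⟩ + ∑ j, k_j (u_j - u₀) ⊗ T_n |k - e_j⟩`.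

*Coefficients* (`errCoeff_succ`, `errCoeff_succ_succ`). Expanding this, `T_n |k⟩` is the sum over all
`γ : {1, …, n} → {0, …, p}` of `u_{γ(1)} ⊗ ⋯ ⊗ u_{γ(n)}` with a coefficient that depends only on
the weight of `γ` and satisfies the same recurrence as the factors of `S^k_s`. Grouping the error
syndromes by their weight and by the member of `𝒬` that they produce, which is unique because the
denotations are linearly independent, gives the formula.
-/

namespace ILL
universe u w
open Ctx Proof

variable {α : Type w} {𝕜 : Type u} [Field 𝕜] (v : α → ModuleCat.{u} 𝕜)

/-! ### Denotations evaluated on pure tensors -/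

/-- The pure tensor `x ⊗ y` in the denotation of the context `Γ, Δ`. -/
noncomputable def Ctx.tm {Γ Δ : Ctx α} (x : Γ.den v) (y : Δ.den v) : (Γ ,, Δ).den v :=
  x ⊗ₜ[𝕜] y

/-- The element `1` in the denotation of the empty context. -/
noncomputable def Ctx.one : (nil : Ctx α).den v := (1 : 𝕜)

/-- The denotation of a proof of `Γ ⊢ A`, with values in the denotation of the one-formula context
`A`. The two types of values agree by definition, but only this one lets the results be used as
arguments of `Ctx.tm` without a change of type. -/
noncomputable def Proof.ev {Γ : Ctx α} {A : Formula α} (π : Proof Γ A) :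
    Γ.den v →ₗ[𝕜] (single A).den v :=
  π.den v

/-- The pure tensor `x ⊗ y` in the denotation of the formula `A ⊗ B`. -/
noncomputable def Formula.tm {A B : Formula α} (x : (single A).den v) (y : (single B).den v) :
    (single (A.tensor B)).den v :=
  (show A.den v from x) ⊗ₜ[𝕜] (show B.den v from y)

/-- Evaluation of an element of the denotation of `A ⊸ B`. -/
noncomputable def Formula.ap {A B : Formula α} (f : (single (A.lolli B)).den v)
    (x : (single A).den v) : (single B).den v :=
  (show A.den v →ₗ[𝕜] B.den v from f) x

/-- The pair `(x, y)` in the denotation of `A & B`. -/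
noncomputable def Formula.pr {A B : Formula α} (x : (single A).den v) (y : (single B).den v) :
    (single (A.amp B)).den v :=
  ((x, y) : A.den v × B.den v)

/-- The first component of an element of the denotation of `A & B`. -/
noncomputable def Formula.fst {A B : Formula α} (x : (single (A.amp B)).den v) :
    (single A).den v :=
  (show A.den v × B.den v from x).1

/-- The second component of an element of the denotation of `A & B`. -/
noncomputable def Formula.snd {A B : Formula α} (x : (single (A.amp B)).den v) :
    (single B).den v :=
  (show A.den v × B.den v from x).2

/-- The universal map `d : !⟦A⟧ → ⟦A⟧` of a formula `A`. -/
noncomputable def Formula.d (A : Formula α) :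
    (single A.bang).den v →ₗ[𝕜] (single A).den v :=
  bangD 𝕜 (A.den v)

/-- The comultiplication of `⟦!Γ⟧`. -/
noncomputable def Ctx.cm (Γ : Ctx α) : Γ.bang.den v →ₗ[𝕜] (Γ.bang ,, Γ.bang).den v :=
  Coalgebra.comul (R := 𝕜) (A := Γ.bang.den v)

/-- The counit of `⟦!Γ⟧`. -/
noncomputable def Ctx.cu (Γ : Ctx α) : Γ.bang.den v →ₗ[𝕜] 𝕜 :=
  Coalgebra.counit (R := 𝕜) (A := Γ.bang.den v)

/-- The comultiplication of `!⟦A⟧`. -/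
noncomputable def Formula.cm (A : Formula α) :
    (single A.bang).den v →ₗ[𝕜] (single A.bang ,, single A.bang).den v :=
  Coalgebra.comul (R := 𝕜) (A := Bang 𝕜 (A.den v))

/-- The counit of `!⟦A⟧`. -/
noncomputable def Formula.cu (A : Formula α) : (single A.bang).den v →ₗ[𝕜] 𝕜 :=
  Coalgebra.counit (R := 𝕜) (A := Bang 𝕜 (A.den v))

variable {v}

@[simp] theorem Formula.fst_pr {A B : Formula α} (x : (single A).den v) (y : (single B).den v) :
    fst v (pr v x y) = x := rfl

@[simp] theorem Formula.snd_pr {A B : Formula α} (x : (single A).den v) (y : (single B).den v) :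
    snd v (pr v x y) = y := rfl

@[simp] theorem Formula.pr_fst_snd {A B : Formula α} (x : (single (A.amp B)).den v) :
    pr v (fst v x) (snd v x) = x := rfl

@[simp] theorem Ctx.smul_tm {Γ Δ : Ctx α} (c : 𝕜) (x : Γ.den v) (y : Δ.den v) :
    tm v (c • x) y = c • tm v x y := TensorProduct.smul_tmul' ..

theorem Ctx.tm_ext {Γ Δ : Ctx α} {M : Type*} [AddCommMonoid M] [Module 𝕜 M]
    {f g : (Γ ,, Δ).den v →ₗ[𝕜] M} (h : ∀ x y, f (tm v x y) = g (tm v x y)) : f = g :=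
  TensorProduct.ext' h

theorem Ctx.nil_ext {M : Type*} [AddCommMonoid M] [Module 𝕜 M]
    {f g : (nil : Ctx α).den v →ₗ[𝕜] M} (h : f (one v) = g (one v)) : f = g :=
  LinearMap.ext_ring h

theorem Ctx.tensor_tm_ext {A B : Formula α} {M : Type*} [AddCommMonoid M] [Module 𝕜 M]
    {f g : (single (A.tensor B)).den v →ₗ[𝕜] M}
    (h : ∀ x y, f (Formula.tm v x y) = g (Formula.tm v x y)) : f = g :=
  TensorProduct.ext' h

theorem Formula.lolli_ext {A B : Formula α} {f g : (single (A.lolli B)).den v}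
    (h : ∀ x, Formula.ap v f x = Formula.ap v g x) : f = g :=
  LinearMap.ext (f := (show A.den v →ₗ[𝕜] B.den v from f)) h

section Exch

variable {Γ Δ Θ Γ' Δ' : Ctx α}

@[simp] theorem Exch.den_refl (x : Γ.den v) : (Exch.refl Γ).den v x = x := rfl

@[simp] theorem Exch.den_symm (e : Exch Γ Δ) (x : Δ.den v) :
    e.symm.den v x = (e.den v).symm x := rfl

@[simp] theorem Exch.den_trans (e : Exch Γ Δ) (f : Exch Δ Θ) (x : Γ.den v) :
    (e.trans f).den v x = f.den v (e.den v x) := rfl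

@[simp] theorem Exch.den_congr (e : Exch Γ Γ') (f : Exch Δ Δ') (x : Γ.den v) (y : Δ.den v) :
    (e.congr f).den v (tm v x y) = tm v (e.den v x) (f.den v y) := rfl

@[simp] theorem Exch.den_comm (x : Γ.den v) (y : Δ.den v) :
    (Exch.comm Γ Δ).den v (tm v x y) = tm v y x := rfl

@[simp] theorem Exch.den_assoc (x : Γ.den v) (y : Δ.den v) (z : Θ.den v) :
    (Exch.assoc Γ Δ Θ).den v (tm v (tm v x y) z) = tm v x (tm v y z) := rfl

@[simp] theorem Exch.den_lunit (x : Γ.den v) :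
    (Exch.lunit Γ).den v (tm v (one v) x) = x := TensorProduct.lid_tmul x 1 |>.trans (one_smul 𝕜 x)

@[simp] theorem Exch.den_refl_symm (x : Γ.den v) : ((Exch.refl Γ).den v).symm x = x := rfl

@[simp] theorem Exch.den_symm_symm (e : Exch Γ Δ) (x : Γ.den v) :
    (e.symm.den v).symm x = e.den v x := rfl

@[simp] theorem Exch.den_trans_symm (e : Exch Γ Δ) (f : Exch Δ Θ) (x : Θ.den v) :
    ((e.trans f).den v).symm x = (e.den v).symm ((f.den v).symm x) := rfl

@[simp] theorem Exch.den_congr_symm (e : Exch Γ Γ') (f : Exch Δ Δ') (x : Γ'.den v) (y : Δ'.den v) :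
    ((e.congr f).den v).symm (tm v x y) = tm v ((e.den v).symm x) ((f.den v).symm y) := rfl

@[simp] theorem Exch.den_comm_symm (x : Γ.den v) (y : Δ.den v) :
    ((Exch.comm Γ Δ).den v).symm (tm v y x) = tm v x y := rfl

@[simp] theorem Exch.den_assoc_symm (x : Γ.den v) (y : Δ.den v) (z : Θ.den v) :
    ((Exch.assoc Γ Δ Θ).den v).symm (tm v x (tm v y z)) = tm v (tm v x y) z := rfl

@[simp] theorem Exch.den_lunit_symm (x : Γ.den v) :
    ((Exch.lunit Γ).den v).symm x = tm v (one v) x := rfl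

attribute [simp] Exch.runit Exch.runitInv Exch.unassoc Exch.lcomm Exch.left Exch.right

end Exch

section Proof

variable {Γ Δ Θ : Ctx α} {A B C : Formula α}

@[simp] theorem Proof.ev_ax (x : (single A).den v) : (ax A).ev v x = x := rfl

@[simp] theorem Proof.ev_exch (e : Exch Γ Δ) (π : Proof Γ A) (x : Δ.den v) :
    (exch e π).ev v x = π.ev v ((e.den v).symm x) := rfl

@[simp] theorem Proof.ev_cut (π : Proof Γ A) (θ : Proof (A ,, Δ) B) (x : Γ.den v) (y : Δ.den v) :
    (cut π θ).ev v (tm v x y) = θ.ev v (tm v (π.ev v x) y) := rfl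

@[simp] theorem Proof.ev_tensorR (π : Proof Γ A) (θ : Proof Δ B) (x : Γ.den v) (y : Δ.den v) :
    (tensorR π θ).ev v (tm v x y) = Formula.tm v (π.ev v x) (θ.ev v y) := rfl

@[simp] theorem Proof.ev_tensorL (θ : Proof ((single A ,, single B) ,, Γ) C)
    (x : (single A).den v) (y : (single B).den v) (z : Γ.den v) :
    (tensorL θ).ev v (tm v (Formula.tm v x y) z) = θ.ev v (tm v (tm v x y) z) := rfl

@[simp] theorem Proof.ev_withR (π : Proof Γ A) (θ : Proof Γ B) (x : Γ.den v) :
    (withR π θ).ev v x = Formula.pr v (π.ev v x) (θ.ev v x) := rfl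

@[simp] theorem Proof.ev_withL₁ (θ : Proof (A ,, Γ) C) (x : (single (A.amp B)).den v)
    (z : Γ.den v) :
    (withL₁ B θ).ev v (tm v x z) = θ.ev v (tm v (Formula.fst v x) z) := rfl

@[simp] theorem Proof.ev_withL₂ (θ : Proof (B ,, Γ) C) (x : (single (A.amp B)).den v)
    (z : Γ.den v) :
    (withL₂ A θ).ev v (tm v x z) = θ.ev v (tm v (Formula.snd v x) z) := rfl

@[simp] theorem Proof.ev_lolliR (π : Proof (A ,, Γ) B) (x : Γ.den v) (a : (single A).den v) :
    Formula.ap v ((lolliR π).ev v x) a = π.ev v (tm v a x) := rfl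

@[simp] theorem Proof.ev_lolliL (π : Proof Γ A) (θ : Proof (B ,, Δ) C)
    (f : (single (A.lolli B)).den v) (x : Γ.den v) (y : Δ.den v) :
    (lolliL π θ).ev v (tm v f (tm v x y)) = θ.ev v (tm v (Formula.ap v f (π.ev v x)) y) := rfl

theorem Proof.ev_prom (π : Proof Γ.bang A) :
    (prom Γ π).ev v = cofreeLift 𝕜 (V := A.den v) (C := Γ.bang.den v) (π.ev v) := rfl

@[simp] theorem Proof.ev_der (θ : Proof (A ,, Γ) B) (x : (single A.bang).den v) (y : Γ.den v) :
    (der θ).ev v (tm v x y) = θ.ev v (tm v (A.d v x) y) := rfl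

@[simp] theorem Proof.ev_wk (θ : Proof Γ B) (x : (single A.bang).den v) (y : Γ.den v) :
    (wk A θ).ev v (tm v x y) = A.cu v x • θ.ev v y :=
  (θ.den v).map_smul _ _

@[simp] theorem Proof.ev_ctr (θ : Proof ((single A.bang ,, single A.bang) ,, Γ) B)
    (x : (single A.bang).den v) (y : Γ.den v) :
    (ctr θ).ev v (tm v x y) = θ.ev v (tm v (A.cm v x) y) := rfl

end Proof

/-! ### Coherence of exchanges -/

/-- The pure tensor of the vectors `x i (Γ i)` over the positions `i` of `Γ`, where `Γ i` denotes
the formula at position `i`. A vector is given for every formula at every position, so that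
transport of families along a permutation of positions involves no casts. -/
noncomputable def Ctx.pure (v : α → ModuleCat.{u} 𝕜) :
    (Γ : Ctx α) → (Γ.Pos → ∀ A : Formula α, A.den v) → Γ.den v
  | nil, _ => one v
  | single A, x => x () A
  | comma Γ Δ, x => tm v (Ctx.pure v Γ fun i => x (Sum.inl i)) (Ctx.pure v Δ fun i => x (Sum.inr i))

theorem Exch.den_pure : {Γ Δ : Ctx α} → (e : Exch Γ Δ) → (x : Δ.Pos → ∀ A : Formula α, A.den v) →
    e.den v (Ctx.pure v Γ fun i => x (e.perm i)) = Ctx.pure v Δ x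
  | _, _, .refl Γ, x => rfl
  | _, _, .symm e, x => by
    rw [Exch.den_symm, LinearEquiv.symm_apply_eq, ← e.den_pure]
    simp [Exch.perm]
  | _, _, .trans e f, x => by
    rw [Exch.den_trans, ← f.den_pure, ← e.den_pure]; rfl
  | _, _, .congr e f, x => by
    exact congrArg₂ (tm v) (e.den_pure fun i => x (Sum.inl i)) (f.den_pure fun i => x (Sum.inr i))
  | _, _, .comm Γ Δ, x => rfl
  | _, _, .assoc Γ Δ Θ, x => rfl
  | _, _, .lunit Γ, x => Exch.den_lunit _

/-- The pure tensors span the denotation of a context. -/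
theorem Ctx.pure_ext : {Γ : Ctx α} → {M : Type u} → [AddCommGroup M] → [Module 𝕜 M] →
    {f g : Γ.den v →ₗ[𝕜] M} → (∀ x, f (Ctx.pure v Γ x) = g (Ctx.pure v Γ x)) → f = g
  | nil, _, _, _, _, _, h => nil_ext (h fun i => i.elim)
  | single A, _, _, _, f, g, h => by
    classical
    refine LinearMap.ext fun a => ?_
    have := h fun _ => Function.update 0 A a
    have hu : (Function.update 0 A a : ∀ A : Formula α, A.den v) A = a := Function.update_self ..
    simp only [Ctx.pure] at this
    rwa [hu] at this
  | comma Γ Δ, M, _, _, f, g, h => by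
    refine TensorProduct.ext (Ctx.pure_ext fun x => Ctx.pure_ext fun y => ?_)
    exact h (Sum.elim x y)

/-- Exchanges with the same permutation of positions have the same denotation. -/
theorem Exch.den_eq_of_perm_eq {Γ Δ : Ctx α} (e f : Exch Γ Δ) (h : e.perm = f.perm) :
    e.den v = f.den v := by
  refine LinearEquiv.toLinearMap_injective (Ctx.pure_ext fun x => ?_)
  have he := e.den_pure (v := v) fun i => x (e.perm.symm i)
  have hf := f.den_pure (v := v) fun i => x (f.perm.symm i)
  simp only [Equiv.symm_apply_apply] at he hf
  change e.den v _ = f.den v _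
  rw [he, hf, h]

end ILL

namespace ILL
universe u w

/-! ### The symmetric algebra as a coalgebra -/

section Sym

variable {𝕜 : Type u} [Field 𝕜] {V : Type u} [AddCommGroup V] [Module 𝕜 V]

local notation "S" => SymmetricAlgebra 𝕜 V

@[simp] theorem symDegOne_ι (x : V) : symDegOne 𝕜 V (SymmetricAlgebra.ι 𝕜 V x) = x := by
  simp [symDegOne]

theorem symDegOne_mul (a b : S) :
    symDegOne 𝕜 V (a * b) =
      Coalgebra.counit (R := 𝕜) a • symDegOne 𝕜 V b +
        Coalgebra.counit (R := 𝕜) b • symDegOne 𝕜 V a := by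
  let _ : Module 𝕜ᵐᵒᵖ V := Module.compHom _ ((RingHom.id 𝕜).fromOpposite mul_comm)
  have : IsCentralScalar 𝕜 V := ⟨fun _ _ => rfl⟩
  have hfst : (TrivSqZeroExt.fstHom 𝕜 𝕜 V).comp
      (SymmetricAlgebra.lift (TrivSqZeroExt.inrHom 𝕜 V)) = SymmetricAlgebra.algebraMapInv := by
    ext x
    simp [SymmetricAlgebra.algebraMapInv_ι]
  have hfst' (x : S) : (SymmetricAlgebra.lift (TrivSqZeroExt.inrHom 𝕜 V) x).fst =
      Coalgebra.counit (R := 𝕜) x := DFunLike.congr_fun hfst x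
  simp only [symDegOne, LinearMap.comp_apply, AlgHom.toLinearMap_apply, map_mul,
    TrivSqZeroExt.sndHom_apply, TrivSqZeroExt.snd_mul, hfst']
  rfl

@[simp] theorem symDegOne_one : symDegOne 𝕜 V 1 = 0 := by
  simpa using symDegOne_mul (𝕜 := 𝕜) (V := V) 1 1

variable (𝕜 V) in
/-- The map `Sym(V) → Sym(V) ⊗ V` which splits off one factor of a product in all possible ways:
the part of the comultiplication whose second component has degree one. It is a derivation. -/
noncomputable def splitOff : Derivation 𝕜 (SymmetricAlgebra 𝕜 V) (SymmetricAlgebra 𝕜 V ⊗[𝕜] V) :=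
  Derivation.mk' ((symDegOne 𝕜 V).lTensor S ∘ₗ Coalgebra.comul) fun a b => by
    have hc (x : S) := Coalgebra.lTensor_counit_comul (R := 𝕜) x
    have key (X Y : S ⊗[𝕜] S) : (symDegOne 𝕜 V).lTensor S (X * Y) =
        TensorProduct.rid 𝕜 S (Coalgebra.counit.lTensor S X) • (symDegOne 𝕜 V).lTensor S Y +
        TensorProduct.rid 𝕜 S (Coalgebra.counit.lTensor S Y) • (symDegOne 𝕜 V).lTensor S X := by
      induction X with
      | zero => simp
      | add X X' hX hX' => simp only [add_mul, map_add, hX, hX', add_smul, smul_add]; abel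
      | tmul x x' =>
        induction Y with
        | zero => simp
        | add Y Y' hY hY' => simp only [mul_add, map_add, hY, hY', add_smul, smul_add]; abel
        | tmul y y' =>
          simp [symDegOne_mul, TensorProduct.tmul_add, TensorProduct.smul_tmul', mul_comm y]
    simpa [hc] using key (Coalgebra.comul a) (Coalgebra.comul b)

theorem splitOff_apply (x : S) :
    splitOff 𝕜 V x = (symDegOne 𝕜 V).lTensor S (Coalgebra.comul (R := 𝕜) x) := rfl

@[simp] theorem splitOff_ι (x : V) :
    splitOff 𝕜 V (SymmetricAlgebra.ι 𝕜 V x) = 1 ⊗ₜ x := by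
  simp [splitOff_apply]

/-- The directional derivative `∂_f` on `Sym(V)` given by a linear form `f` on `V`. -/
noncomputable def symDeriv (f : V →ₗ[𝕜] 𝕜) : Derivation 𝕜 S S :=
  ((TensorProduct.AlgebraTensorModule.rid 𝕜 S S).toLinearMap ∘ₗ f.baseChange S).compDer
    (splitOff 𝕜 V)

theorem symDeriv_apply (f : V →ₗ[𝕜] 𝕜) (x : S) :
    symDeriv f x = TensorProduct.rid 𝕜 S (f.lTensor S (splitOff 𝕜 V x)) := rfl

@[simp] theorem symDeriv_ι (f : V →ₗ[𝕜] 𝕜) (x : V) :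
    symDeriv f (SymmetricAlgebra.ι 𝕜 V x) = algebraMap 𝕜 S (f x) := by
  simp [symDeriv_apply, Algebra.algebraMap_eq_smul_one]

/-- If `∂ᵐ a = 0` and `∂ⁿ b = 0` for a derivation `∂`, then `∂ᵐ⁺ⁿ (a b) = 0`. -/
theorem derivation_iterate_mul_eq_zero {A : Type*} [CommRing A] [Algebra 𝕜 A]
    (D : Derivation 𝕜 A A) {k m n : ℕ} (h : m + n ≤ k) {a b : A}
    (ha : D^[m] a = 0) (hb : D^[n] b = 0) : D^[k] (a * b) = 0 := by
  have h0 (k : ℕ) : D^[k] 0 = 0 := iterate_map_zero D k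
  induction k generalizing m n a b with
  | zero =>
    obtain rfl : m = 0 := by omega
    simp_all
  | succ k ih =>
    obtain _ | m := m
    · simp_all
    obtain _ | n := n
    · simp_all
    rw [Function.iterate_succ_apply, D.leibniz, smul_eq_mul, smul_eq_mul, iterate_map_add,
      ih (m := m + 1) (n := n) (by omega) ha hb, ih (m := n + 1) (n := m) (by omega) hb ha,
      add_zero]

theorem symDeriv_locally_nilpotent (f : V →ₗ[𝕜] 𝕜) (x : S) : ∃ N, (symDeriv f)^[N] x = 0 := by
  induction x using SymmetricAlgebra.induction with
  | algebraMap r => exact ⟨1, by simp⟩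
  | ι x => exact ⟨2, by simp⟩
  | mul a b ha hb =>
    obtain ⟨m, hm⟩ := ha
    obtain ⟨n, hn⟩ := hb
    exact ⟨m + n, derivation_iterate_mul_eq_zero _ le_rfl hm hn⟩
  | add a b ha hb =>
    obtain ⟨m, hm⟩ := ha
    obtain ⟨n, hn⟩ := hb
    refine ⟨m + n, ?_⟩
    rw [iterate_map_add, Function.iterate_add_apply _ m n b, hn, add_comm m,
      Function.iterate_add_apply _ n m a, hm, iterate_map_zero, iterate_map_zero, add_zero]

/-- In characteristic zero, a subset of `Sym(V)` that is stable under all directional derivatives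
and on which the counit vanishes contains at most the zero element (Taylor expansion). -/
theorem sym_eq_zero_of_symDeriv_stable [CharZero 𝕜] {X : Set S}
    (hX : ∀ f, ∀ x ∈ X, symDeriv f x ∈ X) (h0 : ∀ x ∈ X, Coalgebra.counit (R := 𝕜) x = 0)
    {x : S} (hx : x ∈ X) : x = 0 := by
  classical
  let b := Module.Basis.ofVectorSpace 𝕜 V
  let e := SymmetricAlgebra.equivMvPolynomial b
  have hpd (i) (y : S) : MvPolynomial.pderiv i (e y) = e (symDeriv (b.coord i) y) := by
    induction y using SymmetricAlgebra.induction with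
    | algebraMap r => simp
    | ι y =>
      have hι : (MvPolynomial.pderiv i).toLinearMap ∘ₗ e.toLinearMap ∘ₗ SymmetricAlgebra.ι 𝕜 V =
          Algebra.linearMap 𝕜 _ ∘ₗ b.coord i := by
        refine b.ext fun j => ?_
        have : e (SymmetricAlgebra.ι 𝕜 V (b j)) = MvPolynomial.X j :=
          SymmetricAlgebra.equivMvPolynomial_ι_apply b j
        simp only [LinearMap.comp_apply, AlgEquiv.toLinearMap_apply, this, Derivation.coeFn_coe,
          Module.Basis.coord_apply, Module.Basis.repr_self]
        rw [MvPolynomial.pderiv_X, Finsupp.single_apply, Pi.single_apply]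
        split_ifs <;> simp_all
      simpa using DFunLike.congr_fun hι y
    | mul a b ha hb => simp [ha, hb]
    | add a b ha hb => simp [ha, hb]
  have hc (y : S) : MvPolynomial.coeff 0 (e y) = Coalgebra.counit (R := 𝕜) y := by
    have : (MvPolynomial.aeval fun _ => (0 : 𝕜)).comp e.toAlgHom =
        SymmetricAlgebra.algebraMapInv := by
      refine SymmetricAlgebra.algHom_ext (b.ext fun j => ?_)
      have : e (SymmetricAlgebra.ι 𝕜 V (b j)) = MvPolynomial.X j :=
        SymmetricAlgebra.equivMvPolynomial_ι_apply b j
      simp [this, SymmetricAlgebra.algebraMapInv_ι]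
    have := DFunLike.congr_fun this y
    rw [AlgHom.comp_apply, MvPolynomial.aeval_zero'] at this
    exact this
  have key (n : ℕ) : ∀ m : _ →₀ ℕ, m.degree = n → ∀ y ∈ X, MvPolynomial.coeff m (e y) = 0 := by
    induction n with
    | zero =>
      intro m hm y hy
      obtain rfl := (Finsupp.degree_eq_zero_iff m).1 hm
      rw [hc, h0 y hy]
    | succ n ih =>
      intro m hm y hy
      obtain ⟨i, hi⟩ : ∃ i, m i ≠ 0 := by
        by_contra! h
        obtain rfl : m = 0 := Finsupp.ext h
        simp at hm
      have hmi : m - Finsupp.single i 1 + Finsupp.single i 1 = m :=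
        tsub_add_cancel_of_le (by simpa [Nat.one_le_iff_ne_zero] using hi)
      have hd : (m - Finsupp.single i 1).degree = n := by
        have := congrArg Finsupp.degree hmi
        rw [map_add, hm, Finsupp.degree_single] at this
        omega
      have := ih _ hd _ (hX (b.coord i) y hy)
      rw [← hpd, MvPolynomial.coeff_pderiv, hmi] at this
      exact (mul_eq_zero.1 this).resolve_right (Nat.cast_add_one_ne_zero _)
  exact e.injective (MvPolynomial.ext _ _ fun m => by simpa using key _ m rfl x hx)

end Sym

/-! ### Uniqueness of lifts to `!V` -/

section Bang

variable {𝕜 : Type u} [Field 𝕜] {V : Type u} [AddCommGroup V] [Module 𝕜 V]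

theorem bangD_single (P : V) (x : SymmetricAlgebra 𝕜 V) :
    bangD 𝕜 V (Finsupp.single P x) = Coalgebra.counit (R := 𝕜) x • P + symDegOne 𝕜 V x := by
  simp only [bangD, Finsupp.lsum_single]
  rfl

theorem lTensor_bangD_comul_single (P : V) (x : SymmetricAlgebra 𝕜 V) :
    (bangD 𝕜 V).lTensor (Bang 𝕜 V) (Coalgebra.comul (R := 𝕜) (Finsupp.single P x)) =
      Finsupp.single P x ⊗ₜ P + (Finsupp.lsingle P).rTensor V (splitOff 𝕜 V x) := by
  have key (X : SymmetricAlgebra 𝕜 V ⊗[𝕜] SymmetricAlgebra 𝕜 V) :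
      (bangD 𝕜 V).lTensor (Bang 𝕜 V)
        (TensorProduct.map (Finsupp.lsingle P) (Finsupp.lsingle P) X) =
      Finsupp.single P (TensorProduct.rid 𝕜 _ (Coalgebra.counit.lTensor _ X)) ⊗ₜ P +
        (Finsupp.lsingle P).rTensor V ((symDegOne 𝕜 V).lTensor _ X) := by
    induction X with
    | zero => simp
    | add X Y hX hY => simp only [map_add, hX, hY, Finsupp.single_add, TensorProduct.add_tmul]; abel
    | tmul x y =>
      simp only [TensorProduct.map_tmul, LinearMap.lTensor_tmul, Finsupp.lsingle_apply,
        bangD_single, TensorProduct.tmul_add, TensorProduct.tmul_smul, TensorProduct.rid_tmul,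
        LinearMap.rTensor_tmul]
      rw [← Finsupp.smul_single, TensorProduct.smul_tmul']
  rw [Finsupp.comul_single, key, Coalgebra.lTensor_counit_comul, TensorProduct.rid_tmul, one_smul]
  rfl

/-- The operator `x ↦ x₁ · f(x₂)` on a coalgebra with comultiplication `x ↦ x₁ ⊗ x₂`. -/
noncomputable def coalgContract {C : Type*} [AddCommGroup C] [Module 𝕜 C] [Coalgebra 𝕜 C]
    (f : C →ₗ[𝕜] 𝕜) : C →ₗ[𝕜] C :=
  (TensorProduct.rid 𝕜 C).toLinearMap ∘ₗ f.lTensor C ∘ₗ Coalgebra.comul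

/-- On the summand of `!V` at `P`, contraction with `f ∘ d` is `f(P) + ∂_f`. -/
theorem coalgContract_bangD (f : V →ₗ[𝕜] 𝕜) (x : Bang 𝕜 V) (P : V) :
    coalgContract (f ∘ₗ bangD 𝕜 V) x P = f P • x P + symDeriv f (x P) := by
  induction x using Finsupp.induction_linear with
  | zero => simp
  | add x y hx hy => simp only [map_add, Finsupp.add_apply, hx, hy, smul_add]; abel
  | single Q a =>
    have h : coalgContract (f ∘ₗ bangD 𝕜 V) (Finsupp.single Q a) =
        Finsupp.single Q (f Q • a + symDeriv f a) := by
      simp only [coalgContract, LinearMap.comp_apply, LinearMap.lTensor_comp,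
        lTensor_bangD_comul_single,
        map_add, LinearMap.lTensor_tmul, symDeriv_apply, LinearEquiv.coe_coe,
        TensorProduct.rid_tmul, Finsupp.single_add, Finsupp.smul_single]
      congr 1
      generalize splitOff 𝕜 V a = X
      induction X with
      | zero => simp
      | add X Y hX hY => simp only [map_add, hX, hY, Finsupp.single_add]
      | tmul x y => simp [Finsupp.smul_single]
    rw [h]
    by_cases hPQ : Q = P
    · subst hPQ; simp
    · simp [Finsupp.single_eq_of_ne (Ne.symm hPQ)]

/-- A subspace of `!V` that is stable under contraction with the functionals `f ∘ d` and on which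
the counit vanishes is zero. Contractions shrink the support of an element as long as it has two
points, and on a single summand `Sym(V)` they give all directional derivatives. -/
theorem bang_eq_zero_of_coalgContract_stable [CharZero 𝕜] {Y : Submodule 𝕜 (Bang 𝕜 V)}
    (hY : ∀ f : V →ₗ[𝕜] 𝕜, ∀ y ∈ Y, coalgContract (f ∘ₗ bangD 𝕜 V) y ∈ Y)
    (h0 : ∀ y ∈ Y, Coalgebra.counit (R := 𝕜) y = 0) {y : Bang 𝕜 V} (hy : y ∈ Y) : y = 0 := by
  classical
  -- the operator `T = f ∘ d - f(Q)` on the summand at `P`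
  have hT (f : V →ₗ[𝕜] 𝕜) (Q : V) (n : ℕ) : ∀ y ∈ Y, ∃ z ∈ Y,
      ∀ P, z P = (fun a => (f P - f Q) • a + symDeriv f a)^[n] (y P) := by
    induction n with
    | zero => exact fun y hy => ⟨y, hy, fun P => rfl⟩
    | succ n ih =>
      intro y hy
      obtain ⟨z, hz, hzP⟩ := ih y hy
      refine ⟨coalgContract (f ∘ₗ bangD 𝕜 V) z - f Q • z,
        Y.sub_mem (hY f z hz) (Y.smul_mem _ hz), fun P => ?_⟩
      rw [Function.iterate_succ_apply', ← hzP, Finsupp.sub_apply, coalgContract_bangD,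
        Finsupp.smul_apply, sub_smul]
      abel
  have hone (P : V) (x : SymmetricAlgebra 𝕜 V) (hx : Finsupp.single P x ∈ Y) : x = 0 := by
    refine sym_eq_zero_of_symDeriv_stable (X := {x | Finsupp.single P x ∈ Y}) ?_ ?_ hx
    · intro f x hx
      obtain ⟨z, hz, hzP⟩ := hT f P 1 _ hx
      suffices Finsupp.single P (symDeriv f x) = z by
        rw [← this] at hz
        exact hz
      ext Q : 1
      rw [hzP]
      by_cases hPQ : P = Q
      · subst hPQ; simp
      · simp [Finsupp.single_eq_of_ne (Ne.symm hPQ)]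
    · intro x hx
      simpa using h0 _ hx
  -- `∂_f` is locally nilpotent, hence `c + ∂_f` is injective for `c ≠ 0`
  have hinj (f : V →ₗ[𝕜] 𝕜) (c : 𝕜) (hc : c ≠ 0) (n : ℕ) (a : SymmetricAlgebra 𝕜 V)
      (ha : (fun a => c • a + symDeriv f a)^[n] a = 0) : a = 0 := by
    induction n with
    | zero => simpa using ha
    | succ n ih =>
      refine ih ?_
      rw [Function.iterate_succ_apply'] at ha
      generalize (fun a => c • a + symDeriv f a)^[n] a = b at ha
      have hb : symDeriv f b = -c • b := by
        rw [neg_smul]; exact eq_neg_of_add_eq_zero_right ha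
      have hb' (N : ℕ) : (symDeriv f)^[N] b = (-c) ^ N • b := by
        induction N with
        | zero => simp
        | succ N ihN => rw [Function.iterate_succ_apply', ihN, Derivation.map_smul, hb, smul_smul,
            pow_succ]
      obtain ⟨N, hN⟩ := symDeriv_locally_nilpotent f b
      rw [hb'] at hN
      exact (smul_eq_zero.1 hN).resolve_left (pow_ne_zero _ (neg_ne_zero.2 hc))
  induction hn : y.support.card using Nat.strong_induction_on generalizing y with
  | _ n ih =>
    by_contra hne
    obtain ⟨P, hP⟩ := Finsupp.support_nonempty_iff.2 hne
    by_cases hQ : ∃ Q ∈ y.support, Q ≠ P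
    · obtain ⟨Q, hQ, hQP⟩ := hQ
      obtain ⟨f, hf⟩ : ∃ f : V →ₗ[𝕜] 𝕜, f (P - Q) ≠ 0 := by
        by_contra! h
        exact sub_ne_zero.2 hQP.symm ((Module.forall_dual_apply_eq_zero_iff 𝕜 _).1 h)
      rw [map_sub] at hf
      obtain ⟨N, hN⟩ := symDeriv_locally_nilpotent f (y Q)
      obtain ⟨z, hz, hzP⟩ := hT f Q N y hy
      have hsub : z.support ⊆ y.support.erase Q := by
        intro R hR
        rw [Finsupp.mem_support_iff, hzP] at hR
        refine Finset.mem_erase.2 ⟨?_, ?_⟩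
        · rintro rfl
          refine hR ?_
          simpa using hN
        · rw [Finsupp.mem_support_iff]
          intro h
          refine hR ?_
          rw [h]
          exact Function.iterate_fixed (by simp) N
      have hz0 := ih _ (by
        have := Finset.card_le_card hsub
        rw [Finset.card_erase_of_mem hQ] at this
        have : 0 < y.support.card := Finset.card_pos.2 ⟨Q, hQ⟩
        omega) hz rfl
      rw [Finsupp.mem_support_iff] at hP
      exact hP (hinj f _ hf N _ (by rw [← hzP, hz0]; rfl))
    · push Not at hQ
      have : y = Finsupp.single P (y P) := by
        ext R : 1
        by_cases hR : P = R
        · subst hR; simp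
        · rw [Finsupp.single_eq_of_ne (Ne.symm hR)]
          by_contra h
          exact hR (hQ R (Finsupp.mem_support_iff.2 h)).symm
      rw [this] at hy
      exact hne (by rw [this, hone P _ hy, Finsupp.single_zero])

/-- A morphism of coalgebras to `!V` is determined by its composite with `d`. -/
theorem coalgHom_bang_ext [CharZero 𝕜] {C : Type*} [AddCommGroup C] [Module 𝕜 C] [Coalgebra 𝕜 C]
    {Φ Ψ : C →ₗc[𝕜] Bang 𝕜 V}
    (h : bangD 𝕜 V ∘ₗ Φ.toLinearMap = bangD 𝕜 V ∘ₗ Ψ.toLinearMap) :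
    Φ.toLinearMap = Ψ.toLinearMap := by
  have hcon (Φ : C →ₗc[𝕜] Bang 𝕜 V) (g : Bang 𝕜 V →ₗ[𝕜] 𝕜) (c : C) :
      coalgContract g (Φ.toLinearMap c) =
        Φ.toLinearMap (coalgContract (g ∘ₗ Φ.toLinearMap) c) := by
    have := DFunLike.congr_fun Φ.map_comp_comul c
    simp only [LinearMap.comp_apply] at this
    simp only [coalgContract, LinearMap.comp_apply]
    rw [← this]
    generalize (Coalgebra.comul c : C ⊗[𝕜] C) = X
    induction X with
    | zero => simp
    | add X Y hX hY => simp only [map_add, hX, hY]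
    | tmul x y => simp
  refine LinearMap.ext fun c => sub_eq_zero.1 (bang_eq_zero_of_coalgContract_stable
    (Y := LinearMap.range (Φ.toLinearMap - Ψ.toLinearMap)) ?_ ?_ ⟨c, rfl⟩)
  · rintro f _ ⟨c, rfl⟩
    refine ⟨coalgContract ((f ∘ₗ bangD 𝕜 V) ∘ₗ Φ.toLinearMap) c, ?_⟩
    rw [LinearMap.sub_apply, LinearMap.sub_apply, map_sub, hcon, hcon, LinearMap.comp_assoc,
      LinearMap.comp_assoc, h]
  · rintro _ ⟨c, rfl⟩
    have h1 := DFunLike.congr_fun Φ.counit_comp c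
    have h2 := DFunLike.congr_fun Ψ.counit_comp c
    simp only [LinearMap.comp_apply] at h1 h2
    rw [LinearMap.sub_apply, map_sub, h1, h2, sub_self]

end Bang
end ILL

namespace ILL
universe u w

/-! ### Existence of lifts to `!V` -/

section Exp

open WithConv

variable {𝕜 : Type u} [Field 𝕜] {W : Type u} [AddCommGroup W] [Module 𝕜 W]

local notation "S" => SymmetricAlgebra 𝕜 W

variable (𝕜 W) in
/-- The span of the products of `n` elements of `W` in `Sym(W)`. -/
noncomputable def symPart (n : ℕ) : Submodule 𝕜 (SymmetricAlgebra 𝕜 W) :=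
  LinearMap.range (SymmetricAlgebra.ι 𝕜 W) ^ n

theorem iSup_symPart : ⨆ n, symPart 𝕜 W n = ⊤ := by
  refine eq_top_iff.2 fun x _ => ?_
  have hle (n) : symPart 𝕜 W n ≤ ⨆ n, symPart 𝕜 W n := le_iSup _ n
  induction x using SymmetricAlgebra.induction with
  | algebraMap r =>
    refine hle 0 ?_
    rw [symPart, pow_zero]
    exact Submodule.algebraMap_mem r
  | ι x =>
    refine hle 1 ?_
    rw [symPart, pow_one]
    exact ⟨x, rfl⟩
  | mul a b ha hb =>
    have hab := Submodule.mul_mem_mul (ha trivial) (hb trivial)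
    rw [Submodule.iSup_mul] at hab
    simp only [Submodule.mul_iSup] at hab
    refine SetLike.le_def.1 (iSup_le fun i => iSup_le fun j => ?_) hab
    rw [symPart, symPart, ← pow_add]
    exact hle (i + j)
  | add a b ha hb => exact add_mem (ha trivial) (hb trivial)

/-- The comultiplication of `Sym(W)` is graded. -/
theorem comul_mem_of_mem_symPart {n : ℕ} {x : S} (hx : x ∈ symPart 𝕜 W n) :
    Coalgebra.comul (R := 𝕜) x ∈ Submodule.span 𝕜
      {t | ∃ i j, i + j = n ∧ ∃ a ∈ symPart 𝕜 W i, ∃ b ∈ symPart 𝕜 W j, t = a ⊗ₜ[𝕜] b} := by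
  induction n generalizing x with
  | zero =>
    rw [symPart, pow_zero] at hx
    obtain ⟨r, rfl⟩ := Submodule.mem_one.1 hx
    rw [Bialgebra.comul_algebraMap, Algebra.algebraMap_eq_smul_one]
    refine Submodule.smul_mem _ _ (Submodule.subset_span ⟨0, 0, rfl, 1, ?_, 1, ?_, rfl⟩) <;>
    · rw [symPart, pow_zero]
      exact Submodule.one_le.1 le_rfl
  | succ n ih =>
    rw [symPart, pow_succ] at hx
    induction hx using Submodule.mul_induction_on' with
    | add x _ y _ hx hy => rw [map_add]; exact add_mem hx hy
    | mem_mul_mem a ha b hb =>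
      obtain ⟨b, rfl⟩ := hb
      rw [Bialgebra.comul_mul, SymmetricAlgebra.comul_ι]
      refine Submodule.span_induction
        (p := fun t _ => t * (SymmetricAlgebra.ι 𝕜 W b ⊗ₜ[𝕜] 1 + 1 ⊗ₜ[𝕜] SymmetricAlgebra.ι 𝕜 W b) ∈
          Submodule.span 𝕜 {t | ∃ i j, i + j = n + 1 ∧ ∃ a ∈ symPart 𝕜 W i, ∃ b ∈ symPart 𝕜 W j,
            t = a ⊗ₜ[𝕜] b}) ?_ ?_ ?_ ?_ (ih ha)
      · rintro _ ⟨i, j, rfl, x, hx, y, hy, rfl⟩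
        rw [mul_add, Algebra.TensorProduct.tmul_mul_tmul, Algebra.TensorProduct.tmul_mul_tmul,
          mul_one, mul_one]
        refine add_mem (Submodule.subset_span ⟨i + 1, j, by omega, _, ?_, _, hy, rfl⟩)
          (Submodule.subset_span ⟨i, j + 1, by omega, _, hx, _, ?_, rfl⟩)
        · rw [symPart, pow_succ]; exact Submodule.mul_mem_mul hx ⟨b, rfl⟩
        · rw [symPart, pow_succ]; exact Submodule.mul_mem_mul hy ⟨b, rfl⟩
      · simp
      · intro x y _ _ hx hy; rw [add_mul]; exact add_mem hx hy
      · intro c x _ hx; rw [smul_mul_assoc]; exact Submodule.smul_mem _ _ hx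

variable {A : Type*} [CommRing A] [Algebra 𝕜 A]

/-- Convolution powers of a linear map on `Sym(W)` that vanishes at `1` are locally finite. -/
theorem convPow_eq_zero {f : WithConv (S →ₗ[𝕜] A)} (hf : f 1 = 0) {m n : ℕ} (hmn : m < n)
    {x : S} (hx : x ∈ symPart 𝕜 W m) : (f ^ n) x = 0 := by
  induction n generalizing m x with
  | zero => omega
  | succ n ih =>
    rw [pow_succ, LinearMap.convMul_apply]
    refine Submodule.span_induction (p := fun t _ => LinearMap.mul' 𝕜 A
      (TensorProduct.map (f ^ n).ofConv f.ofConv t) = 0) ?_ ?_ ?_ ?_ (comul_mem_of_mem_symPart hx)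
    · rintro _ ⟨i, j, rfl, a, ha, b, hb, rfl⟩
      rw [TensorProduct.map_tmul, LinearMap.mul'_apply]
      obtain _ | j := j
      · rw [symPart, pow_zero] at hb
        obtain ⟨r, rfl⟩ := Submodule.mem_one.1 hb
        have : f.ofConv (algebraMap 𝕜 S r) = 0 := by
          rw [Algebra.algebraMap_eq_smul_one, map_smul]
          exact (congrArg (r • ·) hf).trans (smul_zero r)
        rw [this, mul_zero]
      · have : (f ^ n).ofConv a = 0 := ih (by omega) ha
        rw [this, zero_mul]
    · simp
    · intro x y _ _ hx hy; rw [map_add, map_add, hx, hy, add_zero]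
    · intro c x _ hx; rw [map_smul, map_smul, hx, smul_zero]

theorem exists_convPow_eq_zero {f : WithConv (S →ₗ[𝕜] A)} (hf : f 1 = 0) (x : S) :
    ∃ N, ∀ n ≥ N, (f ^ n) x = 0 := by
  have hx : x ∈ ⨆ n, symPart 𝕜 W n := iSup_symPart (𝕜 := 𝕜) (W := W) ▸ Submodule.mem_top
  induction hx using Submodule.iSup_induction' with
  | mem i x hx => exact ⟨i + 1, fun n hn => convPow_eq_zero hf hn hx⟩
  | zero => exact ⟨0, fun n _ => map_zero (f ^ n).ofConv⟩
  | add x y _ _ hx hy =>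
    obtain ⟨N, hN⟩ := hx
    obtain ⟨M, hM⟩ := hy
    refine ⟨max N M, fun n hn => ?_⟩
    have : (f ^ n) (x + y) = (f ^ n) x + (f ^ n) y := map_add (f ^ n).ofConv x y
    rw [this, hN n (le_of_max_le_left hn), hM n (le_of_max_le_right hn), add_zero]

theorem exists_convPow_eq_zero_tensor {f : WithConv (S →ₗ[𝕜] A)} (hf : f 1 = 0) (X : S ⊗[𝕜] S) :
    ∃ N, ∀ i j, N ≤ i ∨ N ≤ j → TensorProduct.map (f ^ i).ofConv (f ^ j).ofConv X = 0 := by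
  induction X with
  | zero => exact ⟨0, by simp⟩
  | add X Y hX hY =>
    obtain ⟨N, hN⟩ := hX
    obtain ⟨M, hM⟩ := hY
    refine ⟨max N M, fun i j h => ?_⟩
    rw [map_add, hN i j (by omega), hM i j (by omega), add_zero]
  | tmul x y =>
    obtain ⟨N, hN⟩ := exists_convPow_eq_zero hf x
    obtain ⟨M, hM⟩ := exists_convPow_eq_zero hf y
    refine ⟨max N M, fun i j h => ?_⟩
    rw [TensorProduct.map_tmul]
    obtain h | h := h
    · have : (f ^ i).ofConv x = 0 := hN i (by omega)
      rw [this, TensorProduct.zero_tmul]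
    · have : (f ^ j).ofConv y = 0 := hM j (by omega)
      rw [this, TensorProduct.tmul_zero]

theorem finite_support_convPow {f : WithConv (S →ₗ[𝕜] A)} (hf : f 1 = 0) (x : S) :
    (Function.support fun n : ℕ => (n.factorial : 𝕜)⁻¹ • (f ^ n) x).Finite := by
  obtain ⟨N, hN⟩ := exists_convPow_eq_zero hf x
  refine (Set.finite_lt_nat N).subset fun n hn => ?_
  by_contra h
  exact hn (by simp only [hN n (not_lt.1 h), smul_zero])

/-- The exponential `∑ fⁿ / n!` with respect to convolution of a linear map on `Sym(W)` that
vanishes at `1`. -/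
noncomputable def convExp (f : WithConv (S →ₗ[𝕜] A)) (hf : f 1 = 0) : S →ₗ[𝕜] A where
  toFun x := ∑ᶠ n : ℕ, (n.factorial : 𝕜)⁻¹ • (f ^ n) x
  map_add' x y := by
    rw [← finsum_add_distrib (finite_support_convPow hf x) (finite_support_convPow hf y)]
    refine finsum_congr fun n => ?_
    rw [← smul_add]
    exact congrArg _ (map_add (f ^ n).ofConv x y)
  map_smul' c x := by
    rw [RingHom.id_apply, smul_finsum]
    refine finsum_congr fun n => ?_
    rw [smul_comm c]
    exact congrArg _ (map_smul (f ^ n).ofConv c x)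

theorem convExp_eq_sum {f : WithConv (S →ₗ[𝕜] A)} (hf : f 1 = 0) {x : S} {N : ℕ}
    (hN : ∀ n ≥ N, (f ^ n) x = 0) :
    convExp f hf x = ∑ n ∈ Finset.range N, (n.factorial : 𝕜)⁻¹ • (f ^ n) x := by
  refine finsum_eq_sum_of_support_subset _ fun n hn => ?_
  by_contra h
  exact hn (by simp only [hN n (by simpa using h), smul_zero])

theorem algHom_comp_convPow {B : Type*} [CommRing B] [Algebra 𝕜 B] (h : A →ₐ[𝕜] B)
    (f : WithConv (S →ₗ[𝕜] A)) (n : ℕ) (x : S) :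
    h ((f ^ n) x) = (toConv (h.toLinearMap ∘ₗ f.ofConv) ^ n : WithConv (S →ₗ[𝕜] B)) x := by
  have : h.toLinearMap ∘ₗ (f ^ n).ofConv =
      (toConv (h.toLinearMap ∘ₗ f.ofConv) ^ n : WithConv (S →ₗ[𝕜] B)).ofConv := by
    induction n with
    | zero =>
      ext x
      simp [LinearMap.convOne_apply]
    | succ n ih => rw [pow_succ, LinearMap.algHom_comp_convMul_distrib, ih, pow_succ]
  exact DFunLike.congr_fun this x

variable {V : Type u} [AddCommGroup V] [Module 𝕜 V]

/-- A linear map `Sym(W) → V`, viewed in the convolution algebra of linear maps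
`Sym(W) → Sym(V)`. -/
noncomputable def convι (φ : S →ₗ[𝕜] V) : WithConv (S →ₗ[𝕜] SymmetricAlgebra 𝕜 V) :=
  toConv (SymmetricAlgebra.ι 𝕜 V ∘ₗ φ)

theorem convι_apply (φ : S →ₗ[𝕜] V) (x : S) : convι φ x = SymmetricAlgebra.ι 𝕜 V (φ x) := rfl

theorem convι_one {φ : S →ₗ[𝕜] V} (hφ : φ 1 = 0) : convι φ 1 = 0 := by
  rw [convι_apply, hφ, map_zero]

theorem counit_convι_pow (φ : S →ₗ[𝕜] V) (n : ℕ) (x : S) :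
    Coalgebra.counit (R := 𝕜) ((convι φ ^ (n + 1)) x) = 0 := by
  have h := algHom_comp_convPow (SymmetricAlgebra.algebraMapInv (R := 𝕜) (M := V)) (convι φ)
    (n + 1) x
  have h0 : (toConv ((SymmetricAlgebra.algebraMapInv (R := 𝕜) (M := V)).toLinearMap ∘ₗ
      (convι φ).ofConv) : WithConv (S →ₗ[𝕜] 𝕜)) = 0 := by
    ext y
    exact SymmetricAlgebra.algebraMapInv_ι (φ y)
  rw [h0, zero_pow n.succ_ne_zero] at h
  exact h

theorem symDegOne_convι_pow (φ : S →ₗ[𝕜] V) (n : ℕ) (x : S) :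
    symDegOne 𝕜 V ((convι φ ^ (n + 2)) x) = 0 := by
  rw [pow_succ, LinearMap.convMul_apply]
  generalize (Coalgebra.comul x : S ⊗[𝕜] S) = X
  induction X with
  | zero => simp
  | add X Y hX hY => rw [map_add, map_add, map_add, hX, hY, add_zero]
  | tmul a b =>
    have h1 : Coalgebra.counit (R := 𝕜) ((convι φ ^ (n + 1)).ofConv a) = 0 :=
      counit_convι_pow φ n a
    have h2 : Coalgebra.counit (R := 𝕜) ((convι φ).ofConv b) = 0 :=
      SymmetricAlgebra.counit_ι _ _ _
    rw [TensorProduct.map_tmul, LinearMap.mul'_apply, symDegOne_mul, h1, h2, zero_smul, zero_smul,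
      add_zero]

/-- The terms of the exponential of a map with primitive values satisfy the addition law. -/
theorem comul_convι_pow [CharZero 𝕜] (φ : S →ₗ[𝕜] V) (n : ℕ) (x : S) :
    (n.factorial : 𝕜)⁻¹ • Coalgebra.comul (R := 𝕜) ((convι φ ^ n) x) =
      ∑ p ∈ Finset.HasAntidiagonal.antidiagonal n, ((p.1.factorial : 𝕜)⁻¹ * (p.2.factorial : 𝕜)⁻¹) •
        TensorProduct.map (convι φ ^ p.1).ofConv (convι φ ^ p.2).ofConv
          (Coalgebra.comul (R := 𝕜) x) := by
  let T := SymmetricAlgebra 𝕜 V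
  let i₁ : T →ₐ[𝕜] T ⊗[𝕜] T := Algebra.TensorProduct.includeLeft
  let i₂ : T →ₐ[𝕜] T ⊗[𝕜] T := Algebra.TensorProduct.includeRight
  let f₁ : WithConv (S →ₗ[𝕜] T ⊗[𝕜] T) := toConv (i₁.toLinearMap ∘ₗ (convι φ).ofConv)
  let f₂ : WithConv (S →ₗ[𝕜] T ⊗[𝕜] T) := toConv (i₂.toLinearMap ∘ₗ (convι φ).ofConv)
  have hadd : toConv ((Bialgebra.comulAlgHom 𝕜 T).toLinearMap ∘ₗ (convι φ).ofConv) = f₁ + f₂ := by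
    ext y
    exact SymmetricAlgebra.comul_ι 𝕜 V (φ y)
  have hmul (i j : ℕ) : (f₁ ^ i * f₂ ^ j) x =
      TensorProduct.map (convι φ ^ i).ofConv (convι φ ^ j).ofConv (Coalgebra.comul (R := 𝕜) x) := by
    rw [LinearMap.convMul_apply]
    generalize (Coalgebra.comul x : S ⊗[𝕜] S) = X
    induction X with
    | zero => simp
    | add X Y hX hY => rw [map_add, map_add, map_add, hX, hY]
    | tmul a b =>
      have h1 : (f₁ ^ i).ofConv a = i₁ ((convι φ ^ i).ofConv a) :=
        (algHom_comp_convPow i₁ (convι φ) i a).symm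
      have h2 : (f₂ ^ j).ofConv b = i₂ ((convι φ ^ j).ofConv b) :=
        (algHom_comp_convPow i₂ (convι φ) j b).symm
      rw [TensorProduct.map_tmul, TensorProduct.map_tmul, h1, h2, LinearMap.mul'_apply]
      simp [i₁, i₂]
  have h := algHom_comp_convPow (Bialgebra.comulAlgHom 𝕜 T) (convι φ) n x
  rw [hadd, (Commute.all f₁ f₂).add_pow'] at h
  have happ (s : Finset (ℕ × ℕ)) (g : ℕ × ℕ → WithConv (S →ₗ[𝕜] T ⊗[𝕜] T)) :
      (∑ p ∈ s, g p) x = ∑ p ∈ s, g p x := by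
    induction s using Finset.cons_induction with
    | empty => rfl
    | cons a s ha ih => rw [Finset.sum_cons, Finset.sum_cons, ← ih]; rfl
  rw [happ] at h
  refine (congrArg ((n.factorial : 𝕜)⁻¹ • ·) h).trans ?_
  rw [Finset.smul_sum]
  refine Finset.sum_congr rfl fun p hp => ?_
  obtain ⟨i, j⟩ := p
  obtain rfl := Finset.HasAntidiagonal.mem_antidiagonal.1 hp
  have hs (c : ℕ) (g : WithConv (S →ₗ[𝕜] T ⊗[𝕜] T)) : (c • g) x = (c : 𝕜) • g x := by
    rw [Nat.cast_smul_eq_nsmul]; rfl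
  rw [hs, hmul, smul_smul]
  congr 1
  have h1 : (((i + j).factorial : ℕ) : 𝕜) ≠ 0 := by exact_mod_cast (i + j).factorial_ne_zero
  have h2 : ((i.factorial : ℕ) : 𝕜) ≠ 0 := by exact_mod_cast i.factorial_ne_zero
  have h3 : ((j.factorial : ℕ) : 𝕜) ≠ 0 := by exact_mod_cast j.factorial_ne_zero
  have h4 := congrArg (Nat.cast : ℕ → 𝕜) (Nat.choose_symm_add (a := i) (b := j) ▸
    Nat.add_choose_mul_factorial_mul_factorial i j)
  push_cast at h4
  field_simp
  linear_combination h4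

theorem map_convExp {f : WithConv (S →ₗ[𝕜] A)} (hf : f 1 = 0) (X : S ⊗[𝕜] S) :
    ∃ N, ∀ M ≥ N, TensorProduct.map (convExp f hf) (convExp f hf) X =
      ∑ p ∈ Finset.range M ×ˢ Finset.range M, ((p.1.factorial : 𝕜)⁻¹ * (p.2.factorial : 𝕜)⁻¹) •
        TensorProduct.map (f ^ p.1).ofConv (f ^ p.2).ofConv X := by
  induction X with
  | zero => exact ⟨0, by simp⟩
  | add X Y hX hY =>
    obtain ⟨N, hN⟩ := hX
    obtain ⟨M, hM⟩ := hY
    refine ⟨max N M, fun K hK => ?_⟩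
    rw [map_add, hN K (by omega), hM K (by omega), ← Finset.sum_add_distrib]
    exact Finset.sum_congr rfl fun p _ => by rw [map_add, smul_add]
  | tmul x y =>
    obtain ⟨N, hN⟩ := exists_convPow_eq_zero hf x
    obtain ⟨M, hM⟩ := exists_convPow_eq_zero hf y
    refine ⟨max N M, fun K hK => ?_⟩
    rw [TensorProduct.map_tmul, convExp_eq_sum hf (N := K) fun n hn => hN n (by omega),
      convExp_eq_sum hf (N := K) fun n hn => hM n (by omega), TensorProduct.sum_tmul,
      Finset.sum_product]
    refine Finset.sum_congr rfl fun i _ => ?_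
    rw [TensorProduct.tmul_sum]
    refine Finset.sum_congr rfl fun j _ => ?_
    rw [TensorProduct.map_tmul, TensorProduct.tmul_smul, ← TensorProduct.smul_tmul', smul_smul,
      mul_comm]

/-- The exponential of a map with primitive values is a morphism of coalgebras. -/
theorem exists_coalgHom_sym [CharZero 𝕜] {φ : S →ₗ[𝕜] V} (hφ : φ 1 = 0) :
    ∃ Φ : S →ₗc[𝕜] SymmetricAlgebra 𝕜 V, symDegOne 𝕜 V ∘ₗ Φ.toLinearMap = φ := by
  have hf := convι_one hφ
  have hcounit (x : S) : Coalgebra.counit (R := 𝕜) (convExp (convι φ) hf x) =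
      Coalgebra.counit (R := 𝕜) x := by
    obtain ⟨N, hN⟩ := exists_convPow_eq_zero hf x
    rw [convExp_eq_sum hf (N := N + 1) fun n hn => hN n (by omega), map_sum,
      Finset.sum_range_succ', Finset.sum_eq_zero]
    · simp [LinearMap.convOne_apply]
    · intro n _
      rw [map_smul, counit_convι_pow, smul_zero]
  have hcomul (x : S) : TensorProduct.map (convExp (convι φ) hf) (convExp (convι φ) hf)
      (Coalgebra.comul x) = Coalgebra.comul (R := 𝕜) (convExp (convι φ) hf x) := by
    obtain ⟨N₁, hN₁⟩ := exists_convPow_eq_zero hf x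
    obtain ⟨N₂, hN₂⟩ := exists_convPow_eq_zero_tensor hf (Coalgebra.comul (R := 𝕜) x)
    obtain ⟨N₃, hN₃⟩ := map_convExp hf (Coalgebra.comul (R := 𝕜) x)
    -- both sides are sums of the same terms over pairs `(i, j)`; all terms outside a large square
    -- vanish
    let M := max N₂ N₃
    let K := max N₁ (2 * M)
    rw [hN₃ M (le_max_right _ _), convExp_eq_sum hf (N := K) fun n hn => hN₁ n (by omega), map_sum,
      ← Finset.sum_fiberwise_of_maps_to (s := Finset.range M ×ˢ Finset.range M)
        (t := Finset.range K) (g := fun p => p.1 + p.2)]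
    · refine Finset.sum_congr rfl fun n _ => ?_
      rw [map_smul, comul_convι_pow]
      refine Finset.sum_subset (fun p hp => ?_) fun p hp hp' => ?_
      · exact Finset.HasAntidiagonal.mem_antidiagonal.2 (Finset.mem_filter.1 hp).2
      · have : N₂ ≤ p.1 ∨ N₂ ≤ p.2 := by
          by_contra! h
          refine hp' (Finset.mem_filter.2 ⟨Finset.mem_product.2 ⟨?_, ?_⟩,
            Finset.HasAntidiagonal.mem_antidiagonal.1 hp⟩)
          · exact Finset.mem_range.2 (by omega)
          · exact Finset.mem_range.2 (by omega)
        rw [hN₂ _ _ this, smul_zero]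
    · intro p hp
      simp only [Finset.mem_product, Finset.mem_range] at hp ⊢
      omega
  refine ⟨⟨convExp (convι φ) hf, LinearMap.ext hcounit, LinearMap.ext hcomul⟩, ?_⟩
  ext x
  obtain ⟨N, hN⟩ := exists_convPow_eq_zero hf x
  change symDegOne 𝕜 V (convExp (convι φ) hf x) = _
  rw [convExp_eq_sum hf (N := N + 2) fun n hn => hN n (by omega), map_sum,
    Finset.sum_range_succ', Finset.sum_range_succ', Finset.sum_eq_zero]
  · have h0 : symDegOne 𝕜 V ((convι φ ^ 0) x) = 0 := by
      rw [pow_zero, LinearMap.convOne_apply, Algebra.algebraMap_eq_smul_one, map_smul,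
        symDegOne_one, smul_zero]
    rw [map_smul _ _ ((convι φ ^ 0).ofConv x), h0, smul_zero, add_zero, zero_add, pow_one,
      convι_apply, zero_add, Nat.factorial_one, Nat.cast_one, inv_one, one_smul, symDegOne_ι]
  · intro n _
    rw [map_smul, symDegOne_convι_pow, smul_zero]

/-- A linear map `!W → V` lifts to a morphism of coalgebras `!W → !V`: on the summand `Sym_P(W)`
it is `φ(|∅⟩_P) ε + φ̄` with `φ̄` vanishing at `1`, and its lift is the exponential of `φ̄`, with values
in the summand of `!V` at `φ(|∅⟩_P)`. -/
theorem exists_coalgHom_bang [CharZero 𝕜] (φ : Bang 𝕜 W →ₗ[𝕜] V) :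
    ∃ Φ : Bang 𝕜 W →ₗc[𝕜] Bang 𝕜 V, bangD 𝕜 V ∘ₗ Φ.toLinearMap = φ := by
  let q (P : W) : V := φ (Finsupp.single P 1)
  let ψ (P : W) : S →ₗ[𝕜] V := φ ∘ₗ Finsupp.lsingle P -
    (Coalgebra.counit (R := 𝕜) (A := S)).smulRight (q P)
  have hψ (P : W) : ψ P 1 = 0 := by simp [ψ, q]
  choose Φ hΦ using fun P => exists_coalgHom_sym (hψ P)
  have hcomul (P : W) (x : S) := DFunLike.congr_fun ((Φ P).map_comp_comul) x
  have hcounit (P : W) (x : S) := DFunLike.congr_fun ((Φ P).counit_comp) x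
  refine ⟨⟨Finsupp.lsum 𝕜 fun P => Finsupp.lsingle (q P) ∘ₗ (Φ P).toLinearMap, ?_, ?_⟩, ?_⟩
  · refine Finsupp.lhom_ext fun P x => ?_
    simp
  · refine Finsupp.lhom_ext fun P x => ?_
    simp only [LinearMap.comp_apply, Finsupp.comul_single, Finsupp.lsum_single] at hcomul ⊢
    rw [Finsupp.lsingle_apply, Finsupp.comul_single, ← hcomul]
    generalize (Coalgebra.comul x : S ⊗[𝕜] S) = X
    induction X with
    | zero => simp
    | add X Y hX hY => simp only [map_add, hX, hY]
    | tmul a b => simp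
  · refine Finsupp.lhom_ext fun P x => ?_
    have h1 : symDegOne 𝕜 V ((Φ P).toLinearMap x) = ψ P x := DFunLike.congr_fun (hΦ P) x
    have h2 : Coalgebra.counit (R := 𝕜) ((Φ P).toLinearMap x) = Coalgebra.counit (R := 𝕜) x :=
      hcounit P x
    simp only [LinearMap.comp_apply, Finsupp.lsum_single, Finsupp.lsingle_apply, bangD_single,
      h1, h2]
    simp [ψ]

end Exp
end ILL

namespace ILL
universe u w
open Ctx Proof

/-! ### Lifts out of tensor products of the coalgebras `!V` -/

section Seely

variable (𝕜 : Type u) [Field 𝕜] (V W : Type u) [AddCommGroup V] [Module 𝕜 V] [AddCommGroup W]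
  [Module 𝕜 W]

/-- The isomorphism `Sym(V × W) ≅ Sym(V) ⊗ Sym(W)`. -/
noncomputable def symProd : SymmetricAlgebra 𝕜 (V × W) ≃ₐ[𝕜]
    SymmetricAlgebra 𝕜 V ⊗[𝕜] SymmetricAlgebra 𝕜 W :=
  AlgEquiv.ofAlgHom
    (SymmetricAlgebra.lift <| LinearMap.coprod
      (Algebra.TensorProduct.includeLeft.toLinearMap ∘ₗ SymmetricAlgebra.ι 𝕜 V)
      (Algebra.TensorProduct.includeRight.toLinearMap ∘ₗ SymmetricAlgebra.ι 𝕜 W))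
    (Algebra.TensorProduct.productMap
      (SymmetricAlgebra.lift <| SymmetricAlgebra.ι 𝕜 (V × W) ∘ₗ LinearMap.inl 𝕜 V W)
      (SymmetricAlgebra.lift <| SymmetricAlgebra.ι 𝕜 (V × W) ∘ₗ LinearMap.inr 𝕜 V W))
    (by ext <;> simp)
    (by
      ext x
      · simp
      · simp)

variable {V W} in
theorem symProd_ι (x : V × W) :
    symProd 𝕜 V W (SymmetricAlgebra.ι 𝕜 _ x) =
      SymmetricAlgebra.ι 𝕜 V x.1 ⊗ₜ 1 + 1 ⊗ₜ SymmetricAlgebra.ι 𝕜 W x.2 := by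
  simp [symProd]

variable {V W} in
theorem comul_symProd (x : SymmetricAlgebra 𝕜 (V × W)) :
    Coalgebra.comul (R := 𝕜) (symProd 𝕜 V W x) =
      TensorProduct.map (symProd 𝕜 V W).toLinearMap (symProd 𝕜 V W).toLinearMap
        (Coalgebra.comul (R := 𝕜) x) := by
  have hm (X : SymmetricAlgebra 𝕜 (V × W) ⊗[𝕜] SymmetricAlgebra 𝕜 (V × W)) :
      TensorProduct.map (symProd 𝕜 V W).toLinearMap (symProd 𝕜 V W).toLinearMap X =
        Algebra.TensorProduct.map (symProd 𝕜 V W).toAlgHom (symProd 𝕜 V W).toAlgHom X := rfl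
  rw [hm]
  induction x using SymmetricAlgebra.induction with
  | algebraMap r =>
    rw [Bialgebra.comul_algebraMap, AlgHom.commutes, AlgEquiv.commutes, Bialgebra.comul_algebraMap]
  | ι x =>
    simp only [SymmetricAlgebra.comul_ι, symProd_ι, map_add, TensorProduct.comul_tmul,
      Bialgebra.comul_one, TensorProduct.add_tmul, TensorProduct.tmul_add,
      Algebra.TensorProduct.one_def]
    simp [symProd_ι, TensorProduct.AlgebraTensorModule.tensorTensorTensorComm_eq,
      Algebra.TensorProduct.one_def, TensorProduct.add_tmul, TensorProduct.tmul_add]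
    abel
  | mul a b ha hb => rw [map_mul, Bialgebra.comul_mul, Bialgebra.comul_mul, ha, hb, map_mul]
  | add a b ha hb => rw [map_add, map_add, map_add, ha, hb, map_add]

variable {V W} in
theorem counit_symProd (x : SymmetricAlgebra 𝕜 (V × W)) :
    Coalgebra.counit (R := 𝕜) (symProd 𝕜 V W x) = Coalgebra.counit (R := 𝕜) x := by
  have : (Bialgebra.counitAlgHom 𝕜 (SymmetricAlgebra 𝕜 V ⊗[𝕜] SymmetricAlgebra 𝕜 W)).comp
      (symProd 𝕜 V W).toAlgHom = Bialgebra.counitAlgHom 𝕜 (SymmetricAlgebra 𝕜 (V × W)) := by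
    refine SymmetricAlgebra.algHom_ext (LinearMap.ext fun x => ?_)
    simp [symProd_ι, SymmetricAlgebra.algebraMapInv_ι]
  exact DFunLike.congr_fun this x

/-- The linear isomorphism underlying `!(V × W) ≅ !V ⊗ !W`. -/
noncomputable def bangProd : Bang 𝕜 (V × W) ≃ₗ[𝕜] Bang 𝕜 V ⊗[𝕜] Bang 𝕜 W :=
  (Finsupp.mapRange.linearEquiv (symProd 𝕜 V W).toLinearEquiv).trans
    (finsuppTensorFinsupp 𝕜 𝕜 _ _ V W).symm

variable {V W} in
theorem bangProd_single (P : V × W) (x : SymmetricAlgebra 𝕜 (V × W)) :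
    bangProd 𝕜 V W (Finsupp.single P x) =
      TensorProduct.map (Finsupp.lsingle P.1) (Finsupp.lsingle P.2) (symProd 𝕜 V W x) := by
  simp only [bangProd, LinearEquiv.trans_apply, Finsupp.mapRange.linearEquiv_apply,
    Finsupp.mapRange_single, AlgEquiv.toLinearEquiv_apply]
  generalize symProd 𝕜 V W x = X
  induction X with
  | zero => simp
  | add X Y hX hY => rw [Finsupp.single_add, map_add, map_add, hX, hY]
  | tmul a b => exact finsuppTensorFinsupp_symm_single ..

/-- The isomorphism of coalgebras `!(V × W) ≅ !V ⊗ !W`. -/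
noncomputable def bangProdCoalg : Bang 𝕜 (V × W) ≃ₗc[𝕜] Bang 𝕜 V ⊗[𝕜] Bang 𝕜 W where
  __ := bangProd 𝕜 V W
  counit_comp := by
    refine Finsupp.lhom_ext fun P x => ?_
    change Coalgebra.counit (R := 𝕜) (bangProd 𝕜 V W _) = _
    rw [bangProd_single, Finsupp.counit_single, ← counit_symProd]
    generalize symProd 𝕜 V W x = X
    induction X with
    | zero => simp
    | add X Y hX hY => rw [map_add, map_add, map_add, hX, hY]
    | tmul a b => simp
  map_comp_comul := by
    refine Finsupp.lhom_ext fun P x => ?_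
    change TensorProduct.map (bangProd 𝕜 V W).toLinearMap (bangProd 𝕜 V W).toLinearMap
      (Coalgebra.comul (R := 𝕜) (Finsupp.single P x)) =
        Coalgebra.comul (R := 𝕜) (bangProd 𝕜 V W (Finsupp.single P x))
    rw [bangProd_single, Finsupp.comul_single]
    have h1 (X : SymmetricAlgebra 𝕜 V ⊗[𝕜] SymmetricAlgebra 𝕜 W) :
        Coalgebra.comul (R := 𝕜) (TensorProduct.map
          (Finsupp.lsingle P.1 : _ →ₗ[𝕜] Bang 𝕜 V) (Finsupp.lsingle P.2 : _ →ₗ[𝕜] Bang 𝕜 W) X) =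
        TensorProduct.map
          (TensorProduct.map (Finsupp.lsingle P.1) (Finsupp.lsingle P.2))
          (TensorProduct.map (Finsupp.lsingle P.1) (Finsupp.lsingle P.2))
          (Coalgebra.comul (R := 𝕜) X) := by
      induction X with
      | zero => simp
      | add X Y hX hY => simp only [map_add, hX, hY]
      | tmul a b =>
        simp only [TensorProduct.map_tmul, TensorProduct.comul_tmul, Finsupp.lsingle_apply,
          Finsupp.comul_single]
        generalize (Coalgebra.comul a : SymmetricAlgebra 𝕜 V ⊗[𝕜] _) = Y
        generalize (Coalgebra.comul b : SymmetricAlgebra 𝕜 W ⊗[𝕜] _) = Z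
        induction Y with
        | zero => simp
        | add X Y hX hY => simp only [map_add, TensorProduct.add_tmul, hX, hY]
        | tmul a b =>
          induction Z with
          | zero => simp
          | add X Y hX hY => simp only [map_add, TensorProduct.tmul_add, hX, hY]
          | tmul c d => simp
    rw [h1, comul_symProd]
    generalize (Coalgebra.comul x : SymmetricAlgebra 𝕜 (V × W) ⊗[𝕜] _) = X
    induction X with
    | zero => simp
    | add X Y hX hY => simp only [map_add, hX, hY]
    | tmul a b =>
      simp only [TensorProduct.map_tmul, LinearEquiv.coe_coe, Finsupp.lsingle_apply,
        bangProd_single]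
      rfl

/-- The isomorphism of coalgebras `𝕜 ≅ !0`. -/
noncomputable def bangZero : 𝕜 ≃ₗc[𝕜] Bang 𝕜 PUnit.{u + 1} where
  __ : 𝕜 ≃ₗ[𝕜] Bang 𝕜 PUnit.{u + 1} := LinearEquiv.ofLinearMap
    (LinearMap.toSpanSingleton 𝕜 _ (Finsupp.single 0 1)) Coalgebra.counit (by
      have h : (Algebra.ofId 𝕜 (SymmetricAlgebra 𝕜 PUnit.{u + 1})).comp
          SymmetricAlgebra.algebraMapInv = AlgHom.id 𝕜 _ := by
        refine SymmetricAlgebra.algHom_ext (LinearMap.ext fun x => ?_)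
        rw [Subsingleton.elim x 0, map_zero, map_zero]
      refine Finsupp.lhom_ext fun P x => ?_
      obtain rfl : P = 0 := Subsingleton.elim _ _
      have hx : algebraMap 𝕜 (SymmetricAlgebra 𝕜 PUnit.{u + 1})
          (Coalgebra.counit (R := 𝕜) x) = x := DFunLike.congr_fun h x
      rw [Algebra.algebraMap_eq_smul_one] at hx
      simp [hx]) (by ext; simp)
  counit_comp := by
    refine LinearMap.ext_ring ?_
    change Coalgebra.counit (R := 𝕜) ((1 : 𝕜) • (Finsupp.single 0 1 : Bang 𝕜 PUnit.{u + 1})) = _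
    simp
  map_comp_comul := by
    refine LinearMap.ext_ring ?_
    change ((1 : 𝕜) • (Finsupp.single 0 1 : Bang 𝕜 PUnit.{u + 1})) ⊗ₜ[𝕜] ((1 : 𝕜) • _) =
      Coalgebra.comul (R := 𝕜) ((1 : 𝕜) • (Finsupp.single 0 1 : Bang 𝕜 PUnit.{u + 1}))
    simp [Algebra.TensorProduct.one_def]

end Seely

section Lift

variable {𝕜 : Type u} [Field 𝕜] {α : Type w} {v : α → ModuleCat.{u} 𝕜}

/-- The coalgebra `⟦!Γ⟧` is isomorphic to `!W` for some vector space `W`. -/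
theorem Ctx.exists_bang_equiv : (Γ : Ctx α) → ∃ W : ModuleCat.{u} 𝕜,
    Nonempty (Bang 𝕜 W ≃ₗc[𝕜] Γ.bang.den v)
  | nil => ⟨ModuleCat.of 𝕜 PUnit.{u + 1}, ⟨(bangZero 𝕜).symm⟩⟩
  | single A => ⟨A.den v, ⟨CoalgEquiv.refl 𝕜 (Bang 𝕜 (A.den v))⟩⟩
  | comma Γ Δ => by
    obtain ⟨W, ⟨e⟩⟩ := Ctx.exists_bang_equiv Γ
    obtain ⟨W', ⟨e'⟩⟩ := Ctx.exists_bang_equiv Δ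
    refine ⟨ModuleCat.of 𝕜 (W × W'), ⟨(bangProdCoalg 𝕜 W W').trans ?_⟩⟩
    exact { TensorProduct.congr e.toLinearEquiv e'.toLinearEquiv with
      counit_comp := (Coalgebra.TensorProduct.map e.toCoalgHom e'.toCoalgHom).counit_comp
      map_comp_comul := (Coalgebra.TensorProduct.map e.toCoalgHom e'.toCoalgHom).map_comp_comul }

variable [CharZero 𝕜] {V : Type u} [AddCommGroup V] [Module 𝕜 V]

theorem Ctx.exists_lift {Γ : Ctx α} (φ : Γ.bang.den v →ₗ[𝕜] V) :
    ∃ Φ : Γ.bang.den v →ₗc[𝕜] Bang 𝕜 V, bangD 𝕜 V ∘ₗ Φ.toLinearMap = φ := by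
  obtain ⟨W, ⟨e⟩⟩ := Γ.exists_bang_equiv (v := v)
  obtain ⟨Φ, hΦ⟩ := exists_coalgHom_bang (φ ∘ₗ e.toLinearMap)
  refine ⟨Φ.comp e.symm.toCoalgHom, LinearMap.ext fun x => ?_⟩
  have := DFunLike.congr_fun hΦ (e.symm x)
  simp only [LinearMap.comp_apply] at this
  refine Eq.trans this ?_
  exact congrArg φ (e.apply_symm_apply x)

/-- `cofreeLift` is the lift of a linear map on `⟦!Γ⟧` to a morphism of coalgebras. -/
theorem Ctx.cofreeLift_spec {Γ : Ctx α} (φ : Γ.bang.den v →ₗ[𝕜] V) :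
    ∃ Φ : Γ.bang.den v →ₗc[𝕜] Bang 𝕜 V, Φ.toLinearMap = cofreeLift 𝕜 φ ∧
      bangD 𝕜 V ∘ₗ cofreeLift 𝕜 φ = φ := by
  have h := Ctx.exists_lift φ
  rw [cofreeLift, dif_pos h]
  exact ⟨h.choose, rfl, h.choose_spec⟩

/-- A morphism of coalgebras `⟦!Γ⟧ → !V` is the lift of its composite with `d`. -/
theorem Ctx.eq_cofreeLift {Γ : Ctx α} (Φ : Γ.bang.den v →ₗc[𝕜] Bang 𝕜 V) :
    Φ.toLinearMap = cofreeLift 𝕜 (bangD 𝕜 V ∘ₗ Φ.toLinearMap) := by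
  obtain ⟨Ψ, hΨ, h⟩ := Ctx.cofreeLift_spec (bangD 𝕜 V ∘ₗ Φ.toLinearMap)
  rw [← hΨ] at h ⊢
  exact coalgHom_bang_ext h.symm

end Lift

end ILL

namespace ILL
universe u w
open Ctx Proof

variable {α : Type w} {𝕜 : Type u} [Field 𝕜] {v : α → ModuleCat.{u} 𝕜}

/-! ### Soundness of the semantics -/

section Ext

variable {Γ Δ Θ Ξ : Ctx α} {A B : Formula α} {M : Type*} [AddCommMonoid M] [Module 𝕜 M]

theorem Ctx.tm_ext_assoc {f g : ((Γ ,, Δ) ,, Θ).den v →ₗ[𝕜] M}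
    (h : ∀ x y z, f (tm v (tm v x y) z) = g (tm v (tm v x y) z)) : f = g :=
  TensorProduct.ext_threefold h

theorem Ctx.tm_ext_unassoc {f g : (Γ ,, Δ ,, Θ).den v →ₗ[𝕜] M}
    (h : ∀ x y z, f (tm v x (tm v y z)) = g (tm v x (tm v y z))) : f = g :=
  TensorProduct.ext (LinearMap.ext fun x => tm_ext (Γ := Δ) fun y z => h x y z)

theorem Ctx.tm_ext_right₃ {f g : (Γ ,, Δ ,, Θ ,, Ξ).den v →ₗ[𝕜] M}
    (h : ∀ x y z w, f (tm v x (tm v y (tm v z w))) = g (tm v x (tm v y (tm v z w)))) : f = g :=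
  TensorProduct.ext (LinearMap.ext fun x => tm_ext_unassoc (Γ := Δ) fun y z w => h x y z w)

theorem Ctx.tm_ext_left₃ {f g : ((Γ ,, Δ ,, Θ) ,, Ξ).den v →ₗ[𝕜] M}
    (h : ∀ x y z w, f (tm v (tm v x (tm v y z)) w) = g (tm v (tm v x (tm v y z)) w)) : f = g :=
  TensorProduct.ext (tm_ext_unassoc (Γ := Γ) fun x y z => LinearMap.ext fun w => h x y z w)

theorem Ctx.tm_ext_nil {f g : (Γ ,, nil).den v →ₗ[𝕜] M}
    (h : ∀ x, f (tm v x (one v)) = g (tm v x (one v))) : f = g :=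
  TensorProduct.ext (LinearMap.ext fun x => LinearMap.ext_ring (h x))

theorem Ctx.tm_ext_tensor {f g : (single (A.tensor B) ,, Γ).den v →ₗ[𝕜] M}
    (h : ∀ x y z, f (tm v (Formula.tm v x y) z) =
      g (tm v (Formula.tm v x y) z)) : f = g :=
  TensorProduct.ext_threefold h

theorem Ctx.tm_ext_tensor_left {f g : ((single (A.tensor B) ,, Γ) ,, Δ).den v →ₗ[𝕜] M}
    (h : ∀ x y z w, f (tm v (tm v (Formula.tm v x y) z) w) =
      g (tm v (tm v (Formula.tm v x y) z) w)) : f = g :=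
  TensorProduct.ext (tm_ext_tensor (Γ := Γ) fun x y z => LinearMap.ext fun w => h x y z w)

theorem Ctx.tm_ext_tensor_mid {f g : (Δ ,, single (A.tensor B) ,, Γ).den v →ₗ[𝕜] M}
    (h : ∀ w x y z, f (tm v w (tm v (Formula.tm v x y) z)) =
      g (tm v w (tm v (Formula.tm v x y) z))) : f = g :=
  TensorProduct.ext (LinearMap.ext fun w => tm_ext_tensor (Γ := Γ) fun x y z => h w x y z)

end Ext

section Exponential

variable (𝕜) in
/-- The symmetry of the tensor product of coalgebras. -/
noncomputable def coalgComm (M N : Type*) [AddCommGroup M] [Module 𝕜 M] [Coalgebra 𝕜 M]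
    [AddCommGroup N] [Module 𝕜 N] [Coalgebra 𝕜 N] : M ⊗[𝕜] N ≃ₗc[𝕜] N ⊗[𝕜] M where
  __ := TensorProduct.comm 𝕜 M N
  counit_comp := by ext; simp [mul_comm]
  map_comp_comul := by
    refine TensorProduct.ext' fun x y => ?_
    change TensorProduct.map (TensorProduct.comm 𝕜 M N).toLinearMap
      (TensorProduct.comm 𝕜 M N).toLinearMap (Coalgebra.comul (R := 𝕜) (x ⊗ₜ[𝕜] y)) =
        Coalgebra.comul (R := 𝕜) (y ⊗ₜ[𝕜] x)
    rw [TensorProduct.comul_tmul, TensorProduct.comul_tmul]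
    generalize (Coalgebra.comul x : M ⊗[𝕜] M) = X
    generalize (Coalgebra.comul y : N ⊗[𝕜] N) = Y
    induction X with
    | zero => simp
    | add X X' hX hX' =>
      simp only [TensorProduct.add_tmul, TensorProduct.tmul_add, map_add, hX, hX']
    | tmul a b =>
      induction Y with
      | zero => simp
      | add X X' hX hX' =>
        simp only [TensorProduct.add_tmul, TensorProduct.tmul_add, map_add, hX, hX']
      | tmul c d => rfl

theorem Exch.exists_bang_coalgEquiv : {Γ Δ : Ctx α} → (e : Exch Γ Δ) →
    ∃ E : Γ.bang.den v ≃ₗc[𝕜] Δ.bang.den v, ∀ x, E x = e.bang.den v x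
  | _, _, .refl Γ => ⟨CoalgEquiv.refl 𝕜 _, fun _ => rfl⟩
  | _, _, .symm e => by
    obtain ⟨E, hE⟩ := e.exists_bang_coalgEquiv
    refine ⟨E.symm, fun x => ?_⟩
    change _ = (e.bang.den v).symm x
    rw [LinearEquiv.eq_symm_apply, ← hE]
    exact E.apply_symm_apply x
  | _, _, .trans e f => by
    obtain ⟨E, hE⟩ := e.exists_bang_coalgEquiv
    obtain ⟨F, hF⟩ := f.exists_bang_coalgEquiv
    refine ⟨E.trans F, fun x => ?_⟩
    exact (hF _).trans (congrArg (f.bang.den v) (hE x))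
  | _, _, .congr e f => by
    obtain ⟨E, hE⟩ := e.exists_bang_coalgEquiv
    obtain ⟨F, hF⟩ := f.exists_bang_coalgEquiv
    refine ⟨{ TensorProduct.congr E.toLinearEquiv F.toLinearEquiv with
      counit_comp := (Coalgebra.TensorProduct.map E.toCoalgHom F.toCoalgHom).counit_comp
      map_comp_comul := (Coalgebra.TensorProduct.map E.toCoalgHom F.toCoalgHom).map_comp_comul },
      fun x => ?_⟩
    refine LinearMap.congr_fun (TensorProduct.ext' fun x y => ?_) x
      (f := TensorProduct.map E.toLinearMap F.toLinearMap)
      (g := TensorProduct.map (e.bang.den v).toLinearMap (f.bang.den v).toLinearMap)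
    exact congrArg₂ (· ⊗ₜ ·) (hE x) (hF y)
  | _, _, .comm Γ Δ => ⟨coalgComm 𝕜 (Γ.bang.den v) (Δ.bang.den v), fun _ => rfl⟩
  | _, _, .assoc Γ Δ Θ => ⟨Coalgebra.TensorProduct.assoc 𝕜 𝕜 (Γ.bang.den v) (Δ.bang.den v)
      (Θ.bang.den v), fun _ => rfl⟩
  | _, _, .lunit Γ => ⟨Coalgebra.TensorProduct.lid 𝕜 (Γ.bang.den v), fun _ => rfl⟩

theorem Exch.interchange_symm_tm_cm {Γ Δ : Ctx α} (x : Γ.bang.den v) (y : Δ.bang.den v) :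
    ((Exch.interchange Γ.bang Δ.bang Γ.bang Δ.bang).den v).symm (tm v (Γ.cm v x) (Δ.cm v y)) =
      (Γ ,, Δ).cm v (tm v x y) := by
  have key {Γ Δ : Ctx α} : ((Exch.interchange Γ Δ Γ Δ).den v).symm.toLinearMap =
      (TensorProduct.AlgebraTensorModule.tensorTensorTensorComm 𝕜 𝕜 𝕜 𝕜 (Γ.den v) (Γ.den v)
        (Δ.den v) (Δ.den v)).toLinearMap :=
    TensorProduct.ext (TensorProduct.ext' fun _ _ => TensorProduct.ext' fun _ _ => rfl)
  exact DFunLike.congr_fun key _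

theorem Proof.ev_wks : (Γ : Ctx α) → {Δ : Ctx α} → {B : Formula α} → (θ : Proof Δ B) →
    (x : Γ.bang.den v) → (y : Δ.den v) → (wks Γ θ).ev v (tm v x y) = Γ.cu v x • θ.ev v y
  | nil, Δ, B, θ, x, y => (θ.ev v).map_smul x y
  | single A, _, _, θ, x, y => Proof.ev_wk ..
  | comma Γ₁ Γ₂, Δ, B, θ, x, y => by
    suffices h : (wks (Γ₁ ,, Γ₂) θ).ev v = θ.ev v ∘ₗ TensorProduct.lid 𝕜 (Δ.den v) ∘ₗ
        TensorProduct.map ((Γ₁ ,, Γ₂).cu v) (LinearMap.id : Δ.den v →ₗ[𝕜] Δ.den v) from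
      (DFunLike.congr_fun h (tm v x y)).trans ((θ.ev v).map_smul _ _)
    refine tm_ext_assoc fun x₁ x₂ y => ?_
    refine (Proof.ev_wks Γ₁ _ x₁ (tm v x₂ y)).trans ?_
    rw [Proof.ev_wks Γ₂ _ x₂ y, smul_smul]
    refine Eq.trans ?_ ((θ.ev v).map_smul _ _).symm
    rw [mul_comm]
    rfl

theorem Proof.ev_ctrs : (Γ : Ctx α) → {Δ : Ctx α} → {B : Formula α} →
    (θ : Proof ((Γ.bang ,, Γ.bang) ,, Δ) B) → (x : Γ.bang.den v) → (y : Δ.den v) →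
    (ctrs Γ θ).ev v (tm v x y) = θ.ev v (tm v (Γ.cm v x) y)
  | nil, Δ, B, θ, x, y => rfl
  | single A, _, _, θ, x, y => Proof.ev_ctr ..
  | comma Γ₁ Γ₂, Δ, B, θ, x, y => by
    suffices h : (ctrs (Γ₁ ,, Γ₂) θ).ev v = θ.ev v ∘ₗ TensorProduct.map ((Γ₁ ,, Γ₂).cm v)
        (LinearMap.id : Δ.den v →ₗ[𝕜] Δ.den v) from DFunLike.congr_fun h (tm v x y)
    refine tm_ext_assoc fun x₁ x₂ y => ?_
    change _ = θ.ev v (tm v ((Γ₁ ,, Γ₂).cm v (tm v x₁ x₂)) y)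
    rw [← Exch.interchange_symm_tm_cm]
    have h₁ {Γ₁ Γ₂ : Ctx α} (ρ : Proof (Γ₂ ,, Γ₁ ,, Δ) B) (x₁ : Γ₁.den v) (x₂ : Γ₂.den v) :
        (exch ((Exch.lcomm Γ₂ Γ₁ Δ).trans (Exch.unassoc Γ₁ Γ₂ Δ)) ρ).ev v (tm v (tm v x₁ x₂) y) =
          ρ.ev v (tm v x₂ (tm v x₁ y)) := by simp
    have h₂ {Γ₁ Γ₂ : Ctx α} (ρ : Proof (Γ₁ ,, Γ₂ ,, Δ) B) (x₁ : Γ₁.den v) (x₂ : Γ₂.den v) :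
        (exch (Exch.lcomm Γ₁ Γ₂ Δ) ρ).ev v (tm v x₂ (tm v x₁ y)) =
          ρ.ev v (tm v x₁ (tm v x₂ y)) := by simp
    have h₃ {Γ Γ₁ Γ₂ : Ctx α} (e : Exch Γ (Γ₁ ,, Γ₂)) (ρ : Proof (Γ ,, Δ) B) (x₁ : Γ₁.den v)
        (x₂ : Γ₂.den v) : (exch ((Exch.left e Δ).trans (Exch.assoc Γ₁ Γ₂ Δ)) ρ).ev v
          (tm v x₁ (tm v x₂ y)) = ρ.ev v (tm v ((e.den v).symm (tm v x₁ x₂)) y) := by simp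
    refine (h₁ _ x₁ x₂).trans ?_
    refine (Proof.ev_ctrs Γ₂ _ x₂ (tm v x₁ y)).trans ?_
    refine (h₂ _ x₁ (Γ₂.cm v x₂)).trans ?_
    refine (Proof.ev_ctrs Γ₁ _ x₁ (tm v (Γ₂.cm v x₂) y)).trans ?_
    exact h₃ _ _ _ _

variable [CharZero 𝕜]

/-- Precomposition of a lift with a morphism of coalgebras is the lift of the composite. -/
theorem Ctx.cofreeLift_comp {Γ Δ : Ctx α} {V : Type u} [AddCommGroup V] [Module 𝕜 V]
    (φ : Δ.bang.den v →ₗ[𝕜] V) (F : Γ.bang.den v →ₗc[𝕜] Δ.bang.den v) :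
    cofreeLift 𝕜 φ ∘ₗ F.toLinearMap = cofreeLift 𝕜 (φ ∘ₗ F.toLinearMap) := by
  obtain ⟨Φ, hΦ, h⟩ := Ctx.cofreeLift_spec φ
  have := Ctx.eq_cofreeLift (Φ.comp F)
  change Φ.toLinearMap ∘ₗ F.toLinearMap = cofreeLift 𝕜 (_ ∘ₗ Φ.toLinearMap ∘ₗ F.toLinearMap) at this
  rw [hΦ, ← LinearMap.comp_assoc, h] at this
  exact this

variable {Γ : Ctx α} {A : Formula α}

/-- The denotation of a promotion is a morphism of coalgebras. -/
theorem Proof.exists_coalgHom_prom (π : Proof Γ.bang A) :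
    ∃ Φ : Γ.bang.den v →ₗc[𝕜] Bang 𝕜 (A.den v), Φ.toLinearMap = (prom Γ π).ev v :=
  let ⟨Φ, hΦ, _⟩ := Ctx.cofreeLift_spec (π.ev v)
  ⟨Φ, hΦ⟩

theorem Proof.d_ev_prom (π : Proof Γ.bang A) (x : Γ.bang.den v) :
    A.d v ((prom Γ π).ev v x) = π.ev v x :=
  let ⟨_, _, h⟩ := Ctx.cofreeLift_spec (π.ev v)
  DFunLike.congr_fun h x

theorem Proof.cu_ev_prom (π : Proof Γ.bang A) (x : Γ.bang.den v) :
    A.cu v ((prom Γ π).ev v x) = Γ.cu v x := by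
  obtain ⟨Φ, hΦ⟩ := exists_coalgHom_prom (v := v) π
  rw [← hΦ]
  exact DFunLike.congr_fun Φ.counit_comp x

theorem Proof.cm_ev_prom (π : Proof Γ.bang A) (x : Γ.bang.den v) :
    A.cm v ((prom Γ π).ev v x) =
      TensorProduct.map ((prom Γ π).ev v) ((prom Γ π).ev v) (Γ.cm v x) := by
  obtain ⟨Φ, hΦ⟩ := exists_coalgHom_prom (v := v) π
  rw [← hΦ]
  exact (DFunLike.congr_fun Φ.map_comp_comul x).symm

end Exponential

variable [CharZero 𝕜] in
/-- Proofs that are equivalent under cut-elimination have the same denotation. -/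
theorem CutEquiv.ev_eq {Γ : Ctx α} {A : Formula α} {π π' : Proof Γ A} (h : CutEquiv π π') :
    π.ev v = π'.ev v := by
  induction h with
  | refl π => rfl
  | symm _ ih => exact ih.symm
  | trans _ _ ih ih' => exact ih.trans ih'
  | exch_congr e _ ih => exact LinearMap.ext fun x => by simp [ih]
  | cut_congr _ _ ih ih' => exact tm_ext fun x y => by simp [ih, ih']
  | tensorR_congr _ _ ih ih' => exact tm_ext fun x y => by simp [ih, ih']
  | tensorL_congr _ ih => exact tm_ext_tensor fun x y z => by simp [ih]
  | withR_congr _ _ ih ih' => exact LinearMap.ext fun x => by simp [ih, ih']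
  | withL₁_congr _ ih => exact tm_ext fun x y => by simp [ih]
  | withL₂_congr _ ih => exact tm_ext fun x y => by simp [ih]
  | lolliR_congr _ ih =>
    exact LinearMap.ext fun x => Formula.lolli_ext fun a => by simp [ih]
  | lolliL_congr _ _ ih ih' => exact tm_ext_unassoc fun x y z => by simp [ih, ih']
  | prom_congr _ ih => rw [ev_prom, ev_prom, ih]
  | der_congr _ ih => exact tm_ext fun x y => by simp [ih]
  | wk_congr _ ih => exact tm_ext fun x y => by simp [ih]
  | ctr_congr _ ih => exact tm_ext fun x y => by simp [ih]
  | exch_perm e f h π => exact LinearMap.ext fun x => by simp [Exch.den_eq_of_perm_eq e f h]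
  | exch_refl π => rfl
  | exch_trans e f π => rfl
  | cut_exch_left e π θ => exact tm_ext fun x y => by simp
  | cut_exch_right e π θ => exact tm_ext fun x y => by simp
  | tensorR_exch_left e π θ => exact tm_ext fun x y => by simp
  | tensorR_exch_right e π θ => exact tm_ext fun x y => by simp
  | tensorL_exch e θ => exact tm_ext_tensor fun x y z => by simp
  | withR_exch e π θ => exact LinearMap.ext fun x => by simp
  | withL₁_exch e θ => exact tm_ext fun x y => by simp
  | withL₂_exch e θ => exact tm_ext fun x y => by simp
  | lolliR_exch e π => exact LinearMap.ext fun x => Formula.lolli_ext fun a => by simp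
  | lolliL_exch_left e π θ => exact tm_ext_unassoc fun x y z => by simp
  | lolliL_exch_right e π θ => exact tm_ext_unassoc fun x y z => by simp
  | prom_exch e π =>
    -- an exchange of formulas `!Aᵢ` is an isomorphism of coalgebras, and commutes with lifting
    obtain ⟨E, hE⟩ := e.exists_bang_coalgEquiv (v := v)
    have hs : E.symm.toCoalgHom.toLinearMap = (e.bang.den v).symm.toLinearMap := by
      refine LinearMap.ext fun x => ?_
      change E.symm x = (e.bang.den v).symm x
      rw [LinearEquiv.eq_symm_apply, ← hE]
      exact E.apply_symm_apply x
    have := cofreeLift_comp (π.ev v) E.symm.toCoalgHom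
    rw [hs] at this
    exact this.symm
  | der_exch e θ => exact tm_ext fun x y => by simp
  | wk_exch e θ => exact tm_ext fun x y => by simp
  | ctr_exch e θ => exact tm_ext fun x y => by simp
  | ax_cut θ => exact tm_ext fun x y => by simp
  | cut_ax π => exact tm_ext_nil fun x => by simp
  | cut_assoc π θ ρ => exact tm_ext_assoc fun x y z => by simp
  | cut_comm π θ ρ => exact tm_ext_unassoc fun x y z => by simp
  | eta_tensor A B => exact tensor_tm_ext fun x y => by simp
  | eta_amp A B => exact LinearMap.ext fun x => by simp
  | eta_lolli A B => exact LinearMap.ext fun x => Formula.lolli_ext fun a => by simp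
  | eta_bang A =>
    -- the identity of `!⟦A⟧` is the lift of `d`
    have h := (single A).eq_cofreeLift (CoalgHom.id 𝕜 (Bang 𝕜 (A.den v)))
    refine h.trans (congrArg (cofreeLift 𝕜 (C := (single A).bang.den v)) ?_)
    have hx (x : (single A.bang).den v) : A.d v x = Proof.ev v (exch (Exch.runit (single A.bang))
        (der (exch (Exch.runitInv (single A)) (ax A)))) x := by simp
    exact LinearMap.ext hx
  | cut_tensor π θ ρ => exact tm_ext_assoc fun x y z => by simp
  | cut_amp₁ π θ ρ => exact tm_ext fun x y => by simp
  | cut_amp₂ π θ ρ => exact tm_ext fun x y => by simp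
  | cut_lolli π θ ρ => exact tm_ext_unassoc fun x y z => by simp
  | cut_prom_der π θ => exact tm_ext fun x y => by simp [d_ev_prom]
  | cut_prom_wk π θ => exact tm_ext fun x y => by simp [cu_ev_prom, ev_wks]
  | cut_prom_ctr π θ =>
    rename_i Γ' Δ' A' B'
    refine tm_ext fun x y => ?_
    simp only [ev_cut, ev_ctr, ev_ctrs, cm_ev_prom]
    -- `prom π` is a morphism of coalgebras, so it remains to apply `ρ = prom π` to both copies;
    -- a general `ρ` with context `Γ` avoids unfolding `!Γ'`
    have h {Γ : Ctx α} (ρ : Proof Γ A'.bang) : θ.ev v ∘ₗ (TensorProduct.mk 𝕜 _ _).flip y ∘ₗ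
        TensorProduct.map (ρ.ev v) (ρ.ev v) =
        Proof.ev v (exch (Exch.unassoc Γ Γ Δ') (cut ρ (exch (Exch.lcomm Γ A'.bang Δ')
          (cut ρ (exch ((Exch.assoc A'.bang A'.bang Δ').trans
            (Exch.lcomm A'.bang A'.bang Δ')) θ))))) ∘ₗ (TensorProduct.mk 𝕜 _ _).flip y := by
      refine tm_ext fun x₁ x₂ => ?_
      have h' : Proof.ev v (exch (Exch.unassoc Γ Γ Δ') (cut ρ (exch (Exch.lcomm Γ A'.bang Δ')
          (cut ρ (exch ((Exch.assoc A'.bang A'.bang Δ').trans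
            (Exch.lcomm A'.bang A'.bang Δ')) θ))))) (tm v (tm v x₁ x₂) y) =
          θ.ev v (tm v (tm v (ρ.ev v x₁) (ρ.ev v x₂)) y) := by simp
      exact h'.symm
    exact DFunLike.congr_fun (h (prom Γ' π)) _
  | cut_prom_prom π θ =>
    rename_i Γ' Δ' A' B'
    -- cutting against `prom π` is precomposition with the morphism of coalgebras `Φ ⊗ id`
    obtain ⟨Φ, hΦ⟩ := exists_coalgHom_prom (v := v) π
    let F : (Γ' ,, Δ').bang.den v →ₗc[𝕜] (single A' ,, Δ').bang.den v :=
      Coalgebra.TensorProduct.map Φ (CoalgHom.id 𝕜 (Δ'.bang.den v))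
    have hF : F.toLinearMap =
        TensorProduct.map ((prom Γ' π).ev v) (LinearMap.id : Δ'.bang.den v →ₗ[𝕜] _) := by
      rw [← hΦ]; rfl
    have h := cofreeLift_comp (Γ := Γ' ,, Δ') (Δ := single A' ,, Δ') (θ.ev v) F
    rw [hF] at h
    exact h
  | tensorL_cut θ ρ => exact tm_ext_tensor_left fun x y z w => by simp
  | withL₁_cut θ ρ => exact tm_ext_assoc fun x y z => by simp
  | withL₂_cut θ ρ => exact tm_ext_assoc fun x y z => by simp
  | lolliL_cut π θ ρ => exact tm_ext_left₃ fun x y z w => by simp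
  | der_cut θ ρ => exact tm_ext_assoc fun x y z => by simp
  | wk_cut θ ρ => exact tm_ext_assoc fun x y z => by simp
  | ctr_cut θ ρ => exact tm_ext_assoc fun x y z => by simp
  | cut_tensorR_left π θ ρ => exact tm_ext_unassoc fun x y z => by simp
  | cut_tensorR_right π θ ρ => exact tm_ext_unassoc fun x y z => by simp
  | cut_tensorL π θ => exact tm_ext_tensor_mid fun w x y z => by simp
  | cut_withR π θ ρ => exact tm_ext fun x y => by simp
  | cut_withL₁ π θ => exact tm_ext_unassoc fun x y z => by simp
  | cut_withL₂ π θ => exact tm_ext_unassoc fun x y z => by simp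
  | cut_lolliR π θ => exact tm_ext fun x y => Formula.lolli_ext fun a => by simp
  | cut_lolliL_left π θ ρ => exact tm_ext_right₃ fun x y z w => by simp
  | cut_lolliL_right π θ ρ => exact tm_ext_right₃ fun x y z w => by simp
  | cut_der π θ => exact tm_ext_unassoc fun x y z => by simp
  | cut_wk π θ => exact tm_ext_unassoc fun x y z => by simp
  | cut_ctr π θ => exact tm_ext_unassoc fun x y z => by simp

end ILL

namespace ILL
universe u w
open Ctx Proof

variable {α : Type w} {𝕜 : Type u} [Field 𝕜] {v : α → ModuleCat.{u} 𝕜}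

/-! ### Denotations of derived rules and of plain proofs -/

section Rule

/-- The tensor product of the linear maps `R i : ⟦Γ' i⟧ → ⟦Γ i⟧`. -/
noncomputable def Ctx.joinMap : {r : ℕ} → {Γ Γ' : Fin r → Ctx α} →
    (∀ i, (Γ' i).den v →ₗ[𝕜] (Γ i).den v) → ((Ctx.join Γ').den v →ₗ[𝕜] (Ctx.join Γ).den v)
  | 0, _, _, _ => (LinearMap.id : (nil : Ctx α).den v →ₗ[𝕜] _)
  | _ + 1, Γ, Γ', R =>
      TensorProduct.map (R 0) (Ctx.joinMap (Γ := fun i => Γ i.succ) (Γ' := fun i => Γ' i.succ)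
        fun i => R i.succ)

theorem Ctx.joinMap_tprod : {r : ℕ} → {Γ Γ' : Fin r → Ctx α} →
    (R : ∀ i, (Γ' i).den v →ₗ[𝕜] (Γ i).den v) → (x : ∀ i, (Γ' i).den v) →
    joinMap R (tprod v x) = tprod v fun i => R i (x i)
  | 0, _, _, _, _ => rfl
  | _ + 1, Γ, Γ', R, x =>
    congrArg (tm v (R 0 (x 0))) (Ctx.joinMap_tprod (Γ := fun i => Γ i.succ)
      (Γ' := fun i => Γ' i.succ) (fun i => R i.succ) fun i => x i.succ)

/-- A derived rule that replaces `Γ` by `Γ'` is interpreted by `R : ⟦Γ'⟧ → ⟦Γ⟧` if it acts on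
denotations by precomposition with `R`. -/
def Rule.IsDen {Γ Γ' : Ctx α} (f : Rule Γ Γ') (R : Γ'.den v →ₗ[𝕜] Γ.den v) : Prop :=
  ∀ (Δ : Ctx α) (B : Formula α) (π : Proof (Γ ,, Δ) B) (x : Γ'.den v) (y : Δ.den v),
    (f Δ B π).ev v (tm v x y) = π.ev v (tm v (R x) y)

theorem Rule.IsDen.join : {r : ℕ} → {Γ Γ' : Fin r → Ctx α} → {f : ∀ i, Rule (Γ i) (Γ' i)} →
    {R : ∀ i, (Γ' i).den v →ₗ[𝕜] (Γ i).den v} → (∀ i, (f i).IsDen (R i)) →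
    (Rule.join f).IsDen (joinMap R)
  | 0, _, _, _, _, _ => fun _ _ _ _ _ => rfl
  | _ + 1, Γ, Γ', f, R, h => by
    intro Δ B π x y
    suffices hs : ((Rule.join f) Δ B π).ev v = π.ev v ∘ₗ TensorProduct.map (joinMap R)
        (LinearMap.id : Δ.den v →ₗ[𝕜] Δ.den v) from DFunLike.congr_fun hs (tm v x y)
    refine tm_ext_assoc fun x₀ x y => ?_
    have h₁ {Γ₁ Γ₂ : Ctx α} (ρ : Proof (Γ₂ ,, Γ₁ ,, Δ) B) (x₁ : Γ₁.den v) (x₂ : Γ₂.den v) :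
        (exch ((Exch.lcomm Γ₂ Γ₁ Δ).trans (Exch.unassoc Γ₁ Γ₂ Δ)) ρ).ev v (tm v (tm v x₁ x₂) y) =
          ρ.ev v (tm v x₂ (tm v x₁ y)) := by simp
    have h₂ {Γ₁ Γ₂ : Ctx α} (ρ : Proof (Γ₁ ,, Γ₂ ,, Δ) B) (x₁ : Γ₁.den v) (x₂ : Γ₂.den v) :
        (exch (Exch.lcomm Γ₁ Γ₂ Δ) ρ).ev v (tm v x₂ (tm v x₁ y)) =
          ρ.ev v (tm v x₁ (tm v x₂ y)) := by simp
    have h₃ {Γ₁ Γ₂ : Ctx α} (ρ : Proof ((Γ₁ ,, Γ₂) ,, Δ) B) (x₁ : Γ₁.den v) (x₂ : Γ₂.den v) :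
        (exch (Exch.assoc Γ₁ Γ₂ Δ) ρ).ev v (tm v x₁ (tm v x₂ y)) =
          ρ.ev v (tm v (tm v x₁ x₂) y) := by simp
    refine (h₁ _ x₀ x).trans ?_
    refine (Rule.IsDen.join (Γ := fun i => Γ i.succ) (Γ' := fun i => Γ' i.succ)
      (fun i => h i.succ) _ _ _ x (tm v x₀ y)).trans ?_
    refine (h₂ _ x₀ _).trans ?_
    refine (h 0 _ _ _ x₀ _).trans ?_
    exact h₃ _ _ _

variable (v) in
/-- The iterated comultiplication `!⟦A⟧ → !⟦A⟧^{⊗ m}`. -/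
noncomputable def Formula.copyMap (A : Formula α) :
    (m : ℕ) → ((single A.bang).den v →ₗ[𝕜] (copies m A.bang).den v)
  | 0 => A.cu v
  | m + 1 => TensorProduct.map LinearMap.id (A.copyMap m) ∘ₗ A.cm v

theorem Rule.isDen_ctrWk (A : Formula α) : (m : ℕ) → (Rule.ctrWk A m).IsDen (A.copyMap v m)
  | 0 => fun Δ B π x y => by
    refine (Proof.ev_wk _ x y).trans ?_
    refine ((π.ev v).map_smul _ _).symm.trans (congrArg (π.ev v) ?_)
    refine (Ctx.smul_tm _ _ _).symm.trans (congrArg (fun z => tm v z y) ?_)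
    exact mul_one (A.cu v x)
  | 1 => fun Δ B π x y => by
    have h : A.copyMap v 1 x = tm v x (one v) :=
      Coalgebra.lTensor_counit_comul (R := 𝕜) (A := Bang 𝕜 (A.den v)) x
    rw [h]
    have {Γ : Ctx α} (ρ : Proof ((Γ ,, nil) ,, Δ) B) (x : Γ.den v) :
        (exch (Exch.left (Exch.runit _) Δ) ρ).ev v (tm v x y) =
          ρ.ev v (tm v (tm v x (one v)) y) := by simp
    exact this π x
  | m + 2 => fun Δ B π x y => by
    refine (Proof.ev_ctr _ x y).trans ?_
    have h₁ {Γ₁ Γ₂ : Ctx α} (ρ : Proof (Γ₂ ,, Γ₁ ,, Δ) B) (x₁ : Γ₁.den v) (x₂ : Γ₂.den v) :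
        (exch ((Exch.lcomm Γ₂ Γ₁ Δ).trans (Exch.unassoc Γ₁ Γ₂ Δ)) ρ).ev v (tm v (tm v x₁ x₂) y) =
          ρ.ev v (tm v x₂ (tm v x₁ y)) := by simp
    have h₂ {Γ₁ Γ₂ : Ctx α} (ρ : Proof ((Γ₁ ,, Γ₂) ,, Δ) B) (x₁ : Γ₁.den v) (x₂ : Γ₂.den v) :
        (exch ((Exch.assoc Γ₁ Γ₂ Δ).trans (Exch.lcomm Γ₁ Γ₂ Δ)) ρ).ev v (tm v x₂ (tm v x₁ y)) =
          ρ.ev v (tm v (tm v x₁ x₂) y) := by simp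
    have hs (ρ : Proof ((single A.bang ,, single A.bang) ,, Δ) B)
        (hρ : ∀ x₁ x₂, ρ.ev v (tm v (tm v x₁ x₂) y) =
          π.ev v (tm v (tm v x₁ (A.copyMap v (m + 1) x₂)) y)) :
        ρ.ev v (tm v (A.cm v x) y) = π.ev v (tm v (A.copyMap v (m + 2) x) y) := by
      have hl : ρ.ev v ∘ₗ (TensorProduct.mk 𝕜 _ _).flip y =
          π.ev v ∘ₗ (TensorProduct.mk 𝕜 _ _).flip y ∘ₗ
            TensorProduct.map LinearMap.id (A.copyMap v (m + 1)) := tm_ext hρ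
      exact DFunLike.congr_fun hl (A.cm v x)
    refine hs _ fun x₁ x₂ => ?_
    refine (h₁ _ x₁ x₂).trans ?_
    refine (Rule.isDen_ctrWk A (m + 1) _ _ _ x₂ (tm v x₁ y)).trans ?_
    exact h₂ _ _ _

theorem Rule.isDen_der (A : Formula α) :
    Rule.IsDen (Γ := single A) (Γ' := single A.bang) (fun _ _ θ => der θ) (A.d v) :=
  fun _ _ _ _ _ => rfl

theorem Rule.isDen_cutClosed {A : Formula α} (ρ : Proof nil A) :
    (Rule.cutClosed ρ).IsDen (ρ.ev v) :=
  fun _ _ _ _ _ => rfl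

variable (v) in
/-- The map `!⟦A⟧ → ⟦A⟧^{⊗ m}` which duplicates its input `m` times and applies `d` to each of the
copies. -/
noncomputable def Formula.copyD (A : Formula α) (m : ℕ) :
    (single A.bang).den v →ₗ[𝕜] (copies m A).den v :=
  joinMap (fun _ : Fin m => A.d v) ∘ₗ A.copyMap v m

/-- The copy split off first may be taken to be the second factor of the comultiplication, by
cocommutativity. -/
theorem Formula.copyD_succ (A : Formula α) (m : ℕ) (x : (single A.bang).den v) :
    A.copyD v (m + 1) x = TensorProduct.comm 𝕜 _ _ ((A.copyD v m).rTensor _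
      ((bangD 𝕜 (A.den v)).lTensor _ (Coalgebra.comul (R := 𝕜) (A := Bang 𝕜 (A.den v)) x))) := by
  have h₁ : A.copyD v (m + 1) x = TensorProduct.map (bangD 𝕜 (A.den v)) (A.copyD v m)
      (Coalgebra.comul (R := 𝕜) (A := Bang 𝕜 (A.den v)) x) := by
    refine Eq.trans (b := TensorProduct.map (A.d v) (joinMap fun _ : Fin m => A.d v)
      (TensorProduct.map LinearMap.id (A.copyMap v m) (A.cm v x))) rfl ?_
    exact (DFunLike.congr_fun (TensorProduct.map_comp (A.d v) (joinMap fun _ : Fin m => A.d v)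
      LinearMap.id (A.copyMap v m)) (A.cm v x)).symm
  have h₂ {C V M : Type u} [AddCommGroup C] [Module 𝕜 C] [Coalgebra 𝕜 C]
      [Coalgebra.IsCocomm 𝕜 C] [AddCommGroup V] [Module 𝕜 V] [AddCommGroup M] [Module 𝕜 M]
      (f : C →ₗ[𝕜] V) (g : C →ₗ[𝕜] M) (x : C) :
      TensorProduct.map f g (Coalgebra.comul (R := 𝕜) x) =
        TensorProduct.comm 𝕜 M V (g.rTensor V (f.lTensor C (Coalgebra.comul (R := 𝕜) x))) := by
    conv_lhs => rw [← Coalgebra.comm_comul 𝕜 x]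
    generalize (Coalgebra.comul x : C ⊗[𝕜] C) = X
    induction X with
    | zero => simp
    | add X Y hX hY => simp only [map_add, hX, hY]
    | tmul x y => rfl
  exact h₁.trans (h₂ (C := Bang 𝕜 (A.den v)) _ _ _)

/-- On pure tensors, the rules that turn `π` into a plain proof act by `Formula.copyD` on each
factor. -/
theorem ev_plainForm {r : ℕ} {A : Fin r → Formula α} {B : Formula α} (n : Fin r → ℕ)
    (π : Proof (Ctx.join fun i => Ctx.copies (n i) (A i)) B)
    (x : ∀ i, (single (A i).bang).den v) :
    (plainForm n π).ev v (tprod v x) = π.ev v (tprod v fun i => (A i).copyD v (n i) (x i)) := by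
  have h₁ {Γ : Ctx α} (ρ : Proof (Γ ,, nil) B) (x : Γ.den v) :
      (exch (Exch.runit Γ) ρ).ev v x = ρ.ev v (tm v x (one v)) := by simp
  have h₂ {Γ : Ctx α} (ρ : Proof Γ B) (x : Γ.den v) :
      (exch (Exch.runitInv Γ) ρ).ev v (tm v x (one v)) = ρ.ev v x := by simp
  refine (h₁ _ _).trans ?_
  refine (Rule.IsDen.join (fun i => Rule.isDen_ctrWk (A i) (n i)) _ _ _ _ _).trans ?_
  refine (Rule.IsDen.join (fun i => Rule.IsDen.join fun _ : Fin (n i) =>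
    Rule.isDen_der (A i)) _ _ _ _ _).trans ?_
  refine (h₂ _ _).trans ?_
  refine congrArg (π.ev v) ?_
  refine (congrArg (joinMap fun i => joinMap fun _ : Fin (n i) => (A i).d v)
    (joinMap_tprod _ _)).trans ?_
  exact joinMap_tprod _ _

theorem Exch.joinNil_den_symm : {m : ℕ} → {Γ : Fin m → Ctx α} → (e : ∀ i, Exch (Γ i) nil) →
    ((Exch.joinNil m e).den v).symm (one v) = tprod v fun i => ((e i).den v).symm (one v)
  | 0, _, _ => rfl
  | _ + 1, _, e => congrArg (tm v _) (Exch.joinNil_den_symm fun i => e i.succ)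

/-- Cutting all hypotheses of `π` against closed proofs evaluates `⟦π⟧` on the pure tensor of their
values. -/
theorem vec_plug {r : ℕ} {A : Fin r → Formula α} {B : Formula α} {n : Fin r → ℕ}
    (π : Proof (Ctx.join fun i => Ctx.copies (n i) (A i)) B)
    (ρ : ∀ i, Fin (n i) → Proof nil (A i)) :
    (plug π ρ).vec v = π.ev v (tprod v fun i => tprod v fun c => (ρ i c).vec v) := by
  have h₁ {Γ Δ : Ctx α} (e : Exch Γ Δ) (ρ : Proof (Γ ,, nil) B) (x : Δ.den v) :
      (exch ((Exch.runit Γ).trans e) ρ).ev v x =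
        ρ.ev v (tm v ((e.den v).symm x) (one v)) := by simp
  have h₂ {Γ : Ctx α} (ρ : Proof Γ B) (x : Γ.den v) :
      (exch (Exch.runitInv Γ) ρ).ev v (tm v x (one v)) = ρ.ev v x := by simp
  refine (h₁ _ _ (one v)).trans ?_
  refine (Rule.IsDen.join (fun i => Rule.IsDen.join fun j =>
    Rule.isDen_cutClosed (ρ i j)) _ _ _ _ _).trans ?_
  refine (h₂ _ _).trans ?_
  rw [Exch.joinNil_den_symm, joinMap_tprod]
  refine congrArg (fun x => π.ev v (tprod v x)) (funext fun i => ?_)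
  rw [Exch.joinNil_den_symm, joinMap_tprod]
  rfl

end Rule
end ILL

namespace ILL
universe u w
open Ctx Proof

/-! ### The coefficients -/

section Coeff

/-- The number of errors of each type in a sequence of error types. -/
def errCount {n p : ℕ} (γ : Fin n → Fin (p + 1)) : Fin p → ℕ :=
  fun j => (Finset.univ.filter fun c => γ c = j.succ).card

theorem errCount_cons_zero {n p : ℕ} (γ : Fin n → Fin (p + 1)) :
    errCount (Fin.cons 0 γ : Fin (n + 1) → Fin (p + 1)) = errCount γ := by
  funext j
  simp only [errCount, Finset.card_filter, Fin.sum_univ_succ, Fin.cons_zero, Fin.cons_succ,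
    (Fin.succ_ne_zero j).symm, if_false, zero_add]

theorem errCount_cons_succ {n p : ℕ} (a : Fin p) (γ : Fin n → Fin (p + 1)) :
    errCount (Fin.cons a.succ γ : Fin (n + 1) → Fin (p + 1)) =
      Function.update (errCount γ) a (errCount γ a + 1) := by
  funext j
  obtain rfl | h := eq_or_ne j a
  · simp only [errCount, Finset.card_filter, Fin.sum_univ_succ, Fin.cons_zero, Fin.cons_succ,
      if_true, Function.update_self, add_comm]
  · simp only [errCount, Finset.card_filter, Fin.sum_univ_succ, Fin.cons_zero, Fin.cons_succ,
      Fin.succ_inj, h.symm, if_false, zero_add, Function.update_of_ne h]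

theorem sum_errCount_le {n p : ℕ} (γ : Fin n → Fin (p + 1)) : ∑ j, errCount γ j ≤ n := by
  simp only [errCount, Finset.card_filter]
  rw [Finset.sum_comm]
  refine (Finset.sum_le_card_nsmul _ _ 1 fun c _ => ?_).trans (by simp)
  obtain h | ⟨i, h⟩ := (γ c).eq_zero_or_eq_succ
  · simp [h, (Fin.succ_ne_zero _).symm]
  · simp [h]

variable (𝕜 : Type*) [Field 𝕜]

/-- The factor of the coefficient `S^k_s` for one input. Falling factorials make it vanish
for `s ≰ k`, and for `|k| > n` as long as `|s| ≤ n`. -/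
def errCoeff {p : ℕ} (n : ℕ) (k s : Fin p → ℕ) : 𝕜 :=
  (-1) ^ (∑ j, k j - ∑ j, s j) * ((n - ∑ j, s j).descFactorial (∑ j, k j - ∑ j, s j) : 𝕜) *
    ∏ j, ((k j).descFactorial (s j) : 𝕜)

variable {𝕜} {p : ℕ}

theorem errCoeff_eq_zero {n : ℕ} {k s : Fin p → ℕ} (h : ¬ s ≤ k) : errCoeff 𝕜 n k s = 0 := by
  obtain ⟨j, hj⟩ := not_forall.1 h
  rw [errCoeff, Finset.prod_eq_zero (Finset.mem_univ j), mul_zero]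
  rw [Nat.descFactorial_of_lt (not_le.1 hj), Nat.cast_zero]

theorem sum_update_pred {k : Fin p → ℕ} {j : Fin p} (hj : k j ≠ 0) :
    ∑ i, Function.update k j (k j - 1) i + 1 = ∑ i, k i := by
  rw [Finset.sum_update_of_mem (Finset.mem_univ j),
    ← Finset.add_sum_erase _ k (Finset.mem_univ j), Finset.sdiff_singleton_eq_erase]
  omega

theorem errCoeff_zero (k : Fin p → ℕ) : errCoeff 𝕜 0 k 0 = ∏ j, 0 ^ k j := by
  rw [Finset.prod_pow_eq_pow_sum]
  simp only [errCoeff, Pi.zero_apply, Finset.sum_const_zero, Nat.descFactorial_zero,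
    Nat.sub_zero]
  cases ∑ j, k j <;> simp

/-- The recurrence for a sequence of errors that begins with an error of type `j`. -/
theorem errCoeff_succ_succ (n : ℕ) (k s : Fin p → ℕ) (j : Fin p) :
    errCoeff 𝕜 (n + 1) k (Function.update s j (s j + 1)) =
      k j * errCoeff 𝕜 n (Function.update k j (k j - 1)) s := by
  have hs : ∑ i, Function.update s j (s j + 1) i = ∑ i, s i + 1 := by
    have := sum_update_pred (k := Function.update s j (s j + 1)) (j := j) (by simp)
    simpa using this.symm
  by_cases hj : k j = 0
  · rw [hj, Nat.cast_zero, zero_mul, errCoeff_eq_zero]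
    intro h
    simpa [hj] using h j
  · have hk := sum_update_pred hj
    have hprod : ∏ i, ((k i).descFactorial (Function.update s j (s j + 1) i) : 𝕜) =
        k j * ∏ i, ((Function.update k j (k j - 1) i).descFactorial (s i) : 𝕜) := by
      rw [← Finset.mul_prod_erase _ _ (Finset.mem_univ j),
        ← Finset.mul_prod_erase _ _ (Finset.mem_univ j), ← mul_assoc]
      congr 1
      · obtain ⟨m, hm⟩ := Nat.exists_eq_succ_of_ne_zero hj
        rw [Function.update_self, Function.update_self, hm, Nat.succ_descFactorial_succ,
          Nat.cast_mul]
        rfl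
      · refine Finset.prod_congr rfl fun i hi => ?_
        have := Finset.ne_of_mem_erase hi
        simp [this]
    rw [errCoeff, errCoeff, hs, hprod, ← hk, Nat.add_sub_add_right, Nat.add_sub_add_right]
    ring

/-- The recurrence for a sequence of errors that begins with a correct input. -/
theorem errCoeff_succ {n : ℕ} (k s : Fin p → ℕ) (hn : ∑ j, s j ≤ n) :
    errCoeff 𝕜 (n + 1) k s =
      errCoeff 𝕜 n k s - ∑ j, k j * errCoeff 𝕜 n (Function.update k j (k j - 1)) s := by
  by_cases hsk : s ≤ k
  · have hsum : ∑ j, s j ≤ ∑ j, k j := Finset.sum_le_sum fun j _ => hsk j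
    obtain ⟨N, rfl⟩ := Nat.exists_eq_add_of_le hn
    -- `k (k - 1)^{\underline s} = (k - s) k^{\underline s}`
    have hterm (j : Fin p) :
        k j * errCoeff 𝕜 (∑ j, s j + N) (Function.update k j (k j - 1)) s =
          ((k j - s j : ℕ) : 𝕜) * ((-1) ^ (∑ j, k j - ∑ j, s j - 1) *
            (N.descFactorial (∑ j, k j - ∑ j, s j - 1) : 𝕜) *
              ∏ j, ((k j).descFactorial (s j) : 𝕜)) := by
      by_cases hj : k j = 0
      · simp [hj]
      have hk := sum_update_pred hj
      have hprod : k j * ∏ i, ((Function.update k j (k j - 1) i).descFactorial (s i) : 𝕜) =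
          ((k j - s j : ℕ) : 𝕜) * ∏ i, ((k i).descFactorial (s i) : 𝕜) := by
        rw [← Finset.mul_prod_erase _ _ (Finset.mem_univ j),
          ← Finset.mul_prod_erase _ (fun i => ((k i).descFactorial (s i) : 𝕜))
            (Finset.mem_univ j), ← mul_assoc, ← mul_assoc]
        congr 1
        · obtain ⟨m, hm⟩ := Nat.exists_eq_succ_of_ne_zero hj
          rw [Function.update_self, ← Nat.cast_mul, ← Nat.cast_mul, ← Nat.descFactorial_succ, hm,
            Nat.succ_descFactorial_succ]
          rfl
        · refine Finset.prod_congr rfl fun i hi => ?_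
          have := Finset.ne_of_mem_erase hi
          simp [this]
      have hexp : ∑ i, Function.update k j (k j - 1) i - ∑ j, s j =
          ∑ j, k j - ∑ j, s j - 1 := by omega
      rw [errCoeff, hexp, Nat.add_sub_cancel_left, mul_left_comm, hprod]
      ring
    have hD : ∑ j, ((k j - s j : ℕ) : 𝕜) = ((∑ j, k j - ∑ j, s j : ℕ) : 𝕜) := by
      rw [← Nat.cast_sum, Finset.sum_tsub_distrib _ fun j _ => hsk j]
    simp only [hterm]
    rw [← Finset.sum_mul, hD, errCoeff, errCoeff, add_assoc, Nat.add_sub_cancel_left,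
      Nat.add_sub_cancel_left]
    generalize ∑ j, k j - ∑ j, s j = D
    obtain _ | d := D
    · simp
    have hN : ((N + 1).descFactorial (d + 1) : 𝕜) =
        N.descFactorial (d + 1) + (d + 1) * N.descFactorial d := by
      have : (N + 1).descFactorial (d + 1) =
          N.descFactorial (d + 1) + (d + 1) * N.descFactorial d := by
        rw [Nat.succ_descFactorial_succ, Nat.descFactorial_succ, ← add_mul]
        obtain h | h := le_or_gt d N
        · congr 1; omega
        · simp [Nat.descFactorial_of_lt h]
      rw [this, Nat.cast_add, Nat.cast_mul, Nat.cast_add_one]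
    rw [hN]
    simp only [Nat.add_sub_cancel, pow_succ]
    push_cast
    ring
  · rw [errCoeff_eq_zero hsk, errCoeff_eq_zero hsk, Finset.sum_eq_zero, sub_zero]
    intro j _
    rw [errCoeff_eq_zero, mul_zero]
    exact fun h => hsk (h.trans (update_le_self_iff.2 (Nat.sub_le _ _)))

theorem syndromeCoeff_eq_prod {𝕜 : Type u} [Field 𝕜] [CharZero 𝕜] {r : ℕ} (n : Fin r → ℕ)
    {p : Fin r → ℕ} (k s : ∀ i, Fin (p i) → ℕ) (hsk : s ≤ k) (hs : ∀ i, ∑ j, s i j ≤ n i) :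
    syndromeCoeff 𝕜 n k s = ∏ i, errCoeff 𝕜 (n i) (k i) (s i) := by
  refine Finset.prod_congr rfl fun i _ => ?_
  have hdiv {a b : ℕ} (h : b ≤ a) :
      (a.factorial : 𝕜) / ((a - b).factorial : 𝕜) = a.descFactorial b := by
    rw [div_eq_iff (by exact_mod_cast Nat.factorial_ne_zero _), mul_comm]
    exact_mod_cast (Nat.factorial_mul_descFactorial h).symm
  have hsum : ∑ j, s i j ≤ ∑ j, k i j := Finset.sum_le_sum fun j _ => hsk i j
  have hsi := hs i
  have hprod : ∏ j, ((k i j).factorial : 𝕜) / ((k i j - s i j).factorial : 𝕜) =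
      ∏ j, ((k i j).descFactorial (s i j) : 𝕜) :=
    Finset.prod_congr rfl fun j _ => hdiv (hsk i j)
  rw [hprod, errCoeff]
  split_ifs with h
  · have : n i - ∑ j, k i j = n i - ∑ j, s i j - (∑ j, k i j - ∑ j, s i j) := by omega
    rw [this, hdiv (by omega)]
  · rw [Nat.descFactorial_of_lt (by omega)]
    simp

end Coeff
end ILL

namespace ILL
universe u w
open Ctx Proof

/-! ### Plain proofs evaluated on kets -/

section Ket

variable {𝕜 : Type u} [Field 𝕜] {V : Type u} [AddCommGroup V] [Module 𝕜 V]

theorem derivation_prod {A M ι : Type*} [CommRing A] [Algebra 𝕜 A] [AddCommGroup M] [Module 𝕜 M]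
    [Module A M] [DecidableEq ι] (D : Derivation 𝕜 A M) (s : Finset ι) (f : ι → A) :
    D (∏ i ∈ s, f i) = ∑ i ∈ s, (∏ j ∈ s.erase i, f j) • D (f i) := by
  induction s using Finset.induction_on with
  | empty => simp
  | insert a s ha ih =>
    rw [Finset.prod_insert ha, D.leibniz, ih, Finset.sum_insert ha, Finset.erase_insert ha,
      Finset.smul_sum, add_comm]
    congr 1
    refine Finset.sum_congr rfl fun i hi => ?_
    have hia : a ≠ i := fun h => ha (h ▸ hi)
    rw [Finset.erase_insert_of_ne hia, Finset.prod_insert (fun h => ha (Finset.mem_of_mem_erase h)),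
      mul_smul]

variable (𝕜) in
/-- The ket `|(u₁ - u₀)^{k₁}, …, (u_p - u₀)^{k_p}⟩` at the point `u₀`. -/
noncomputable def errKet {p : ℕ} (u : Fin (p + 1) → V) (k : Fin p → ℕ) : Bang 𝕜 V :=
  Finsupp.single (u 0) (∏ j, SymmetricAlgebra.ι 𝕜 V (u j.succ - u 0) ^ k j)

theorem ket_eq_errKet {p : ℕ} (u : Fin (p + 1) → V) (k : Fin p → ℕ) :
    ket 𝕜 (u 0) (List.ofFn fun j => List.replicate (k j) (u j.succ - u 0)).flatten =
      errKet 𝕜 u k := by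
  rw [ket, errKet, List.map_flatten, List.prod_flatten, List.map_map, List.map_ofFn, List.prod_ofFn]
  simp

theorem counit_errKet {p : ℕ} (u : Fin (p + 1) → V) (k : Fin p → ℕ) :
    Coalgebra.counit (R := 𝕜) (errKet 𝕜 u k) = errCoeff 𝕜 0 k 0 := by
  have h : Coalgebra.counit (R := 𝕜) (errKet 𝕜 u k) =
      SymmetricAlgebra.algebraMapInv (∏ j, SymmetricAlgebra.ι 𝕜 V (u j.succ - u 0) ^ k j) :=
    Finsupp.counit_single ..
  rw [h, errCoeff_zero, map_prod]
  simp [SymmetricAlgebra.algebraMapInv_ι]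

/-- `(id ⊗ d) ∘ Δ` on a ket splits off either the point `u₀` or one of the factors. -/
theorem lTensor_bangD_comul_errKet {p : ℕ} (u : Fin (p + 1) → V) (k : Fin p → ℕ) :
    (bangD 𝕜 V).lTensor _ (Coalgebra.comul (R := 𝕜) (errKet 𝕜 u k)) =
      errKet 𝕜 u k ⊗ₜ u 0 + ∑ j, (k j : 𝕜) •
        errKet 𝕜 u (Function.update k j (k j - 1)) ⊗ₜ[𝕜] (u j.succ - u 0) := by
  rw [errKet, lTensor_bangD_comul_single, derivation_prod, map_sum]
  congr 1
  refine Finset.sum_congr rfl fun j _ => ?_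
  rw [errKet, ← Finset.mul_prod_erase _ (fun i => SymmetricAlgebra.ι 𝕜 V (u i.succ - u 0) ^
    Function.update k j (k j - 1) i) (Finset.mem_univ j), Derivation.leibniz_pow, splitOff_ι,
    Function.update_self]
  have h : ∏ i ∈ Finset.univ.erase j, SymmetricAlgebra.ι 𝕜 V (u i.succ - u 0) ^
      Function.update k j (k j - 1) i =
      ∏ i ∈ Finset.univ.erase j, SymmetricAlgebra.ι 𝕜 V (u i.succ - u 0) ^ k i :=
    Finset.prod_congr rfl fun i hi => by rw [Function.update_of_ne (Finset.ne_of_mem_erase hi)]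
  rw [h, smul_comm, map_nsmul, smul_smul, TensorProduct.smul_tmul', LinearMap.rTensor_tmul,
    Finsupp.lsingle_apply, smul_eq_mul, mul_one, mul_comm, Nat.cast_smul_eq_nsmul]

end Ket

section Plain

variable {α : Type w} {𝕜 : Type u} [Field 𝕜] {v : α → ModuleCat.{u} 𝕜}

theorem sum_cons {M : Type*} [AddCommMonoid M] {n : ℕ} {X : Fin (n + 1) → Type*}
    [∀ i, Fintype (X i)] (f : (∀ i, X i) → M) :
    ∑ γ, f γ = ∑ a : X 0, ∑ γ : ∀ i : Fin n, X i.succ, f (Fin.cons a γ) := by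
  rw [← Fintype.sum_prod_type']
  exact ((Fin.consEquiv X).sum_comp f).symm

/-- Multilinear expansion of a tensor product of linear combinations. -/
theorem Ctx.tprod_sum : {r : ℕ} → {Γ : Fin r → Ctx α} → (X : Fin r → Type) →
    [∀ i, Fintype (X i)] → (c : ∀ i, X i → 𝕜) → (y : ∀ i, X i → (Γ i).den v) →
    tprod v (fun i => ∑ g, c i g • y i g) =
      ∑ γ : ∀ i, X i, (∏ i, c i (γ i)) • tprod v fun i => y i (γ i)
  | 0, _, _, _, _, _ => by
    rw [Fintype.sum_unique, Fin.prod_univ_zero, one_smul]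
    rfl
  | r + 1, Γ, X, _, c, y => by
    rw [sum_cons]
    have ih := Ctx.tprod_sum (Γ := fun i => Γ i.succ) (fun i => X i.succ) (fun i => c i.succ)
      fun i => y i.succ
    refine (congrArg (tm v (∑ g, c 0 g • y 0 g)) ih).trans ?_
    refine (TensorProduct.sum_tmul _ _ _).trans (Finset.sum_congr rfl fun a _ => ?_)
    refine (TensorProduct.tmul_sum _ _ _).trans (Finset.sum_congr rfl fun γ _ => ?_)
    refine (TensorProduct.smul_tmul_smul _ _ _ _).trans ?_
    rw [Fin.prod_univ_succ]
    rfl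

/-- The value of `Formula.copyD` on a ket: expand `d` on each copy of the input into `u₀` or one
of the differences `u_j - u₀`, and collect the coefficients of the tensors of the `u_j`. -/
theorem Formula.copyD_errKet (A : Formula α) {p : ℕ} (u : Fin (p + 1) → (single A).den v) (n : ℕ)
    (k : Fin p → ℕ) :
    A.copyD v n (errKet 𝕜 (V := A.den v) u k) =
      ∑ γ : Fin n → Fin (p + 1), errCoeff 𝕜 n k (errCount γ) •
        tprod v (Γ := fun _ => single A) fun c => u (γ c) := by
  induction n generalizing k with
  | zero =>
    rw [Fintype.sum_unique]
    refine (counit_errKet (𝕜 := 𝕜) (V := A.den v) _ _).trans ?_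
    exact (mul_one (errCoeff 𝕜 0 k 0)).symm
  | succ n ih =>
    have h₁ : A.copyD v (n + 1) (errKet 𝕜 (V := A.den v) u k) =
        Ctx.tm v (Δ := copies n A) (u 0) (A.copyD v n (errKet 𝕜 (V := A.den v) u k)) +
          ∑ j, (k j : 𝕜) • Ctx.tm v (Δ := copies n A) (u j.succ - u 0) (A.copyD v n
            (errKet 𝕜 (V := A.den v) u (Function.update k j (k j - 1)))) := by
      have h {E V M : Type u} [AddCommGroup E] [Module 𝕜 E] [AddCommGroup V] [Module 𝕜 V]
          [AddCommGroup M] [Module 𝕜 M] (g : E →ₗ[𝕜] M) (e₀ : E) (a : V) (e : Fin p → E)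
          (b : Fin p → V) : TensorProduct.comm 𝕜 M V (g.rTensor V
            (e₀ ⊗ₜ a + ∑ j, (k j : 𝕜) • e j ⊗ₜ[𝕜] b j)) =
          a ⊗ₜ g e₀ + ∑ j, (k j : 𝕜) • b j ⊗ₜ[𝕜] g (e j) := by simp
      refine (A.copyD_succ n _).trans ?_
      refine (congrArg (fun X => TensorProduct.comm 𝕜 _ _ ((A.copyD v n).rTensor _ X))
        (lTensor_bangD_comul_errKet (V := A.den v) u k)).trans ?_
      exact h (E := Bang 𝕜 (A.den v)) _ _ _ _ _
    have h₂ {V M : Type u} [AddCommGroup V] [Module 𝕜 V] [AddCommGroup M] [Module 𝕜 M]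
        {ι : Type} [Fintype ι] (u : Fin (p + 1) → V) (Y : ι → M) (c : ι → 𝕜)
        (c' : Fin p → ι → 𝕜) :
        u 0 ⊗ₜ[𝕜] (∑ γ, c γ • Y γ) +
          ∑ j, (k j : 𝕜) • (u j.succ - u 0) ⊗ₜ[𝕜] (∑ γ, c' j γ • Y γ) =
        ∑ γ, (c γ - ∑ j, k j * c' j γ) • u 0 ⊗ₜ[𝕜] Y γ +
          ∑ j, ∑ γ, (k j * c' j γ) • u (Fin.succ j) ⊗ₜ[𝕜] Y γ := by
      simp only [TensorProduct.sub_tmul, TensorProduct.tmul_sum, TensorProduct.tmul_smul,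
        smul_sub, sub_smul, Finset.sum_sub_distrib, Finset.smul_sum, Finset.sum_smul, smul_smul]
      rw [Finset.sum_comm (f := fun γ j => (k j * c' j γ) • u 0 ⊗ₜ[𝕜] Y γ)]
      abel
    rw [h₁, sum_cons, Fin.sum_univ_succ]
    simp only [ih, errCount_cons_zero, errCount_cons_succ, errCoeff_succ_succ,
      errCoeff_succ k _ (sum_errCount_le _)]
    exact h₂ (V := A.den v) u _ _ _

variable [CharZero 𝕜]

/-- The value of a plain proof on a tensor product of kets, as a sum over all error syndromes. -/
theorem ev_plain_errKet {r : ℕ} {A : Fin r → Formula α} {B : Formula α} {n p : Fin r → ℕ}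
    {ψ : Proof (Ctx.join fun i => single (A i).bang) B}
    {π : Proof (Ctx.join fun i => Ctx.copies (n i) (A i)) B} (hψ : CutEquiv ψ (plainForm n π))
    (P : ∀ i, Fin (p i + 1) → Proof nil (A i)) (k : ∀ i, Fin (p i) → ℕ) :
    ψ.ev v (tprod v fun i => errKet 𝕜 (V := (A i).den v) (fun j => (P i j).vec v) (k i)) =
      ∑ γ : Syndrome n p, (∏ i, errCoeff 𝕜 (n i) (k i) (Syndrome.wt γ i)) • (eval π P γ).vec v := by
  rw [hψ.ev_eq]
  refine (ev_plainForm n π _).trans ?_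
  have h : (fun i => (A i).copyD v (n i)
      (errKet 𝕜 (V := (A i).den v) (fun j => (P i j).vec v) (k i))) = _ :=
    funext fun i => (A i).copyD_errKet (fun j => (P i j).vec v) (n i) (k i)
  refine (congrArg (fun x => π.ev v (tprod v x)) h).trans ?_
  refine (congrArg (π.ev v) (Ctx.tprod_sum (Γ := fun i => copies (n i) (A i))
    (fun i => Fin (n i) → Fin (p i + 1)) (fun i γ => errCoeff 𝕜 (n i) (k i) (errCount γ))
    fun i γ => tprod v (Γ := fun _ => single (A i)) fun c => (P i (γ c)).vec v)).trans ?_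
  refine (map_sum (π.ev v) _ _).trans (Finset.sum_congr rfl fun γ _ => ?_)
  refine ((π.ev v).map_smul _ _).trans ?_
  exact congrArg ((∏ i, errCoeff 𝕜 (n i) (k i) (Syndrome.wt γ i)) • ·)
    (vec_plug π fun i c => P i (γ i c)).symm

end Plain
end ILL

theorem mainTheorem2 {𝕜 : Type*} [Field 𝕜] [IsAlgClosed 𝕜] [CharZero 𝕜]
    {α : Type*} (v : α → ModuleCat 𝕜)
    {r : ℕ} (A : Fin r → ILL.Formula α) (B : ILL.Formula α) (n : Fin r → ℕ)
    (ψ : ILL.Proof (ILL.Ctx.join fun i => ILL.Ctx.single (A i).bang) B)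
    (π : ILL.Proof (ILL.Ctx.join fun i => ILL.Ctx.copies (n i) (A i)) B)
    (hψ : ILL.IsPlainWith n ψ π)
    (p : Fin r → ℕ) (P : ∀ i, Fin (p i + 1) → ILL.Proof ILL.Ctx.nil (A i))
    (q : ℕ) (Q : Fin q → ILL.Proof ILL.Ctx.nil B)
    (hQ : LinearIndependent 𝕜 fun τ => (Q τ).vec v)
    (hPQ : ∀ γ : ILL.Syndrome n p, ∃ τ, ILL.CutEquiv (ILL.eval π P γ) (Q τ))
    (k : ∀ i, Fin (p i) → ℕ) :
    ψ.den v (ILL.Ctx.tprod v fun i =>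
        ILL.ket 𝕜 ((P i 0).vec v)
          (List.ofFn fun j => List.replicate (k i j) ((P i j.succ).vec v - (P i 0).vec v)).flatten) =
      ∑ τ, ∑ s ∈ Finset.Icc 0 k,
        (ILL.syndromeCoeff 𝕜 n k s * (ILL.syndromeCount π P s (Q τ) : 𝕜)) • (Q τ).vec v := by
  classical
  choose τ hτ using hPQ
  have hvec (γ : ILL.Syndrome n p) : (ILL.eval π P γ).vec v = (Q (τ γ)).vec v :=
    DFunLike.congr_fun ((hτ γ).ev_eq (v := v)) (ILL.Ctx.one v)
  -- by linear independence of the values, `Q τ` is equivalent to `eval γ` for only one `τ`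
  have hiff (γ : ILL.Syndrome n p) (σ : Fin q) :
      ILL.CutEquiv (ILL.eval π P γ) (Q σ) ↔ τ γ = σ := by
    refine ⟨fun h => hQ.injective ?_, fun h => h ▸ hτ γ⟩
    exact DFunLike.congr_fun (((hτ γ).symm.trans h).ev_eq (v := v)) (ILL.Ctx.one v)
  have hcount (s : ∀ i, Fin (p i) → ℕ) (σ : Fin q) :
      (ILL.syndromeCount π P s (Q σ) : 𝕜) =
        ∑ γ : ILL.Syndrome n p, if γ.wt = s ∧ τ γ = σ then 1 else 0 := by
    rw [ILL.syndromeCount, Nat.card_eq_fintype_card, Fintype.card_subtype, Finset.sum_boole]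
    simp only [hiff]
  simp only [ILL.ket_eq_errKet fun j => (P _ j).vec v]
  refine (ILL.ev_plain_errKet hψ.2 P k).trans ?_
  simp only [hcount, hvec, Finset.mul_sum, Finset.sum_smul]
  -- sum over the error syndromes first; each one contributes to a single `σ` and to a single `s`
  have hswap (F : Fin q → (∀ i, Fin (p i) → ℕ) → ILL.Syndrome n p → B.den v) :
      ∑ σ, ∑ s ∈ Finset.Icc 0 k, ∑ γ, F σ s γ = ∑ γ, ∑ s ∈ Finset.Icc 0 k, ∑ σ, F σ s γ := by
    rw [Finset.sum_comm]
    simp only [Finset.sum_comm (s := (Finset.univ : Finset (Fin q)))]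
    rw [Finset.sum_comm]
  rw [hswap]
  refine Finset.sum_congr rfl fun γ _ => ?_
  have hinner (s : ∀ i, Fin (p i) → ℕ) :
      ∑ σ, (ILL.syndromeCoeff 𝕜 n k s * if γ.wt = s ∧ τ γ = σ then 1 else 0) • (Q σ).vec v =
        if γ.wt = s then ILL.syndromeCoeff 𝕜 n k s • (Q (τ γ)).vec v else 0 := by
    split_ifs with h <;> simp [h]
  simp only [hinner, Finset.sum_ite_eq, Finset.mem_Icc, zero_le, true_and]
  split_ifs with h
  · rw [ILL.syndromeCoeff_eq_prod n k _ h fun i => ILL.sum_errCount_le (γ i)]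
  · obtain ⟨i, hi⟩ := not_forall.1 h
    rw [Finset.prod_eq_zero (Finset.mem_univ i) (ILL.errCoeff_eq_zero hi), zero_smul]
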